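/- Let $k$ be an algebraically closed field of characteristic $0$, let $R$ be a discrete valuation ring (not necessarily complete) that is a $k$-algebra, with uniformiser $\pi$, and let $X$ be a smooth projective (integral) three-fold over $k$. Write $X_R = X\otimes_k R$ and, for $m\ge 1$, $X_m = X\otimes_k R/(\pi^m)$; let $\iota_m : X_m\to X_R$ and, for $1\le m'<m$, $\iota_{m,m'} : X_{m'}\to X_m$ be the natural closed immersions. For a locally Noetherian scheme $Y$ let $D(Y)$ be the unbounded and $D^-(Y)$ the bounded above derived category of $\mathrm{Coh}(Y)$. Let $\mathrm{Coh}_{\le 1}(Y)\subset\mathrm{Coh}(Y)$ be the coherent sheaves with support of dimension at most $1$ and $\mathrm{Coh}_{\ge 2}(Y)$ the coherent sheaves $E$ with $\mathrm{Hom}(F,E)=0$ for all $F\in\mathrm{Coh}_{\le 1}(Y)$. For every $m\ge1$ there is a (necessarily unique) t-structure on $D(X_m)$ with $$D^{\le 0}=\{E : H^0(E)\in\mathrm{Coh}_{\le1}(X_m),\ H^i(E)=0\ \text{for } i>0\},\qquad D^{\ge 0}=\{E : H^{-1}(E)\in\mathrm{Coh}_{\ge2}(X_m),\ H^i(E)=0\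 \text{for } i<-1\}.$$ Let $\mathcal A^p_m\subset D^-(X_m)$ be its heart and $\mathcal H^0_{\mathcal A^p_m}=\tau^{\le0}\tau^{\ge0}:D(X_m)\to\mathcal A^p_m$ its cohomology functor. The total left derived functors $L\iota_m^*:D^-(X_R)\to D^-(X_m)$ and $L\iota_{m,m'}^*:D^-(X_m)\to D^-(X_{m'})$ of the pullbacks of coherent sheaves exist, and the following hold. (a) For every $m\ge1$ there is an isomorphism of functors $\mathcal A^p_m\to\mathcal A^p_m$ $$\mathcal H^0_{\mathcal A^p_m}\, L\iota_m^*\,{\iota_m}_*\;\cong\;\mathrm{id}_{\mathcal A^p_m}.$$ (b) For all $1\le m'<m$ there is an isomorphism of functors $\mathcal A^p_{m'}\to\mathcal A^p_{m'}$ $$\mathcal H^0_{\mathcal A^p_{m'}}\, L\iota_{m,m'}^*\,{\iota_{m,m'}}_*\;\cong\;\mathrm{id}_{\mathcal A^p_{m'}}.$$ -/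

import Mathlib

open CategoryTheory Limits AlgebraicGeometry TopologicalSpace ZeroObject Pretriangulated Triangulated

universe u

noncomputable section

section
namespace AlgebraicGeometry.Scheme.Modules

variable {X : Scheme.{u}}

/-- Transport of a presentation along an isomorphism. -/
def presentationOfIso {M N : X.Modules} (e : M ≅ N) (P : SheafOfModules.Presentation.{u} M) :
    SheafOfModules.Presentation.{u} N :=
  @SheafOfModules.Presentation.ofIsIso.{u, u, u} _ _ _ _ _ _ M N e.hom (Iso.isIso_hom e) P

def presentationOver (M : X.Modules) (U : X.Opens)
    (P : SheafOfModules.Presentation.{u} (M.restrict U.ι)) :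
    SheafOfModules.Presentation.{u} (SheafOfModules.over M U) := by
  let E : (U : Scheme.{u}).Modules ≌ SheafOfModules (X.ringCatSheaf.over U) := (overEquiv U).symm
  let F : SheafOfModules (U : Scheme.{u}).ringCatSheaf ⥤ SheafOfModules (X.ringCatSheaf.over U) :=
    E.functor
  haveI : PreservesColimitsOfSize.{u, u} F :=
    E.toAdjunction.leftAdjoint_preservesColimits
  let e : E.functor.obj (M.restrict U.ι) ≅ SheafOfModules.over M U :=
    (overEquiv U).inverse.mapIso ((overFunctorEquiv U).symm.app M) ≪≫
      ((overEquiv U).unitIso.symm.app _)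
  exact SheafOfModules.Presentation.ofIsIso.{u, u, u} e.hom
    (SheafOfModules.Presentation.map.{u} P F
      (Opens.sheafOfModulesEquivOverInverseUnit U X.ringCatSheaf).symm)

/-- A presentation on an open immersion gives one on its range. -/
def presentationOpensRange {Y : Scheme.{u}} (f : Y ⟶ X) [IsOpenImmersion f] (M : X.Modules)
    (P : SheafOfModules.Presentation.{u} (M.restrict f)) :
    SheafOfModules.Presentation.{u} (M.restrict f.opensRange.ι) :=
  presentationOfIso
    (((restrictFunctorComp f.isoOpensRange.inv f).symm ≪≫
      restrictFunctorCongr (by simp)).app M)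
    (presentationRestrict f.isoOpensRange.inv P)

theorem isQuasicoherent_of_presentation_cover (M : X.Modules) {I : Type u} {Y : I → Scheme.{u}}
    (f : ∀ i, Y i ⟶ X) [∀ i, IsOpenImmersion (f i)] (hf : ∀ x, ∃ i, x ∈ (f i).opensRange)
    (P : ∀ i, SheafOfModules.Presentation.{u} (M.restrict (f i))) :
    SheafOfModules.IsQuasicoherent.{u} M :=
  SheafOfModules.QuasicoherentData.isQuasicoherent.{u}
    { I := I
      X := fun i => (f i).opensRange
      coversTop := (Opens.coversTop_iff _ _).2 (by
        rw [IsOpenCover, eq_top_iff]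
        intro x _
        simpa using hf x)
      presentation := fun i => presentationOver M _ (presentationOpensRange (f i) M (P i)) }

theorem isQuasicoherent_of_cover (M : X.Modules) {I : Type u} {Y : I → Scheme.{u}}
    (f : ∀ i, Y i ⟶ X) [∀ i, IsOpenImmersion (f i)] (hf : ∀ x, ∃ i, x ∈ (f i).opensRange)
    (h : ∀ i, SheafOfModules.IsQuasicoherent.{u} (M.restrict (f i))) :
    SheafOfModules.IsQuasicoherent.{u} M := by
  choose 𝒰 h𝒰 using fun i => exists_affineOpenCover_presentation (M.restrict (f i))
  refine isQuasicoherent_of_presentation_cover M (I := Σ i, (𝒰 i).I₀)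
    (fun j => (𝒰 j.1).f j.2 ≫ f j.1) ?_ (fun j => ?_)
  · intro x
    obtain ⟨i, y, rfl⟩ := hf x
    obtain ⟨k, z, hz⟩ := (𝒰 i).openCover.exists_eq y
    exact ⟨⟨i, k⟩, z, congrArg (f i) hz⟩
  · exact presentationOfIso
      ((restrictFunctorComp ((𝒰 j.1).f j.2) (f j.1)).symm.app M) (h𝒰 j.1 j.2).some
end AlgebraicGeometry.Scheme.Modules

end

section
namespace AlgebraicGeometry.Scheme.Modules

variable {X : Scheme.{u}}

lemma image_fromSpec_le {U : X.Opens} (hU : IsAffineOpen U) (V : (Spec Γ(X, U)).Opens) :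
    hU.fromSpec ''ᵁ V ≤ U := by
  have := hU.opensRange_fromSpec
  exact (Scheme.Hom.image_le_opensRange _ _).trans this.le

lemma fromSpec_appIso_inv {U : X.Opens} (hU : IsAffineOpen U) (V : (Spec Γ(X, U)).Opens) :
    (ΓSpecIso Γ(X, U)).inv ≫ (Spec Γ(X, U)).presheaf.map V.leTop.op ≫ (hU.fromSpec.appIso V).inv
      = X.presheaf.map (homOfLE (image_fromSpec_le hU V)).op := by
  have h := hU.fromSpec_app_self
  have h2 : (ΓSpecIso Γ(X, U)).inv = hU.fromSpec.app U ≫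
      (Spec Γ(X, U)).presheaf.map (eqToHom hU.fromSpec_preimage_self.symm).op := by
    rw [h, Category.assoc, ← Functor.map_comp]
    simp
  rw [h2, Category.assoc, ← Functor.map_comp_assoc]
  have h3 := Scheme.Hom.appLE_appIso_inv hU.fromSpec (U := U) (V := V)
    (by rw [hU.fromSpec_preimage_self]; exact le_top)
  rw [← h3, Scheme.Hom.appLE, Category.assoc]
  rfl

lemma smul_fromSpec {U : X.Opens} (hU : IsAffineOpen U) (M : X.Modules)
    (V : (Spec Γ(X, U)).Opens) (a : Γ(X, U)) (x : Γ(M.restrict hU.fromSpec, V)) :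
    (M.restrictAppIso hU.fromSpec V).hom (a • x) =
      X.presheaf.map (homOfLE (image_fromSpec_le hU V)).op a •
        (M.restrictAppIso hU.fromSpec V).hom x := by
  rw [smul_Spec_def, smul_restrictAppIso_hom_apply, ← fromSpec_appIso_inv hU V]
  rfl

/-- Every section over `D(f)` extends to `U` after multiplication by a power of `f`, and
every section over `U` that vanishes on `D(f)` is killed by a power of `f`. -/
structure IsLocalizingOn (M : X.Modules) (U : X.Opens) : Prop where
  exists_lift (f : Γ(X, U)) (s : Γ(M, X.basicOpen f)) : ∃ (n : ℕ) (t : Γ(M, U)),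
    M.presheaf.map (homOfLE (X.basicOpen_le f)).op t =
      X.presheaf.map (homOfLE (X.basicOpen_le f)).op (f ^ n) • s
  exists_pow_smul (f : Γ(X, U)) (t : Γ(M, U)) :
    M.presheaf.map (homOfLE (X.basicOpen_le f)).op t = 0 → ∃ n : ℕ, f ^ n • t = 0

/-- Comparison of sections on the spectrum of an affine open with sections on the scheme. -/
def fromSpecIso {U : X.Opens} (hU : IsAffineOpen U) (M : X.Modules)
    (V : (Spec Γ(X, U)).Opens) (W : X.Opens) (h : hU.fromSpec ''ᵁ V = W) :
    Γ(M.restrict hU.fromSpec, V) ≅ Γ(M, W) :=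
  M.restrictAppIso hU.fromSpec V ≪≫ M.presheaf.mapIso (eqToIso h.symm).op

lemma fromSpecIso_smul {U : X.Opens} (hU : IsAffineOpen U) (M : X.Modules)
    (V : (Spec Γ(X, U)).Opens) (W : X.Opens) (h : hU.fromSpec ''ᵁ V = W) (hW : W ≤ U)
    (a : Γ(X, U)) (x : Γ(M.restrict hU.fromSpec, V)) :
    (fromSpecIso hU M V W h).hom (a • x) =
      X.presheaf.map (homOfLE hW).op a • (fromSpecIso hU M V W h).hom x := by
  subst h
  have := smul_fromSpec hU M V a x
  simpa [fromSpecIso] using this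

lemma fromSpecIso_map {U : X.Opens} (hU : IsAffineOpen U) (M : X.Modules)
    (V V' : (Spec Γ(X, U)).Opens) (W W' : X.Opens) (h : hU.fromSpec ''ᵁ V = W)
    (h' : hU.fromSpec ''ᵁ V' = W') (hV : V' ≤ V) (hW : W' ≤ W)
    (x : Γ(M.restrict hU.fromSpec, V)) :
    (fromSpecIso hU M V' W' h').hom ((M.restrict hU.fromSpec).presheaf.map (homOfLE hV).op x) =
      M.presheaf.map (homOfLE hW).op ((fromSpecIso hU M V W h).hom x) := by
  subst h h'
  have := congr($(map_restrictAppIso_hom (f := hU.fromSpec) M (homOfLE hV).op) x)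
  simpa [fromSpecIso] using this

lemma fromSpec_image_top {U : X.Opens} (hU : IsAffineOpen U) : hU.fromSpec ''ᵁ ⊤ = U := by
  simp

/-- An explicit form of the criterion for `M` to be of the form `N^~`. -/
lemma isIso_fromTildeΓ_iff_exists {R : CommRingCat.{u}} (M : (Spec R).Modules) :
    IsIso M.fromTildeΓ ↔ ∀ (f : R) (D : (Spec R).Opens), D = PrimeSpectrum.basicOpen f →
      (∀ s : Γ(M, D), ∃ (n : ℕ) (t : Γ(M, ⊤)),
        M.presheaf.map (homOfLE (le_top : D ≤ ⊤)).op t = f ^ n • s) ∧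
      (∀ t : Γ(M, ⊤), M.presheaf.map (homOfLE (le_top : D ≤ ⊤)).op t = 0 →
        ∃ n : ℕ, f ^ n • t = 0) := by
  rw [isIso_fromTildeΓ_iff_isLocalizing]
  constructor
  · rintro h f _ rfl
    have h1 := h f
    refine ⟨fun s => ?_, fun t ht => ?_⟩
    · obtain ⟨⟨t, ⟨_, n, rfl⟩⟩, ht⟩ := h1.surj s
      exact ⟨n, t, ht.symm⟩
    · obtain ⟨⟨_, n, rfl⟩, hn⟩ := (IsLocalizedModule.eq_zero_iff (.powers f)
        ((modulesSpecToSheaf.obj M).obj.map (PrimeSpectrum.basicOpen f).leTop.op).hom).1 ht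
      exact ⟨n, hn⟩
  · intro h f
    obtain ⟨h1, h2⟩ := h f (PrimeSpectrum.basicOpen f) rfl
    refine IsLocalizedModule.Away.mk_of_addCommGroup ?_ ?_ ?_
    · exact isUnit_algebraMap_end_of_le_basicOpen f le_rfl
    · intro s
      obtain ⟨n, t, ht⟩ := h1 s
      exact ⟨n, t, ht.symm⟩
    · intro t ht
      exact h2 t ht

theorem IsLocalizingOn.iff_isIso_fromTildeΓ (M : X.Modules) {U : X.Opens} (hU : IsAffineOpen U) :
    M.IsLocalizingOn U ↔ IsIso (M.restrict hU.fromSpec).fromTildeΓ := by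
  rw [isIso_fromTildeΓ_iff_exists]
  have et := fromSpec_image_top hU
  constructor
  · rintro h f D rfl
    have ef := hU.fromSpec_image_basicOpen f
    generalize hD : (PrimeSpectrum.basicOpen f : (Spec Γ(X, U)).Opens) = D at ef ⊢
    refine ⟨fun s => ?_, fun t ht => ?_⟩
    · obtain ⟨n, t, ht⟩ := h.exists_lift f ((fromSpecIso hU M _ _ ef).hom s)
      refine ⟨n, (fromSpecIso hU M _ _ et).inv t, ?_⟩
      apply (ConcreteCategory.bijective_of_isIso (fromSpecIso hU M _ _ ef).hom).1
      rw [fromSpecIso_smul hU M _ _ ef (X.basicOpen_le f),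
        fromSpecIso_map hU M _ _ _ _ et ef le_top (X.basicOpen_le f), ← ht]
      simp
    · have h3 := congrArg (fromSpecIso hU M _ _ ef).hom ht
      rw [fromSpecIso_map hU M _ _ _ _ et ef le_top (X.basicOpen_le f), map_zero] at h3
      obtain ⟨n, hn⟩ := h.exists_pow_smul f _ h3
      refine ⟨n, ?_⟩
      apply (ConcreteCategory.bijective_of_isIso (fromSpecIso hU M _ _ et).hom).1
      rw [fromSpecIso_smul hU M _ _ et le_rfl, map_zero]
      simpa using hn
  · intro h
    constructor
    · intro f s
      have ef := hU.fromSpec_image_basicOpen f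
      generalize hD : (PrimeSpectrum.basicOpen f : (Spec Γ(X, U)).Opens) = D at ef
      obtain ⟨n, t, ht⟩ := (h f D hD.symm).1 ((fromSpecIso hU M _ _ ef).inv s)
      refine ⟨n, (fromSpecIso hU M _ _ et).hom t, ?_⟩
      have h2 := congrArg (fromSpecIso hU M _ _ ef).hom ht
      rw [fromSpecIso_smul hU M _ _ ef (X.basicOpen_le f),
        fromSpecIso_map hU M _ _ _ _ et ef le_top (X.basicOpen_le f)] at h2
      rw [h2]
      simp
    · intro f t ht
      have ef := hU.fromSpec_image_basicOpen f
      generalize hD : (PrimeSpectrum.basicOpen f : (Spec Γ(X, U)).Opens) = D at ef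
      obtain ⟨n, hn⟩ := (h f D hD.symm).2 ((fromSpecIso hU M _ _ et).inv t) (by
        apply (ConcreteCategory.bijective_of_isIso (fromSpecIso hU M _ _ ef).hom).1
        rw [fromSpecIso_map hU M _ _ _ _ et ef le_top (X.basicOpen_le f)]
        simpa using ht)
      refine ⟨n, ?_⟩
      have h3 := congrArg (fromSpecIso hU M _ _ et).hom hn
      rw [fromSpecIso_smul hU M _ _ et le_rfl] at h3
      simpa using h3

theorem isQuasicoherent_iff_isLocalizingOn (M : X.Modules) :
    SheafOfModules.IsQuasicoherent.{u} M ↔ ∀ U : X.Opens, IsAffineOpen U → M.IsLocalizingOn U := by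
  constructor
  · intro hM U hU
    rw [IsLocalizingOn.iff_isIso_fromTildeΓ M hU, ← isQuasicoherent_iff_isIso_fromTildeΓ]
    infer_instance
  · intro h
    have (U : X.affineOpens) : IsOpenImmersion U.2.fromSpec := U.2.isOpenImmersion_fromSpec
    refine isQuasicoherent_of_cover M (I := X.affineOpens) (fun U => U.2.fromSpec) ?_ ?_
    · intro x
      obtain ⟨U, hU, hx, -⟩ := exists_isAffineOpen_mem_and_subset (X := X) (x := x) (U := ⊤) trivial
      exact ⟨⟨U, hU⟩, by rw [hU.opensRange_fromSpec]; exact hx⟩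
    · intro U
      rw [isQuasicoherent_iff_isIso_fromTildeΓ]
      exact (IsLocalizingOn.iff_isIso_fromTildeΓ M U.2).1 (h _ U.2)

end AlgebraicGeometry.Scheme.Modules

end

section
namespace AlgebraicGeometry.Scheme.Modules

variable {X : Scheme.{u}}

/-- Sections over an open subset, as a functor to abelian groups. -/
def sections (X : Scheme.{u}) (U : X.Opens) : X.Modules ⥤ Ab.{u} :=
  toPresheaf X ⋙ (CategoryTheory.evaluation _ _).obj (.op U)

instance (U : X.Opens) : PreservesLimits (sections X U) := by
  have : PreservesLimits ((CategoryTheory.evaluation X.Opensᵒᵖ Ab.{u}).obj (.op U)) := inferInstance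
  exact @comp_preservesLimits _ _ _ _ _ _ (toPresheaf X) _ inferInstance this

instance (U : X.Opens) : (sections X U).Additive where
  map_add := rfl

lemma app_injective_of_mono {M N : X.Modules} (φ : M ⟶ N) [Mono φ] (U : X.Opens) :
    Function.Injective (φ.app U) := by
  have : Mono ((sections X U).map φ) := inferInstance
  exact (AddCommGrpCat.mono_iff_injective _).1 this

lemma exists_app_kernel_ι {M N : X.Modules} (φ : M ⟶ N) {K : X.Modules} (i : K ⟶ M)
    (w : i ≫ φ = 0) (hi : IsLimit (KernelFork.ofι i w)) (U : X.Opens) (x : Γ(M, U))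
    (hx : φ.app U x = 0) : ∃ y : Γ(K, U), i.app U y = x := by
  let S := ShortComplex.mk i φ w
  have hS : S.Exact := S.exact_of_f_is_kernel hi
  have : Mono S.f := Fork.IsLimit.mono hi
  have h := hS.map_of_mono_of_preservesKernel (sections X U) inferInstance inferInstance
  rw [ShortComplex.ab_exact_iff] at h
  exact h x hx

end AlgebraicGeometry.Scheme.Modules

namespace AlgebraicGeometry.Scheme

open Modules

variable {X : Scheme.{u}}

/-- A sheaf of modules is coherent if it is quasi-coherent and its sections over every affine
open subset are finitely generated. -/
def IsCoherent (X : Scheme.{u}) : ObjectProperty X.Modules := fun M =>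
  SheafOfModules.IsQuasicoherent.{u} M ∧
    ∀ U : X.Opens, IsAffineOpen U → Module.Finite Γ(X, U) Γ(M, U)

lemma IsCoherent.isLocalizingOn {M : X.Modules} (h : IsCoherent X M) {U : X.Opens}
    (hU : IsAffineOpen U) : M.IsLocalizingOn U :=
  (isQuasicoherent_iff_isLocalizingOn M).1 h.1 U hU

lemma isCoherent_kernel [IsLocallyNoetherian X] {M N K : X.Modules} (φ : M ⟶ N) (i : K ⟶ M)
    (w : i ≫ φ = 0) (hi : IsLimit (KernelFork.ofι i w)) (hM : IsCoherent X M)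
    (hN : IsCoherent X N) : IsCoherent X K := by
  have : Mono i := Fork.IsLimit.mono hi
  have nat {A B : X.Modules} (ψ : A ⟶ B) {U V : X.Opens} (h : U ≤ V) (x : Γ(A, V)) :
      ψ.app U (A.presheaf.map (homOfLE h).op x) = B.presheaf.map (homOfLE h).op (ψ.app V x) :=
    congr($(ψ.mapPresheaf.naturality (homOfLE h).op) x)
  have h0 {U : X.Opens} (y : Γ(K, U)) : φ.app U (i.app U y) = 0 :=
    congr(Modules.Hom.app $w U y)
  refine ⟨(isQuasicoherent_iff_isLocalizingOn K).2 fun U hU => ⟨fun f s => ?_, fun f t ht => ?_⟩,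
    fun U hU => ?_⟩
  · obtain ⟨n, t, ht⟩ := (hM.isLocalizingOn hU).exists_lift f (i.app _ s)
    obtain ⟨m, hm⟩ := (hN.isLocalizingOn hU).exists_pow_smul f (φ.app _ t) (by
      rw [← nat, ht, Modules.Hom.app_smul, h0, smul_zero])
    obtain ⟨y, hy⟩ := exists_app_kernel_ι φ i w hi U (f ^ m • t) (by rw [Modules.Hom.app_smul, hm])
    refine ⟨m + n, y, ?_⟩
    apply app_injective_of_mono i
    rw [nat, hy, map_smul, ht, Modules.Hom.app_smul, pow_add, map_mul, mul_smul]
  · obtain ⟨n, hn⟩ := (hM.isLocalizingOn hU).exists_pow_smul f (i.app _ t) (by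
      rw [← nat, ht, map_zero])
    refine ⟨n, app_injective_of_mono i U ?_⟩
    rw [Modules.Hom.app_smul, hn, map_zero]
  · have := hM.2 U hU
    have : IsNoetherianRing Γ(X, U) := IsLocallyNoetherian.component_noetherian ⟨U, hU⟩
    let l : Γ(K, U) →ₗ[Γ(X, U)] Γ(M, U) :=
      { toFun := i.app U, map_add' := map_add _, map_smul' := Modules.Hom.app_smul i }
    exact Module.Finite.of_injective l (app_injective_of_mono i U)

/-- The isomorphism criterion in terms of modules over the coordinate rings of affine opens. -/
lemma isCoherent_iff_exists (M : X.Modules) : IsCoherent X M ↔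
    ∀ U : X.Opens, ∀ hU : IsAffineOpen U, ∃ N : ModuleCat.{u} Γ(X, U), Module.Finite Γ(X, U) N ∧
      Nonempty ((tilde.functor Γ(X, U)).obj N ≅ M.restrict hU.fromSpec) := by
  have key {U : X.Opens} (hU : IsAffineOpen U) : Module.Finite Γ(X, U) Γ(M, U) ↔
      Module.Finite Γ(X, U) (moduleSpecΓFunctor.obj (M.restrict hU.fromSpec)) := by
    let e := fromSpecIso hU M ⊤ U (fromSpec_image_top hU)
    let l : Γ(M.restrict hU.fromSpec, ⊤) ≃ₗ[Γ(X, U)] Γ(M, U) :=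
      { e.addCommGroupIsoToAddEquiv with
        map_smul' := fun a x => by
          have := fromSpecIso_smul hU M ⊤ U (fromSpec_image_top hU) le_rfl a x
          simpa using this }
    exact (Module.Finite.equiv_iff l).symm
  constructor
  · intro h U hU
    refine ⟨moduleSpecΓFunctor.obj (M.restrict hU.fromSpec), (key hU).1 (h.2 U hU), ?_⟩
    have := (IsLocalizingOn.iff_isIso_fromTildeΓ M hU).1 (h.isLocalizingOn hU)
    exact ⟨@asIso _ _ _ _ (M.restrict hU.fromSpec).fromTildeΓ this⟩
  · intro h
    refine ⟨(isQuasicoherent_iff_isLocalizingOn M).2 fun U hU => ?_, fun U hU => ?_⟩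
    · obtain ⟨N, -, ⟨e⟩⟩ := h U hU
      rw [IsLocalizingOn.iff_isIso_fromTildeΓ M hU, isIso_fromTildeΓ_iff]
      exact ⟨N, ⟨e⟩⟩
    · obtain ⟨N, hN, ⟨e⟩⟩ := h U hU
      rw [key hU]
      let i : N ≅ moduleSpecΓFunctor.obj (M.restrict hU.fromSpec) :=
        tilde.toTildeΓNatIso.app N ≪≫ moduleSpecΓFunctor.mapIso e
      exact Module.Finite.equiv i.toLinearEquiv

lemma isCoherent_of_iso {M N : X.Modules} (e : M ≅ N) (h : IsCoherent X M) : IsCoherent X N := by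
  rw [isCoherent_iff_exists] at h ⊢
  intro U hU
  obtain ⟨P, hP, ⟨i⟩⟩ := h U hU
  exact ⟨P, hP, ⟨i ≪≫ (Modules.restrictFunctor hU.fromSpec).mapIso e⟩⟩

instance : (IsCoherent X).IsClosedUnderIsomorphisms := ⟨isCoherent_of_iso⟩

lemma isCoherent_cokernel {M N Q : X.Modules} (φ : M ⟶ N) (p : N ⟶ Q)
    (w : φ ≫ p = 0) (hp : IsColimit (CokernelCofork.ofπ p w)) (hM : IsCoherent X M)
    (hN : IsCoherent X N) : IsCoherent X Q := by
  rw [isCoherent_iff_exists] at hM hN ⊢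
  intro U hU
  obtain ⟨A, hA, ⟨a⟩⟩ := hM U hU
  obtain ⟨B, hB, ⟨b⟩⟩ := hN U hU
  let ρ := Modules.restrictFunctor hU.fromSpec
  let T := tilde.functor Γ(X, U)
  let g : A ⟶ B := T.preimage (a.hom ≫ ρ.map φ ≫ b.inv)
  have hg : T.map g = a.hom ≫ ρ.map φ ≫ b.inv := T.map_preimage _
  refine ⟨cokernel g, ?_, ⟨?_⟩⟩
  · exact Module.Finite.of_surjective (cokernel.π g).hom
      ((ModuleCat.epi_iff_surjective _).1 inferInstance)
  · have h1 := isColimitOfPreserves ρ hp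
    have h2 := isColimitOfPreserves T (cokernelIsCokernel g)
    let e : parallelPair g 0 ⋙ T ≅ parallelPair φ 0 ⋙ ρ :=
      parallelPair.ext a b (by simp [hg]) (by simp)
    exact IsColimit.coconePointsIsoOfNatIso h2 h1 e

end AlgebraicGeometry.Scheme

end

section
namespace AlgebraicGeometry.Scheme
open Modules
variable {X : Scheme.{u}}

lemma isCoherent_biprod {A B : X.Modules} (c : BinaryCofan A B) (hc : IsColimit c)
    (hA : IsCoherent X A) (hB : IsCoherent X B) : IsCoherent X c.pt := by
  rw [isCoherent_iff_exists] at hA hB ⊢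
  intro U hU
  obtain ⟨P, hP, ⟨a⟩⟩ := hA U hU
  obtain ⟨Q, hQ, ⟨b⟩⟩ := hB U hU
  let ρ := Modules.restrictFunctor hU.fromSpec
  let T := tilde.functor Γ(X, U)
  refine ⟨ModuleCat.of _ (P × Q), inferInstanceAs (Module.Finite _ (P × Q)), ⟨?_⟩⟩
  have h1 := isColimitOfPreserves ρ hc
  have h2 := isColimitOfPreserves T (BinaryBiproduct.isColimit P Q)
  let e : pair P Q ⋙ T ≅ pair A B ⋙ ρ := mapPairIso a b
  exact T.mapIso (ModuleCat.biprodIsoProd P Q).symm ≪≫ IsColimit.coconePointsIsoOfNatIso h2 h1 e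

lemma isCoherent_of_isZero {M : X.Modules} (h : IsZero M) : IsCoherent X M := by
  rw [isCoherent_iff_exists]
  intro U hU
  refine ⟨ModuleCat.of _ PUnit, inferInstanceAs (Module.Finite Γ(X, U) PUnit.{u+1}), ⟨?_⟩⟩
  have h1 : IsZero (ModuleCat.of Γ(X, U) PUnit.{u+1}) := ModuleCat.isZero_of_subsingleton _
  exact ((tilde.functor _).map_isZero h1).iso ((Modules.restrictFunctor hU.fromSpec).map_isZero h)


instance : (IsCoherent X).ContainsZero :=
  ⟨⟨_, isZero_zero X.Modules, isCoherent_of_isZero (isZero_zero X.Modules)⟩⟩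

instance : (IsCoherent X).IsClosedUnderBinaryProducts where
  limitsOfShape_le := by
    rintro M ⟨p⟩
    let c : BinaryFan (p.diag.obj ⟨.left⟩) (p.diag.obj ⟨.right⟩) :=
      (Cone.postcompose (diagramIsoPair p.diag).hom).obj p.cone
    have hc : IsLimit c := (IsLimit.postcomposeHomEquiv (diagramIsoPair p.diag) p.cone).symm p.isLimit
    exact isCoherent_of_iso ((BinaryBiproduct.isLimit _ _).conePointUniqueUpToIso hc)
      (isCoherent_biprod _ (BinaryBiproduct.isColimit _ _) (p.prop_diag_obj _) (p.prop_diag_obj _))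

instance : (IsCoherent X).IsClosedUnderFiniteProducts := .mk'

lemma finite_sections_basicOpen {M : X.Modules} {U : X.Opens}
    (h : M.IsLocalizingOn U) (f : Γ(X, U)) [Module.Finite Γ(X, U) Γ(M, U)] :
    Module.Finite Γ(X, X.basicOpen f) Γ(M, X.basicOpen f) := by
  obtain ⟨s, hs⟩ := Module.Finite.fg_top (R := Γ(X, U)) (M := Γ(M, U))
  classical
  let r : Γ(M, U) →+ Γ(M, X.basicOpen f) :=
    (M.presheaf.map (homOfLE (X.basicOpen_le f)).op).hom
  refine ⟨⟨s.image r, ?_⟩⟩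
  have hr (t : Γ(M, U)) : r t ∈ Submodule.span Γ(X, X.basicOpen f) (s.image r : Set _) := by
    have ht : t ∈ Submodule.span Γ(X, U) (s : Set Γ(M, U)) := hs ▸ Submodule.mem_top
    induction ht using Submodule.span_induction with
    | mem x hx => exact Submodule.subset_span (by simpa using ⟨x, hx, rfl⟩)
    | zero => simp [r]
    | add x y _ _ hx hy => rw [map_add]; exact add_mem hx hy
    | smul a x _ hx =>
      have : r (a • x) = _ • r x := M.map_smul _ _ _
      rw [this]
      exact Submodule.smul_mem _ _ hx
  rw [eq_top_iff]
  rintro x -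
  obtain ⟨n, t, ht⟩ := h.exists_lift f x
  have hu : IsUnit (X.presheaf.map (homOfLE (X.basicOpen_le f)).op (f ^ n)) := by
    rw [map_pow]
    exact (RingedSpace.isUnit_res_basicOpen _ f).pow n
  obtain ⟨a, ha⟩ := hu.exists_left_inv
  have : x = a • r t := by
    rw [show r t = _ from ht, smul_smul, ha, one_smul]
  rw [this]
  exact Submodule.smul_mem _ _ (hr t)

lemma finite_of_basicOpen {M : X.Modules} {U : X.Opens} (hU : IsAffineOpen U)
    (h : M.IsLocalizingOn U) (s : Finset Γ(X, U)) (hs : Ideal.span (s : Set Γ(X, U)) = ⊤)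
    (H : ∀ f : s, Module.Finite Γ(X, X.basicOpen f.1) Γ(M, X.basicOpen f.1)) :
    Module.Finite Γ(X, U) Γ(M, U) := by
  let _ (f : s) : Module Γ(X, U) Γ(M, X.basicOpen f.1) :=
    Module.compHom _ (algebraMap Γ(X, U) Γ(X, X.basicOpen f.1))
  have (f : s) : IsScalarTower Γ(X, U) Γ(X, X.basicOpen f.1) Γ(M, X.basicOpen f.1) :=
    .of_algebraMap_smul fun _ _ => rfl
  have (f : s) : IsLocalization.Away f.1 Γ(X, X.basicOpen f.1) := hU.isLocalization_basicOpen f.1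
  let l (f : s) : Γ(M, U) →ₗ[Γ(X, U)] Γ(M, X.basicOpen f.1) :=
    { toFun := M.presheaf.map (homOfLE (X.basicOpen_le f.1)).op
      map_add' := map_add _
      map_smul' := M.map_smul _ }
  have (f : s) : IsLocalizedModule.Away f.1 (l f) := by
    refine IsLocalizedModule.Away.mk_of_addCommGroup ?_ (fun x => ?_) (h.exists_pow_smul f.1)
    · have := (RingedSpace.isUnit_res_basicOpen _ f.1).map
        (algebraMap Γ(X, X.basicOpen f.1) (Module.End Γ(X, X.basicOpen f.1) Γ(M, X.basicOpen f.1)))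
      rw [Module.End.isUnit_iff] at this ⊢
      exact this
    · obtain ⟨n, t, ht⟩ := h.exists_lift f.1 x
      exact ⟨n, t, ht.symm⟩
  exact Module.Finite.of_localizationSpan_finite' s hs l H

/-- Coherence is local. -/
theorem isCoherent_of_cover (M : X.Modules) {I : Type u} {Y : I → Scheme.{u}}
    (f : ∀ i, Y i ⟶ X) [∀ i, IsOpenImmersion (f i)] (hf : ∀ x, ∃ i, x ∈ (f i).opensRange)
    (h : ∀ i, IsCoherent (Y i) (M.restrict (f i))) : IsCoherent X M := by
  have hq : SheafOfModules.IsQuasicoherent.{u} M := isQuasicoherent_of_cover M f hf fun i => (h i).1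
  have hl := (isQuasicoherent_iff_isLocalizingOn M).1 hq
  refine ⟨hq, fun U hU => ?_⟩
  refine of_affine_open_cover (P := fun U => Module.Finite Γ(X, U) Γ(M, U))
    (ι := Σ i, (Y i).affineOpens)
    (fun j => ⟨f j.1 ''ᵁ j.2, j.2.2.image_of_isOpenImmersion _⟩) ?_ ⟨U, hU⟩ ?_ ?_ ?_
  · rw [eq_top_iff]
    rintro x -
    obtain ⟨i, y, rfl⟩ := hf x
    obtain ⟨V, hV, hy, -⟩ := exists_isAffineOpen_mem_and_subset (X := Y i) (x := y) (U := ⊤) trivial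
    simp only [Opens.mem_iSup]
    exact ⟨⟨i, ⟨V, hV⟩⟩, y, hy, rfl⟩
  · intro U f hf
    exact finite_sections_basicOpen (hl U U.2) f
  · intro U s hs H
    exact finite_of_basicOpen U.2 (hl U U.2) s hs H
  · rintro ⟨i, V⟩
    have := (h i).2 V V.2
    let σ : Γ(Y i, V) →+* Γ(X, f i ''ᵁ V) := ((f i).appIso V).inv.hom
    have : RingHomSurjective σ :=
      ⟨(ConcreteCategory.bijective_of_isIso ((f i).appIso V).inv).2⟩
    let l : Γ(M.restrict (f i), V) →ₛₗ[σ] Γ(M, f i ''ᵁ V) :=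
      { toFun := (M.restrictAppIso (f i) V).hom
        map_add' := map_add _
        map_smul' := fun _ _ => rfl }
    exact Module.Finite.of_surjective l
      (ConcreteCategory.bijective_of_isIso (M.restrictAppIso (f i) V).hom).2

end AlgebraicGeometry.Scheme

end

section
namespace AlgebraicGeometry.Scheme
open Modules
variable {X Y : Scheme.{u}}

instance [IsLocallyNoetherian X] : (IsCoherent X).IsClosedUnderKernels where
  kernels_le := by
    rintro _ ⟨f, c, hc, ⟨hA, hB⟩⟩
    exact isCoherent_kernel f c.ι c.condition (IsLimit.ofIsoLimit hc (Fork.ext (Iso.refl _))) hA hB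

instance : (IsCoherent X).IsClosedUnderCokernels where
  cokernels_le := by
    rintro _ ⟨f, c, hc, ⟨hA, hB⟩⟩
    exact isCoherent_cokernel f c.π c.condition (IsColimit.ofIsoColimit hc (Cofork.ext (Iso.refl _)))
      hA hB

/-- The category of coherent sheaves. -/
abbrev Coh (X : Scheme.{u}) : Type (u + 1) := (IsCoherent X).FullSubcategory

/-- A morphism of coherent sheaves that is surjective on the sections over all affine open
subsets is an epimorphism. -/
lemma epi_of_surjective {M N : X.Modules} (φ : M ⟶ N)
    (h : ∀ U : X.Opens, IsAffineOpen U → Function.Surjective (φ.app U)) : Epi φ := by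
  refine Preadditive.epi_of_cancel_zero _ fun {P} ψ w => ?_
  ext V x
  refine TopCat.Sheaf.eq_of_locally_eq' ⟨P.presheaf, P.isSheaf⟩
    (fun U : {U : X.affineOpens // U.1 ≤ V} => U.1.1) V (fun U => homOfLE U.2) ?_ _ _ ?_
  · intro x hx
    obtain ⟨U, hU, hxU, hUV⟩ := exists_isAffineOpen_mem_and_subset (X := X) (x := x) (U := V) hx
    exact Opens.mem_iSup.2 ⟨⟨⟨U, hU⟩, hUV⟩, hxU⟩
  · rintro ⟨U, hU⟩
    have nat : ψ.app U.1 (N.presheaf.map (homOfLE hU).op x) =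
      P.presheaf.map (homOfLE hU).op (ψ.app V x) := congr($(ψ.mapPresheaf.naturality (homOfLE hU).op) x)
    obtain ⟨y, hy⟩ := h U U.2 (N.presheaf.map (homOfLE hU).op x)
    have h2 : ψ.app U.1 (φ.app U.1 y) = 0 := congr(Modules.Hom.app $w U y)
    rw [hy, nat] at h2
    exact h2.trans (map_zero _).symm

lemma epi_of_isIso_square {C : Type*} [Category* C] {A B A' B' : C} {a : A ⟶ A'} {b : B ⟶ B'}
    {f : A ⟶ B} {g : A' ⟶ B'} (ha : IsIso a) (hb : IsIso b) (h : f ≫ b = a ≫ g) (hg : Epi g) :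
    Epi f := by
  have : f = a ≫ g ≫ inv b := by rw [← reassoc_of% h]; simp
  rw [this]
  infer_instance

lemma surjective_of_epi {M N : X.Modules} (φ : M ⟶ N) [Epi φ] (hM : IsCoherent X M)
    (hN : IsCoherent X N) (U : X.Opens) (hU : IsAffineOpen U) :
    Function.Surjective (φ.app U) := by
  have iM := (IsLocalizingOn.iff_isIso_fromTildeΓ M hU).1 (hM.isLocalizingOn hU)
  have iN := (IsLocalizingOn.iff_isIso_fromTildeΓ N hU).1 (hN.isLocalizingOn hU)
  let ρ := Modules.restrictFunctor hU.fromSpec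
  let T := tilde.functor Γ(X, U)
  let G := moduleSpecΓFunctor (R := Γ(X, U))
  have nat : T.map (G.map (ρ.map φ)) ≫ (N.restrict hU.fromSpec).fromTildeΓ =
    (M.restrict hU.fromSpec).fromTildeΓ ≫ ρ.map φ := fromTildeΓNatTrans.naturality _
  have h1 : Epi (ρ.map φ) := inferInstance
  have h2 : Epi (T.map (G.map (ρ.map φ))) := epi_of_isIso_square iM iN nat h1
  have h3 : Epi (G.map (ρ.map φ)) := T.epi_of_epi_map h2
  have h4 := (ModuleCat.epi_iff_surjective _).1 h3
  intro y
  obtain ⟨x, hx⟩ := h4 ((fromSpecIso hU N ⊤ U (fromSpec_image_top hU)).inv y)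
  let e := fromSpec_image_top hU
  refine ⟨(fromSpecIso hU M ⊤ U e).hom x, ?_⟩
  have h5 : (fromSpecIso hU M ⊤ U e).hom ≫ φ.app U =
      (ρ.map φ).app ⊤ ≫ (fromSpecIso hU N ⊤ U e).hom :=
    (φ.mapPresheaf.naturality (eqToHom e.symm).op)
  have h6 : φ.app U ((fromSpecIso hU M ⊤ U e).hom x) =
      (fromSpecIso hU N ⊤ U e).hom ((ρ.map φ).app ⊤ x) := congr($h5 x)
  have h7 : (ρ.map φ).app ⊤ x = (fromSpecIso hU N ⊤ U e).inv y := hx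
  rw [h6, h7]
  simp

end AlgebraicGeometry.Scheme

end

section
namespace AlgebraicGeometry.Scheme
open Modules
variable {X Y : Scheme.{u}}

lemma isCoherent_pushforward (f : X ⟶ Y) [IsClosedImmersion f] {M : X.Modules}
    (hM : IsCoherent X M) : IsCoherent Y ((Modules.pushforward f).obj M) := by
  refine ⟨(isQuasicoherent_iff_isLocalizingOn _).2 fun U hU => ?_, fun U hU => ?_⟩
  · have h := hM.isLocalizingOn (hU.preimage f)
    have key (s : Γ(Y, U)) (D : X.Opens) (hD : D = X.basicOpen (f.app U s)) (hDU : D ≤ f ⁻¹ᵁ U) :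
       (∀ x : Γ(M, D), ∃ (n : ℕ) (t : Γ(M, f ⁻¹ᵁ U)), M.presheaf.map (homOfLE hDU).op t =
          X.presheaf.map (homOfLE hDU).op (f.app U s ^ n) • x) ∧
       (∀ t : Γ(M, f ⁻¹ᵁ U), M.presheaf.map (homOfLE hDU).op t = 0 →
         ∃ n : ℕ, f.app U s ^ n • t = 0) := by
      subst hD
      exact ⟨h.exists_lift _, h.exists_pow_smul _⟩
    refine ⟨fun s x => ?_, fun s t ht => ?_⟩
    · obtain ⟨n, t, ht⟩ := (key s _ (Scheme.preimage_basicOpen f s)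
        (f.preimage_mono (Y.basicOpen_le s))).1 x
      refine ⟨n, t, ht.trans ?_⟩
      have : (f.app (Y.basicOpen s)) (Y.presheaf.map (homOfLE (Y.basicOpen_le s)).op (s ^ n)) =
        X.presheaf.map (homOfLE (f.preimage_mono (Y.basicOpen_le s))).op (f.app U s ^ n) := by
        rw [← map_pow]
        exact congr($(f.naturality (homOfLE (Y.basicOpen_le s)).op) (s ^ n))
      rw [← this]
      rfl
    · obtain ⟨n, hn⟩ := (key s _ (Scheme.preimage_basicOpen f s)
        (f.preimage_mono (Y.basicOpen_le s))).2 t ht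
      refine ⟨n, ?_⟩
      rw [← map_pow] at hn
      exact hn
  · have := hM.2 _ (hU.preimage f)
    have hs : Function.Surjective (f.app U) := f.app_surjective U hU
    obtain ⟨s, hs'⟩ := Module.Finite.fg_top (R := Γ(X, f ⁻¹ᵁ U)) (M := Γ(M, f ⁻¹ᵁ U))
    refine ⟨⟨s, ?_⟩⟩
    rw [eq_top_iff]
    rintro (x : Γ(M, f ⁻¹ᵁ U)) -
    have hx : x ∈ Submodule.span Γ(X, f ⁻¹ᵁ U) (s : Set Γ(M, f ⁻¹ᵁ U)) := hs' ▸ Submodule.mem_top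
    induction hx using Submodule.span_induction with
    | mem x hx => exact Submodule.subset_span hx
    | zero => exact zero_mem _
    | add x y _ _ hx hy => exact add_mem hx hy
    | smul a x _ hx =>
      obtain ⟨b, rfl⟩ := hs a
      exact Submodule.smul_mem _ b hx

/-- Direct image of coherent sheaves along a closed immersion. -/
def cohPushforward (f : X ⟶ Y) [IsClosedImmersion f] : Coh X ⥤ Coh Y :=
  (IsCoherent Y).lift ((IsCoherent X).ι ⋙ Modules.pushforward f)
    fun M => isCoherent_pushforward f M.2

instance (f : X ⟶ Y) [IsClosedImmersion f] : (cohPushforward f).Additive where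
  map_add {M N φ ψ} := by
    ext U x
    rfl

lemma epi_coh_iff {M N : Coh X} (φ : M ⟶ N) : Epi φ ↔
    ∀ U : X.Opens, IsAffineOpen U → Function.Surjective (φ.hom.app U) := by
  constructor
  · intro h
    have := (IsCoherent X).preservesEpimorphisms_ι_of_isNormalMonoCategory
    have : Epi φ.hom := (inferInstance : Epi ((IsCoherent X).ι.map φ))
    exact surjective_of_epi φ.hom M.2 N.2
  · intro h
    have : Epi ((IsCoherent X).ι.map φ) := epi_of_surjective _ h
    exact (IsCoherent X).ι.epi_of_epi_map this

section
variable [IsLocallyNoetherian X] [IsLocallyNoetherian Y] (f : X ⟶ Y) [IsClosedImmersion f]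

instance : PreservesFiniteLimits (cohPushforward f) := by
  refine ((cohPushforward f).preservesFiniteLimits_tfae.out 2 3).1 fun M N φ => ?_
  have := (IsCoherent X).preservesKernels_ι φ
  have h : PreservesLimit (parallelPair φ 0) (cohPushforward f ⋙ (IsCoherent Y).ι) :=
    inferInstanceAs (PreservesLimit (parallelPair φ 0) ((IsCoherent X).ι ⋙ Modules.pushforward f))
  exact preservesLimit_of_reflects_of_preserves _ (IsCoherent Y).ι

instance : PreservesFiniteColimits (cohPushforward f) := by
  have h0 : (cohPushforward f).PreservesEpimorphisms := ⟨fun φ h => by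
    rw [epi_coh_iff] at h ⊢
    exact fun U hU => h _ (hU.preimage f)⟩
  refine ((cohPushforward f).preservesFiniteColimits_tfae.out 0 3).1 fun S hS => ?_
  have := hS.mono_f
  have := hS.epi_g
  exact ⟨hS.exact.map_of_mono_of_preservesKernel _ inferInstance inferInstance,
    inferInstance⟩
end

end AlgebraicGeometry.Scheme

end

section
namespace AlgebraicGeometry.Scheme
open Modules
variable {X Y : Scheme.{u}}

instance : (IsCoherent X).IsClosedUnderBinaryCoproducts where
  colimitsOfShape_le := by
    rintro M ⟨p⟩
    let c : BinaryCofan (p.diag.obj ⟨.left⟩) (p.diag.obj ⟨.right⟩) :=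
      (Cocone.precompose (diagramIsoPair p.diag).inv).obj p.cocone
    have hc : IsColimit c := (IsColimit.precomposeInvEquiv (diagramIsoPair p.diag) p.cocone).symm p.isColimit
    exact isCoherent_biprod c hc (p.prop_diag_obj _) (p.prop_diag_obj _)

instance : (IsCoherent X).IsClosedUnderFiniteCoproducts := .mk'

lemma isCoherent_unit : IsCoherent X (SheafOfModules.unit X.ringCatSheaf) := by
  refine (isCoherent_iff_exists (X := X) _).2 ?_
  intro U hU
  exact ⟨ModuleCat.of _ Γ(X, U), inferInstanceAs (Module.Finite Γ(X, U) Γ(X, U)),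
    ⟨tildeSelf ≪≫ (restrictUnitIso hU.fromSpec).symm⟩⟩

lemma isCoherent_free (I : Type u) [Finite I] :
    IsCoherent X (SheafOfModules.free.{u} (R := X.ringCatSheaf) I) :=
  (IsCoherent X).prop_of_isColimit_cofan (SheafOfModules.isColimitFreeCofan (R := X.ringCatSheaf) I)
    fun _ => isCoherent_unit

lemma final_opensMap {X Y : TopCat.{u}} (f : X ⟶ Y) : (Opens.map f).Final where
  out V := isConnected_of_isTerminal (StructuredArrow V (Opens.map f))
    (x := StructuredArrow.mk (Y := ⊤) (homOfLE le_top))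
    (IsTerminal.ofUniqueHom (fun _ => StructuredArrow.homMk (homOfLE le_top) (by subsingleton))
      (fun _ _ => StructuredArrow.ext _ _ (by subsingleton)))

lemma isCoherent_pullback_free (f : X ⟶ Y) (I : Type u) [Finite I] :
    IsCoherent X ((Modules.pullback f).obj (SheafOfModules.free.{u} (R := Y.ringCatSheaf) I)) := by
  have : (SheafOfModules.pushforward.{u} f.toRingCatSheafHom).IsRightAdjoint :=
    (Modules.pullbackPushforwardAdjunction f).isRightAdjoint
  have := final_opensMap f.base
  exact isCoherent_of_iso (X := X) (SheafOfModules.pullbackObjFreeIso f.toRingCatSheafHom I).symm (isCoherent_free I)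

lemma isCoherent_pullback_tilde {A : CommRingCat.{u}} [IsNoetherianRing A] (h : X ⟶ Spec A)
    (N : ModuleCat.{u} A) [Module.Finite A N] :
    IsCoherent X ((Modules.pullback h).obj ((tilde.functor A).obj N)) := by
  obtain ⟨n, p, hp⟩ := Module.Finite.exists_fin' A N
  obtain ⟨m, q, hq⟩ := Module.Finite.exists_fin' A (LinearMap.ker p)
  let eN (n : ℕ) : (ULift.{u} (Fin n) →₀ A) ≃ₗ[A] (Fin n → A) :=
    (Finsupp.linearEquivFunOnFinite A A _).trans (LinearEquiv.funCongrLeft A A Equiv.ulift.symm)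
  let p' : ModuleCat.of A (ULift.{u} (Fin n) →₀ A) ⟶ N := ModuleCat.ofHom (p ∘ₗ (eN n).toLinearMap)
  let q' : ModuleCat.of A (ULift.{u} (Fin m) →₀ A) ⟶ ModuleCat.of A (ULift.{u} (Fin n) →₀ A) :=
    ModuleCat.ofHom ((eN n).symm.toLinearMap ∘ₗ (LinearMap.ker p).subtype ∘ₗ q ∘ₗ (eN m).toLinearMap)
  have hp' (x) : p' x = p (eN n x) := rfl
  have hq' (x) : q' x = (eN n).symm (q (eN m x)) := rfl
  have hex : Function.Exact q' p' := by
    intro x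
    rw [hp']
    constructor
    · intro hx
      obtain ⟨y, hy⟩ := hq ⟨_, hx⟩
      exact ⟨(eN m).symm y, by rw [hq']; simp [hy]⟩
    · rintro ⟨y, rfl⟩
      rw [hq', LinearEquiv.apply_symm_apply]
      exact (q (eN m y)).2
  have hs : Function.Surjective p' := fun y => by
    obtain ⟨x, hx⟩ := hp y
    exact ⟨(eN n).symm x, by rw [hp']; simpa using hx⟩
  have w : q' ≫ p' = 0 := by
    ext1
    exact LinearMap.ext hex.apply_apply_eq_zero
  have hc := ModuleCat.isColimitCokernelCofork _ _ hex hs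
  let T := tilde.functor A ⋙ Modules.pullback h
  have hf (k : ℕ) : IsCoherent X (T.obj (ModuleCat.of A (ULift.{u} (Fin k) →₀ A))) :=
    isCoherent_of_iso ((Modules.pullback h).mapIso (tildeFinsupp _).symm) (isCoherent_pullback_free h _)
  have : T.PreservesZeroMorphisms := inferInstance
  exact isCoherent_cokernel (T.map q') (T.map p') (by rw [← T.map_comp, w, T.map_zero])
    (CokernelCofork.mapIsColimit _ hc T) (hf m) (hf n)

lemma isCoherent_pullback [IsLocallyNoetherian Y] (f : X ⟶ Y) {M : Y.Modules}
    (hM : IsCoherent Y M) : IsCoherent X ((Modules.pullback f).obj M) := by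
  refine isCoherent_of_cover _ (I := Y.affineOpens) (fun U => (f ⁻¹ᵁ U.1).ι) ?_ ?_
  · intro x
    obtain ⟨U, hU, hx, -⟩ := exists_isAffineOpen_mem_and_subset (X := Y) (x := f x) (U := ⊤) trivial
    refine ⟨⟨U, hU⟩, ?_⟩
    simpa using hx
  · rintro ⟨U, hU⟩
    have : IsNoetherianRing Γ(Y, U) := IsLocallyNoetherian.component_noetherian ⟨U, hU⟩
    obtain ⟨N, hN, ⟨e⟩⟩ := (isCoherent_iff_exists M).1 hM U hU
    have := hU.isOpenImmersion_fromSpec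
    let h : (f ⁻¹ᵁ U).toScheme ⟶ Spec Γ(Y, U) := IsOpenImmersion.lift hU.fromSpec ((f ⁻¹ᵁ U).ι ≫ f) (by
      rw [hU.range_fromSpec]
      rintro _ ⟨x, rfl⟩
      exact x.2)
    have hh : h ≫ hU.fromSpec = (f ⁻¹ᵁ U).ι ≫ f := IsOpenImmersion.lift_fac _ _ _
    refine isCoherent_of_iso ?_ (isCoherent_pullback_tilde h N)
    exact (Modules.pullback h).mapIso (e ≪≫ (restrictFunctorIsoPullback _).app M) ≪≫
      (Modules.pullbackComp h hU.fromSpec).app M ≪≫ (Modules.pullbackCongr hh).app M ≪≫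
      (Modules.pullbackComp _ f).symm.app M ≪≫ (restrictFunctorIsoPullback _).symm.app _

/-- Inverse image of coherent sheaves. -/
def cohPullback [IsLocallyNoetherian Y] (f : X ⟶ Y) : Coh Y ⥤ Coh X :=
  (IsCoherent X).lift ((IsCoherent Y).ι ⋙ Modules.pullback f) fun M => isCoherent_pullback f M.2

instance [IsLocallyNoetherian Y] (f : X ⟶ Y) : (cohPullback f).Additive where
  map_add {M N φ ψ} := by
    apply (IsCoherent X).ι.map_injective
    exact (Modules.pullback f).map_add (f := φ.hom) (g := ψ.hom)

end AlgebraicGeometry.Scheme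

end

section

namespace HomotopyCategory

section
variable (C : Type*) [Category* C] [Preadditive C]

/-- The objects of `HomotopyCategory C (.up ℤ)` whose underlying cochain complex is
bounded above. -/
def minus : ObjectProperty (HomotopyCategory C (.up ℤ)) := fun K =>
  ∃ n : ℤ, CochainComplex.IsStrictlyLE (K.as : CochainComplex C ℤ) n

instance [HasZeroObject C] : (minus C).ContainsZero where
  exists_zero := ⟨(quotient _ _).obj 0, Functor.map_isZero _ (isZero_zero _), 0,
    inferInstanceAs (CochainComplex.IsStrictlyLE (0 : CochainComplex C ℤ) 0)⟩

instance : (minus C).IsStableUnderShift ℤ where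
  isStableUnderShiftBy n :=
    { le_shift := by
        rintro K ⟨q, hq⟩
        obtain ⟨K : CochainComplex _ _, rfl⟩ := K.quotient_obj_surjective
        have : K.IsStrictlyLE q := hq
        rw [ObjectProperty.prop_shift_iff, shift_quotient_obj]
        exact ⟨q - n, CochainComplex.isStrictlyLE_shift K q n (q - n) (by lia)⟩ }

instance [HasZeroObject C] [HasBinaryBiproducts C] : (minus C).IsTriangulatedClosed₃ where
  ext₃' T hT := by
    rintro ⟨n₁, h₁⟩ ⟨n₂, h₂⟩
    obtain ⟨f : (T.obj₁.as : CochainComplex C ℤ) ⟶ T.obj₂.as, hf⟩ :=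
      (quotient _ _).map_surjective T.mor₁
    refine ⟨_, ?_, ⟨Triangle.π₃.mapIso (isoTriangleOfIso₁₂ T _ hT
      (mappingCone_triangleh_distinguished f) (Iso.refl _) (Iso.refl _) ?_)⟩⟩
    · refine ⟨max n₁ n₂, ?_⟩
      change CochainComplex.IsStrictlyLE (CochainComplex.mappingCone f) _
      rw [CochainComplex.isStrictlyLE_iff]
      intro i hi
      rw [CochainComplex.mappingCone.isZero_X_iff]
      exact ⟨CochainComplex.isZero_of_isStrictlyLE _ n₁ _ (by lia),
        CochainComplex.isZero_of_isStrictlyLE _ n₂ _ (by lia)⟩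
    · refine (Category.comp_id _).trans (hf.symm.trans (Category.id_comp _).symm)

instance [HasZeroObject C] [HasBinaryBiproducts C] : (minus C).IsTriangulated where
  toIsTriangulatedClosed₂ := .of_isTriangulatedClosed₃

/-- The homotopy category of bounded above cochain complexes. -/
abbrev Minus := (minus C).FullSubcategory

end

end HomotopyCategory

namespace CategoryTheory.Functor
variable {C D : Type*} [Category* C] [Preadditive C] [Category* D] [Preadditive D]

/-- The functor between homotopy categories of bounded above complexes that is induced by an
additive functor. -/
def mapHomotopyCategoryMinus (F : C ⥤ D) [F.Additive] :
    HomotopyCategory.Minus C ⥤ HomotopyCategory.Minus D :=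
  (HomotopyCategory.minus D).lift
    ((HomotopyCategory.minus C).ι ⋙ F.mapHomotopyCategory (ComplexShape.up ℤ)) (by
      rintro ⟨K, n, hn⟩
      exact ⟨n, inferInstanceAs (CochainComplex.IsStrictlyLE
        ((F.mapHomologicalComplex _).obj (K.as : CochainComplex C ℤ)) n)⟩)

end CategoryTheory.Functor

namespace DerivedCategory
open TStructure

variable {C : Type*} [Category* C] [Abelian C] [HasDerivedCategory C]

/-- The localization functor from the homotopy category of bounded above complexes to the
bounded above derived category. -/
def Minus.Qh : HomotopyCategory.Minus C ⥤ Minus C :=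
  t.minus.lift ((HomotopyCategory.minus C).ι ⋙ DerivedCategory.Qh) (by
    rintro ⟨K, n, hn⟩
    exact ⟨n, ⟨⟨K.as, (quotientCompQhIso C).app K.as, hn⟩⟩⟩)

/-- Morphisms of bounded above complexes (up to homotopy) that are quasi-isomorphisms. -/
def Minus.quasiIso (C : Type*) [Category* C] [Abelian C] :
    MorphismProperty (HomotopyCategory.Minus C) :=
  (HomotopyCategory.quasiIso C (.up ℤ)).inverseImage (HomotopyCategory.minus C).ι

instance : (HomotopyCategory.minus C).IsVerdierLeftLocalizing
    (HomotopyCategory.subcategoryAcyclic C) where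
  fac {K L} φ hK hL := by
    obtain ⟨n, hn⟩ := hK
    obtain ⟨K : CochainComplex _ _, rfl⟩ := HomotopyCategory.quotient_obj_surjective K
    obtain ⟨L : CochainComplex _ _, rfl⟩ := HomotopyCategory.quotient_obj_surjective L
    obtain ⟨φ, rfl⟩ := (HomotopyCategory.quotient _ _).map_surjective φ
    rw [HomotopyCategory.quotient_obj_mem_subcategoryAcyclic_iff_acyclic] at hL
    have hn : K.IsStrictlyLE n := hn
    refine ⟨(HomotopyCategory.quotient _ _).obj (L.truncLE n),
      (HomotopyCategory.quotient _ _).map (inv (K.ιTruncLE n) ≫ CochainComplex.truncLEMap φ n),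
      (HomotopyCategory.quotient _ _).map (L.ιTruncLE n), ?_, ?_, ?_⟩
    · exact ⟨n, inferInstanceAs ((L.truncLE n).IsStrictlyLE n)⟩
    · rw [HomotopyCategory.quotient_obj_mem_subcategoryAcyclic_iff_acyclic]
      exact hL.truncLE _
    · rw [← Functor.map_comp, Category.assoc, CochainComplex.ιTruncLE_naturality,
        IsIso.inv_hom_id_assoc]

instance : (Minus.Qh (C := C)).EssSurj where
  mem_essImage := by
    intro ⟨X, n, K, e, h⟩
    refine ⟨⟨(HomotopyCategory.quotient C (ComplexShape.up ℤ)).obj K, n, h⟩,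
      ⟨Minus.ι.preimageIso ((quotientCompQhIso C).app _ ≪≫ e.symm)⟩⟩

instance : (Minus.Qh (C := C)).IsLocalization (Minus.quasiIso C) := by
  have h : Minus.quasiIso C = ((HomotopyCategory.subcategoryAcyclic C).inverseImage
      (HomotopyCategory.minus C).ι).trW := by
    ext K L f
    obtain ⟨M, g, h, mem⟩ := distinguished_cocone_triangle f
    have := (HomotopyCategory.subcategoryAcyclic C).trW_iff_of_distinguished _
      ((HomotopyCategory.minus C).ι.map_distinguished _ mem)
    rw [← HomotopyCategory.quasiIso_eq_trW_subcategoryAcyclic] at this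
    exact this.trans (((HomotopyCategory.subcategoryAcyclic C).inverseImage
      (HomotopyCategory.minus C).ι).trW_iff_of_distinguished _ mem).symm
  rw [h]
  let e : (HomotopyCategory.minus C).ι ⋙ DerivedCategory.Qh ≅ Minus.Qh ⋙ Minus.ι := Iso.refl _
  exact ((HomotopyCategory.minus C).triangulatedLocalizerMorphism
    (HomotopyCategory.subcategoryAcyclic C)).isLocalization_of_isLocalizedFullyFaithful e

end DerivedCategory

end

namespace CategoryTheory.Functor

variable {C D : Type*} [Category* C] [Abelian C] [HasDerivedCategory C]
  [Category* D] [Abelian D] [HasDerivedCategory D]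

/-- The functor between bounded above derived categories induced by an exact functor. -/
def mapDerivedCategoryMinus (F : C ⥤ D) [F.Additive] [PreservesFiniteLimits F]
    [PreservesFiniteColimits F] : DerivedCategory.Minus C ⥤ DerivedCategory.Minus D :=
  DerivedCategory.TStructure.t.minus.lift (DerivedCategory.Minus.ι ⋙ F.mapDerivedCategory) (by
    rintro ⟨X, n, ⟨K, e, hK⟩⟩
    exact ⟨n, ⟨⟨_, F.mapDerivedCategory.mapIso e ≪≫ F.mapDerivedCategoryFactors.app K,
      inferInstanceAs (CochainComplex.IsStrictlyLE ((F.mapHomologicalComplex _).obj K) n)⟩⟩⟩)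

/-- The property that the total left derived functor on bounded above derived categories
exists. -/
abbrev HasLeftDerivedFunctorMinus (F : C ⥤ D) [F.Additive] : Prop :=
  (F.mapHomotopyCategoryMinus ⋙ DerivedCategory.Minus.Qh).HasLeftDerivedFunctor
    (DerivedCategory.Minus.quasiIso C)

/-- The total left derived functor `D⁻(C) ⥤ D⁻(D)` of an additive functor `C ⥤ D`. -/
def leftDerivedFunctorMinus (F : C ⥤ D) [F.Additive] [F.HasLeftDerivedFunctorMinus] :
    DerivedCategory.Minus C ⥤ DerivedCategory.Minus D :=
  (F.mapHomotopyCategoryMinus ⋙ DerivedCategory.Minus.Qh).totalLeftDerived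
    DerivedCategory.Minus.Qh (DerivedCategory.Minus.quasiIso C)

end CategoryTheory.Functor

namespace CategoryTheory.Triangulated.TStructure

variable {C : Type*} [Category* C] [Preadditive C] [HasZeroObject C] [HasShift C ℤ]
  [∀ n : ℤ, (shiftFunctor C n).Additive] [Pretriangulated C] [IsTriangulated C]

/-- The cohomological functor `τ^{≤0} τ^{≥0}` with values in the heart of a t-structure. -/
def heartCohomology (t : TStructure C) : C ⥤ t.heart.FullSubcategory :=
  t.heart.lift (t.truncGE 0 ⋙ t.truncLE 0) fun X =>
    (t.mem_heart_iff _).2 ⟨inferInstanceAs (t.IsLE ((t.truncLE 0).obj ((t.truncGE 0).obj X)) 0),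
      t.isGE_of_iso ((t.truncGELEIsoLEGE 0 0).app X) 0⟩

end CategoryTheory.Triangulated.TStructure

namespace AlgebraicGeometry.Scheme

/-- The set of points where the stalk is nonzero. -/
def Modules.supp {X : Scheme.{u}} (M : X.Modules) : Set X :=
  {x | ¬ IsZero (M.presheaf.stalk x)}

/-- The coherent sheaves with support of dimension at most one. -/
def cohLEOne (X : Scheme.{u}) : ObjectProperty (Coh X) := fun F =>
  topologicalKrullDim (Modules.supp F.obj) ≤ 1

/-- The coherent sheaves without nonzero morphism from a coherent sheaf with support of
dimension at most one. -/
def cohGETwo (X : Scheme.{u}) : ObjectProperty (Coh X) := fun E =>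
  ∀ (F : Coh X), cohLEOne X F → ∀ f : F ⟶ E, f = 0

section

variable (X : Scheme.{u}) [IsLocallyNoetherian X]

instance : HasDerivedCategory (Coh X) := HasDerivedCategory.standard _

/-- The unbounded derived category of coherent sheaves. -/
abbrev DCoh := DerivedCategory (Coh X)

/-- The bounded above derived category of coherent sheaves. -/
abbrev DCohMinus := DerivedCategory.Minus (Coh X)

variable {X} in
/-- The condition that a t-structure on the derived category of coherent sheaves is the one
obtained by tilting with respect to the sheaves with support of dimension at most one. -/
structure IsTiltedTStructure (t : TStructure (DCoh X)) : Prop where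
  le_zero_iff (E : DCoh X) : t.le 0 E ↔
    cohLEOne X ((DerivedCategory.homologyFunctor (Coh X) 0).obj E) ∧
      ∀ i : ℤ, 0 < i → IsZero ((DerivedCategory.homologyFunctor (Coh X) i).obj E)
  ge_zero_iff (E : DCoh X) : t.ge 0 E ↔
    cohGETwo X ((DerivedCategory.homologyFunctor (Coh X) (-1)).obj E) ∧
      ∀ i : ℤ, i < -1 → IsZero ((DerivedCategory.homologyFunctor (Coh X) i).obj E)

variable {X} in
/-- The inclusion of the heart in the bounded above derived category. -/
def IsTiltedTStructure.heartToMinus {t : TStructure (DCoh X)} (ht : IsTiltedTStructure t) :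
    t.heart.FullSubcategory ⥤ DCohMinus X :=
  DerivedCategory.TStructure.t.minus.lift t.heart.ι fun E =>
    ⟨0, (DerivedCategory.isLE_iff E.obj 0).2 ((ht.le_zero_iff E.obj).1 E.property.1).2⟩

end

variable {X Y : Scheme.{u}} [IsLocallyNoetherian X] [IsLocallyNoetherian Y]

/-- The endofunctor `ℋ⁰ Lf^* f_*` of the heart: the heart lies in `D⁻(X)`, the direct image
`f_* : D⁻(X) ⥤ D⁻(Y)` is exact, `Lf^* : D⁻(Y) ⥤ D⁻(X)` is the total left derived functor, and
`ℋ⁰` is taken in `D(X)`. -/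
def IsTiltedTStructure.heartEndofunctor {t : TStructure (DCoh X)} (ht : IsTiltedTStructure t)
    (f : X ⟶ Y) [IsClosedImmersion f] [(cohPullback f).HasLeftDerivedFunctorMinus] :
    t.heart.FullSubcategory ⥤ t.heart.FullSubcategory :=
  ht.heartToMinus ⋙ (cohPushforward f).mapDerivedCategoryMinus ⋙
    (cohPullback f).leftDerivedFunctorMinus ⋙ DerivedCategory.Minus.ι ⋙ t.heartCohomology

section BaseChange

variable {k : Type u} [Field k] {X : Scheme.{u}} (p : X ⟶ Spec (.of k))

/-- The base change `X ⊗_k A` of a `k`-scheme to a `k`-algebra. -/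
def baseChange (A : Type u) [CommRing A] [Algebra k A] : Scheme.{u} :=
  pullback p (Spec.map (CommRingCat.ofHom (algebraMap k A)))

variable {A B : Type u} [CommRing A] [Algebra k A] [CommRing B] [Algebra k B]

/-- The morphism `X ⊗_k B ⟶ X ⊗_k A` induced by a homomorphism `A → B` of `k`-algebras. -/
def baseChangeMap (φ : A →ₐ[k] B) : baseChange p B ⟶ baseChange p A :=
  pullback.map _ _ _ _ (𝟙 X) (Spec.map (CommRingCat.ofHom φ.toRingHom)) (𝟙 _) (by simp) (by
    rw [Category.comp_id, ← Spec.map_comp, ← CommRingCat.ofHom_comp]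
    congr 2
    exact φ.comp_algebraMap.symm)

lemma isPullback_baseChangeMap (φ : A →ₐ[k] B) : IsPullback (baseChangeMap p φ)
    (pullback.snd _ _) (pullback.snd _ _) (Spec.map (CommRingCat.ofHom φ.toRingHom)) := by
  have h : Spec.map (CommRingCat.ofHom φ.toRingHom) ≫
      Spec.map (CommRingCat.ofHom (algebraMap k A)) =
      Spec.map (CommRingCat.ofHom (algebraMap k B)) := by
    rw [← Spec.map_comp, ← CommRingCat.ofHom_comp]
    congr 2
    exact φ.comp_algebraMap
  have h1 : baseChangeMap p φ ≫ pullback.fst _ _ = pullback.fst _ _ :=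
    (pullback.lift_fst _ _ _).trans (Category.comp_id _)
  have h2 : IsPullback (pullback.fst p (Spec.map (CommRingCat.ofHom (algebraMap k B))))
      (pullback.snd _ _) p (Spec.map (CommRingCat.ofHom (algebraMap k B))) :=
    IsPullback.of_hasPullback _ _
  have h3 : IsPullback (pullback.fst p (Spec.map (CommRingCat.ofHom (algebraMap k A))))
      (pullback.snd _ _) p (Spec.map (CommRingCat.ofHom (algebraMap k A))) :=
    IsPullback.of_hasPullback _ _
  refine IsPullback.of_right (h₁₁ := baseChangeMap p φ)
    (h₁₂ := pullback.fst p (Spec.map (CommRingCat.ofHom (algebraMap k A))))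
    (v₁₂ := pullback.snd p (Spec.map (CommRingCat.ofHom (algebraMap k A)))) ?_ ?_ h3
  · rw [h1, h]
    exact h2
  · exact pullback.lift_snd _ _ _

lemma isClosedImmersion_baseChangeMap (φ : A →ₐ[k] B) (hφ : Function.Surjective φ) :
    IsClosedImmersion (baseChangeMap p φ) :=
  MorphismProperty.of_isPullback (isPullback_baseChangeMap p φ).flip
    (IsClosedImmersion.spec_of_surjective (CommRingCat.ofHom φ.toRingHom) hφ)

instance [LocallyOfFiniteType p] [IsNoetherianRing A] : IsLocallyNoetherian (baseChange p A) :=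
  have : LocallyOfFiniteType (pullback.snd p (Spec.map (CommRingCat.ofHom (algebraMap k A)))) :=
    inferInstance
  have : IsLocallyNoetherian (pullback p (Spec.map (CommRingCat.ofHom (algebraMap k A)))) :=
    LocallyOfFiniteType.isLocallyNoetherian
      (pullback.snd p (Spec.map (CommRingCat.ofHom (algebraMap k A))))
  this

end BaseChange

attribute [local instance] MvPolynomial.gradedAlgebra in
/-- Smooth projective threefolds over a field: integral closed subschemes of a projective space
which are smooth of relative dimension three. -/
class IsSmoothProjectiveThreefold {k : Type u} [Field k] {X : Scheme.{u}}
    (p : X ⟶ Spec (.of k)) : Prop where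
  isIntegral : IsIntegral X
  smooth : SmoothOfRelativeDimension 3 p
  projective : ∃ (n : ℕ) (i : X ⟶ Proj (MvPolynomial.homogeneousSubmodule (Fin (n + 1)) k)),
    IsClosedImmersion i ∧
      i ≫ Proj.toSpecZero (MvPolynomial.homogeneousSubmodule (Fin (n + 1)) k) ≫
        Spec.map (CommRingCat.ofHom
          (algebraMap k (MvPolynomial.homogeneousSubmodule (Fin (n + 1)) k 0))) = p

section Truncations

variable {k : Type u} [Field k] {X : Scheme.{u}} (p : X ⟶ Spec (.of k))

instance [hp : IsSmoothProjectiveThreefold p] : LocallyOfFiniteType p := by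
  have := hp.smooth
  have := SmoothOfRelativeDimension.smooth 3 p
  infer_instance

variable {R : Type u} [CommRing R] [Algebra k R] (π : R)

/-- The scheme `X_m = X ⊗_k R/(π^m)`. -/
abbrev thickening (m : ℕ) : Scheme.{u} := baseChange p (R ⧸ Ideal.span {π ^ m})

/-- The closed immersion `ι_m : X_m ⟶ X_R`. -/
def thickeningι (m : ℕ) : thickening p π m ⟶ baseChange p R :=
  baseChangeMap p (Ideal.Quotient.mkₐ k (Ideal.span {π ^ m}))

instance (m : ℕ) : IsClosedImmersion (thickeningι p π m) :=
  isClosedImmersion_baseChangeMap p _ (Ideal.Quotient.mkₐ_surjective k _)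

lemma span_pow_le {m' m : ℕ} (h : m' ≤ m) : Ideal.span {π ^ m} ≤ Ideal.span {π ^ m'} :=
  Ideal.span_singleton_le_span_singleton.2 (pow_dvd_pow π h)

/-- The closed immersion `ι_{m,m'} : X_{m'} ⟶ X_m` for `m' ≤ m`. -/
def thickeningMap {m' m : ℕ} (h : m' ≤ m) : thickening p π m' ⟶ thickening p π m :=
  baseChangeMap p (Ideal.Quotient.factorₐ k (span_pow_le π h))

instance {m' m : ℕ} (h : m' ≤ m) : IsClosedImmersion (thickeningMap p π h) :=
  isClosedImmersion_baseChangeMap p _ (Ideal.Quotient.factor_surjective (span_pow_le π h))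

end Truncations

end AlgebraicGeometry.Scheme

end

/-! Let `f` be one of the closed immersions. The counit of the adjunction between `f^*` and `f_*` on
coherent sheaves is an isomorphism, and it extends to a transformation `Lf^* f_* ⟶ id` on `D⁻`
(`Adjunction.derivedCounit`). The isomorphism sought is this transformation after `ℋ⁰`. By the long
exact sequence it is enough that, on the heart, its cone lies in `D^{≤ -2}` of the tilted
t-structure: the sheaf cohomology of the cone vanishes in degrees at least `-1` and has support of
dimension at most one in degree `-2`. Only `E ∈ D^{≤ 0}` matters for this.

Represent `E` by a complex `K` in degrees at most `0` and resolve `f_* K` by a complex `P` of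
adapted sheaves. Up to isomorphism the cone in question is `f^* N`, with `N` the cone of `P ⟶ f_*
K`, an acyclic complex in degrees at most `0`. Right exactness of `f^*` kills the cohomology in
degrees at least `-1` (`isZero_homology_map_of_acyclic`). In degree `-2` it embeds in the kernel of
`f^* Z ⟶ f^* N^{-1}`, where `Z` is the kernel of `N^{-1} = P^0 ⊕ f_* K^{-1} ⟶ f_* K^0`. Now `Z` is
an extension of the kernel of `r : P^0 ⟶ f_* H^0(K)` by `f_* ker(K^{-1} ⟶ K^0)`. The second piece
contributes nothing because `f^* f_* = id`, so the cohomology embeds in the kernel of `f^* ker r ⟶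
f^* P^0` (`prop_of_mono_of_comp_eq_zero`). That sheaf vanishes off the support of `H^0(K)`, where
`ker r = P^0` (`supp_kernel_cohPullback_map_subset`), and `H^0(K)` has support of dimension at most
one.

The derived functor exists because the coherent sheaves on `X ⊗ A` that are flat over `A` are
adapted to `f^*`. There are enough of them: the projection `q : X ⊗ A ⟶ X` is affine, so every
coherent sheaf is a quotient of some `q^* G` with `G` coherent, or of a finite sum of such
(`exists_epi_of_cohPullback`), and `q^* G` is flat since `k` is a field. The t-structure comes from
tilting (`DerivedCategory.tilt`): sheaves with support of dimension at most one form a Serre class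
in a category of noetherian objects, hence a torsion class (`IsSerre.isTorsionPair`). -/

noncomputable section

/-! ### Pointwise left derived functors from adapted objects -/

namespace CategoryTheory

namespace Functor

section AdaptedObjects

variable {C D H : Type*} [Category* C] [Category* D] [Category* H]

/-- A property of objects is adapted to a functor `F : C ⥤ H` with respect to a class of morphisms
`W` when each object receives a morphism in `W` from an object with the property, and `F` inverts
the morphisms in `W` between such objects. -/
structure IsLeftAdapted (F : C ⥤ H) (W : MorphismProperty C) (S : ObjectProperty C) : Prop where
  exists_resolution (X : C) : ∃ (P : C) (_ : S P) (w : P ⟶ X), W w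
  isIso_map {P Q : C} (w : P ⟶ Q) (hP : S P) (hQ : S Q) (hw : W w) : IsIso (F.map w)

namespace IsLeftAdapted

variable {F : C ⥤ H} {W : MorphismProperty C} {S : ObjectProperty C}

section

variable (h : F.IsLeftAdapted W S) [W.HasRightCalculusOfFractions]
include h

lemma exists_rightFraction (L : C ⥤ D) [L.IsLocalization W] {P X : C} (u : L.obj P ⟶ L.obj X) :
    ∃ (φ : W.RightFraction P X), S φ.X' ∧ L.map φ.s ≫ u = L.map φ.f := by
  obtain ⟨φ, rfl⟩ := Localization.exists_rightFraction L W u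
  obtain ⟨P', hP', w, hw⟩ := h.exists_resolution φ.X'
  refine ⟨⟨w ≫ φ.s, W.comp_mem _ _ hw φ.hs, w ≫ φ.f⟩, hP', ?_⟩
  simp

/-- Two fractions for the same `u` are dominated by a third, whose apex may be replaced by an
adapted object. `F` inverts its leg towards the apex of `ψ`, so the equation for `a` passes from `φ`
to `ψ`; only `ψ` needs an adapted apex. -/
lemma map_eq_of_fractions (L : C ⥤ D) [L.IsLocalization W] {P X : C} (hP : S P)
    (u : L.obj P ⟶ L.obj X) (φ ψ : W.RightFraction P X) (hψ : S ψ.X')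
    (hφu : L.map φ.s ≫ u = L.map φ.f) (hψu : L.map ψ.s ≫ u = L.map ψ.f)
    (a : F.obj P ⟶ F.obj X) (ha : F.map φ.s ≫ a = F.map φ.f) : F.map ψ.s ≫ a = F.map ψ.f := by
  have hL := Localization.inverts L W
  have e (χ : W.RightFraction P X) (hχ : L.map χ.s ≫ u = L.map χ.f) : χ.map L hL = u := by
    have := hL χ.s χ.hs
    rw [← cancel_epi (L.map χ.s), MorphismProperty.RightFraction.map_s_comp_map, hχ]
  have h1 := (MorphismProperty.RightFraction.map_eq_iff (L := L) (W := W) φ ψ).1 ((e φ hφu).trans (e ψ hψu).symm)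
  obtain ⟨Z, t₁, t₂, h₁, h₂, h₃⟩ := h1
  obtain ⟨P', hP', w, hw⟩ := h.exists_resolution Z
  have : IsIso (F.map (w ≫ t₂ ≫ ψ.s)) :=
    h.isIso_map _ hP' hP (W.comp_mem _ _ hw (h₁ ▸ h₃))
  have h4 : IsIso (F.map ψ.s) := h.isIso_map _ hψ hP ψ.hs
  have h5 : IsIso (F.map (w ≫ t₂)) := by
    rw [← Category.assoc, F.map_comp] at this
    exact IsIso.of_isIso_comp_right _ (F.map ψ.s)
  rw [← cancel_epi (F.map (w ≫ t₂)), ← F.map_comp_assoc, Category.assoc, ← h₁, ← F.map_comp,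
    Category.assoc, ← h₂, F.map_comp, F.map_comp, Category.assoc, Category.assoc, ha,
    F.map_comp, F.map_comp]

lemma exists_map (L : C ⥤ D) [L.IsLocalization W] {P X : C} (hP : S P)
    (u : L.obj P ⟶ L.obj X) : ∃ a : F.obj P ⟶ F.obj X, ∀ (φ : W.RightFraction P X), S φ.X' →
      L.map φ.s ≫ u = L.map φ.f → F.map φ.s ≫ a = F.map φ.f := by
  obtain ⟨φ, hφ, hu⟩ := h.exists_rightFraction L u
  have := h.isIso_map _ hφ hP φ.hs
  exact ⟨CategoryTheory.inv (F.map φ.s) ≫ F.map φ.f, fun ψ hψ hψu =>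
    h.map_eq_of_fractions L hP u φ ψ hψ hu hψu _ (by simp)⟩

/-- At an adapted `P` the derived functor has value `F P`. Fractions with adapted apex turn each
arrow `L P ⟶ L X` into `F P ⟶ F X`, and any cone on these data is determined by its leg at the
identity of `L P`. -/
lemma exists_isLimit (L : C ⥤ D) [L.IsLocalization W] {P : C} (hP : S P) :
    ∃ (c : Cone (StructuredArrow.proj (L.obj P) L ⋙ F)) (_ : IsLimit c),
      IsIso (c.π.app (StructuredArrow.mk (𝟙 (L.obj P)))) := by
  have hL := Localization.inverts L W
  choose a ha using fun (j : StructuredArrow (L.obj P) L) => h.exists_map L hP j.hom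
  have nat {i j : StructuredArrow (L.obj P) L} (g : i ⟶ j) : a j = a i ≫ F.map g.right := by
    obtain ⟨φ, hφ, hu⟩ := h.exists_rightFraction L i.hom
    have := h.isIso_map _ hφ hP φ.hs
    rw [← cancel_epi (F.map φ.s), ← Category.assoc, ha _ _ hφ hu, ← F.map_comp]
    refine ha j ⟨φ.s, φ.hs, φ.f ≫ g.right⟩ hφ ?_
    rw [L.map_comp, ← hu, Category.assoc]
    congr 1
    exact (StructuredArrow.w g).symm
  have ha₁ : a (StructuredArrow.mk (𝟙 (L.obj P))) = 𝟙 _ := by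
    have := ha (StructuredArrow.mk (𝟙 (L.obj P))) ⟨𝟙 P, W.id_mem _, 𝟙 P⟩ hP (by simp)
    simpa using this
  refine ⟨{ pt := F.obj P, π := { app := a, naturality := fun i j g => (Category.id_comp _).trans (nat g) } },
    { lift := fun s => s.π.app (StructuredArrow.mk (𝟙 (L.obj P))), fac := fun s j => ?_,
      uniq := fun s m hm => ?_ }, ?_⟩
  · obtain ⟨φ, hφ, hu⟩ := h.exists_rightFraction L j.hom
    have := h.isIso_map _ hφ hP φ.hs
    have := hL φ.s φ.hs
    -- The apex of the fraction is itself an object under `L P`. It maps to the identity arrow by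
    -- `φ.s` and to `j` by `φ.f`, so the leg at `j` is read off from the leg at the identity.
    let i : StructuredArrow (L.obj P) L := StructuredArrow.mk (CategoryTheory.inv (L.map φ.s))
    let p : s.pt ⟶ F.obj φ.X' := s.π.app i
    let q : s.pt ⟶ F.obj P := s.π.app (StructuredArrow.mk (𝟙 (L.obj P)))
    have e₁ : p ≫ F.map φ.s = q := s.w (StructuredArrow.homMk φ.s (by simp [i]) :
      i ⟶ StructuredArrow.mk (𝟙 (L.obj P)))
    have e₂ : p ≫ F.map φ.f = s.π.app j :=
      s.w (StructuredArrow.homMk φ.f (by simp [i, ← hu]) : i ⟶ j)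
    change q ≫ a j = _
    rw [← e₁, ← e₂, Category.assoc, ha j φ hφ hu]
  · have := hm (StructuredArrow.mk (𝟙 (L.obj P)))
    dsimp at this
    rw [ha₁] at this
    rw [← this]
    exact (Category.comp_id m).symm
  · dsimp
    rw [ha₁]
    exact inferInstanceAs (IsIso (𝟙 (F.obj P)))

lemma hasPointwiseLeftDerivedFunctor : F.HasPointwiseLeftDerivedFunctor W := by
  intro X
  obtain ⟨P, hP, w, hw⟩ := h.exists_resolution X
  rw [← hasPointwiseLeftDerivedFunctorAt_iff_of_mem F W w hw]
  obtain ⟨c, hc, -⟩ := h.exists_isLimit W.Q hP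
  exact ⟨⟨_, hc⟩⟩

/-- The derived functor is a pointwise Kan extension, so its value at `L P` is the limit of
`exists_isLimit`, and `α` at `P` is the leg at the identity arrow. -/
lemma isIso_app {L : C ⥤ D} [L.IsLocalization W] {LF : D ⥤ H} (α : L ⋙ LF ⟶ F)
    [LF.IsLeftDerivedFunctor α W] {P : C} (hP : S P) : IsIso (α.app P) := by
  have := h.hasPointwiseLeftDerivedFunctor
  have hE := isPointwiseRightKanExtensionOfHasPointwiseLeftDerivedFunctor LF α W (L.obj P)
  obtain ⟨c, hc, hc'⟩ := h.exists_isLimit L hP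
  have e₂ : (((RightExtension.mk LF α).coneAt (L.obj P)).π.app
      (StructuredArrow.mk (𝟙 (L.obj P)))) = α.app P := by
    simp only [RightExtension.coneAt]
    change LF.map (𝟙 (L.obj P)) ≫ α.app P = _
    rw [LF.map_id]
    exact Category.id_comp (α.app P)
  rw [← e₂, ← IsLimit.conePointUniqueUpToIso_hom_comp hE hc]
  exact IsIso.comp_isIso' (Iso.isIso_hom _) hc'

end

end IsLeftAdapted

end AdaptedObjects

end Functor

end CategoryTheory

/-! ### Resolutions of bounded above complexes -/

namespace CategoryTheory

open HomologicalComplex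

variable {C D : Type*} [Category* C] [Abelian C] [Category* D] [Abelian D]

namespace ObjectProperty

/-- A property of objects in an abelian category is adapted to an additive functor `F` if every
object is a quotient of an object with the property, kernels of epimorphisms between such objects
have the property, and `F` is exact on short exact sequences of such objects. -/
structure IsAdaptedTo (S : ObjectProperty C) (F : C ⥤ D) [F.Additive] : Prop where
  of_iso {X Y : C} (e : X ≅ Y) (hX : S X) : S Y
  of_isZero {X : C} (hX : IsZero X) : S X
  biprod {X Y : C} (hX : S X) (hY : S Y) : S (X ⊞ Y)
  exists_epi (X : C) : ∃ (P : C) (_ : S P) (f : P ⟶ X), Epi f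
  kernel {T : ShortComplex C} (hT : T.ShortExact) (h₂ : S T.X₂) (h₃ : S T.X₃) : S T.X₁
  exact {T : ShortComplex C} (hT : T.ShortExact) (h₁ : S T.X₁) (h₂ : S T.X₂) (h₃ : S T.X₃) :
    (T.map F).ShortExact

section resolution

/-- A partial resolution of a chain complex: a term in degree `n` together with an object over
the cycles in degree `n`. -/
structure ResolutionStage (S : ObjectProperty C) (K : ChainComplex C ℕ) (n : ℕ) where
  obj : C
  prop : S obj
  hom : obj ⟶ K.X n
  cycles : C
  ι : cycles ⟶ obj

variable {S : ObjectProperty C} (hS : ∀ X : C, ∃ (P : C) (_ : S P) (f : P ⟶ X), Epi f)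
  (K : ChainComplex C ℕ)

/-- A chosen epimorphism from an object with the given property. -/
def coverObj (X : C) : C := (hS X).choose

omit [Abelian C] in
lemma coverObj_prop (X : C) : S (coverObj hS X) := (hS X).choose_spec.choose

/-- A chosen epimorphism from an object with the given property. -/
def coverπ (X : C) : coverObj hS X ⟶ X := (hS X).choose_spec.choose_spec.choose

instance (X : C) : Epi (coverπ hS X) := (hS X).choose_spec.choose_spec.choose_spec

variable {K} in
/-- The object over which the next term of the resolution is chosen. -/
abbrev ResolutionStage.target {n : ℕ} (s : ResolutionStage S K n) : C :=
  pullback (s.ι ≫ s.hom) (K.d (n + 1) n)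

variable {K} in
/-- The differential from the next term of the resolution. -/
def ResolutionStage.d {n : ℕ} (s : ResolutionStage S K n) : coverObj hS s.target ⟶ s.obj :=
  coverπ hS _ ≫ pullback.fst _ _ ≫ s.ι

variable {K} in
/-- The next term of the resolution. -/
def ResolutionStage.next {n : ℕ} (s : ResolutionStage S K n) : ResolutionStage S K (n + 1) where
  obj := coverObj hS s.target
  prop := coverObj_prop hS _
  hom := coverπ hS _ ≫ pullback.snd _ _
  cycles := Limits.kernel (s.d hS)
  ι := kernel.ι _

/-- The terms of the resolution. -/
def resolutionStage : ∀ n, ResolutionStage S K n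
  -- Nothing leaves degree `0` of a chain complex, so everything is a cycle there and the inclusion
  -- of cycles is the identity.
  | 0 => { obj := coverObj hS (K.X 0), prop := coverObj_prop hS _, hom := coverπ hS _,
           cycles := coverObj hS (K.X 0), ι := 𝟙 _ }
  | n + 1 => (resolutionStage n).next hS

lemma ResolutionStage.next_ι_d {n : ℕ} (s : ResolutionStage S K n) :
    (s.next hS).ι ≫ s.d hS = 0 := kernel.condition (s.d hS)

lemma ResolutionStage.next_d_d {n : ℕ} (s : ResolutionStage S K n) :
    (s.next hS).d hS ≫ s.d hS = 0 :=
  (Category.assoc _ _ _).trans <| (congrArg (coverπ hS _ ≫ ·) ((Category.assoc _ _ _).trans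
    (congrArg (pullback.fst _ _ ≫ ·) (s.next_ι_d hS K)))).trans (by simp)

lemma ResolutionStage.next_hom_comp {n : ℕ} (s : ResolutionStage S K n) :
    (s.next hS).hom ≫ K.d (n + 1) n = s.d hS ≫ s.hom := by
  simp only [ResolutionStage.next, ResolutionStage.d, Category.assoc]
  exact congrArg (coverπ hS _ ≫ ·) pullback.condition.symm

/-- The surjectivity behind both halves of the quasi-isomorphism. When `k` bounds the image of a
cycle `z` it gives injectivity on homology; when `z = 0` it gives surjectivity in positive degrees.
-/
lemma ResolutionStage.exists_lift {n : ℕ} (s : ResolutionStage S K n) {A : C}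
    (z : A ⟶ s.cycles) (k : A ⟶ K.X (n + 1)) (h : z ≫ s.ι ≫ s.hom = k ≫ K.d (n + 1) n) :
    ∃ (A' : C) (π : A' ⟶ A) (_ : Epi π) (x : A' ⟶ (s.next hS).obj),
      x ≫ s.d hS = π ≫ z ≫ s.ι ∧ x ≫ (s.next hS).hom = π ≫ k := by
  obtain ⟨A', π, hπ, x, hx⟩ := surjective_up_to_refinements_of_epi
    (coverπ hS s.target) (pullback.lift z k h)
  have h₁ : x ≫ coverπ hS s.target ≫ pullback.fst _ _ ≫ s.ι = π ≫ z ≫ s.ι := by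
    rw [← reassoc_of% hx, pullback.lift_fst_assoc]
  have h₂ : x ≫ coverπ hS s.target ≫ pullback.snd _ _ = π ≫ k := by
    rw [← reassoc_of% hx, pullback.lift_snd]
  exact ⟨A', π, hπ, x, h₁, h₂⟩

/-- A resolution of a chain complex by objects with the given property. -/
def resolution : ChainComplex C ℕ :=
  ChainComplex.of (fun n => (resolutionStage hS K n).obj) (fun n => (resolutionStage hS K n).d hS)
    (fun n => (resolutionStage hS K n).next_d_d hS K)

lemma resolution_d (n : ℕ) :
    (resolution hS K).d (n + 1) n = (resolutionStage hS K n).d hS := by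
  simp only [resolution]
  exact ChainComplex.of_d (fun n => (resolutionStage hS K n).obj)
    (fun n => (resolutionStage hS K n).d hS) n

/-- The augmentation of the resolution. -/
def resolutionHom : resolution hS K ⟶ K where
  f n := (resolutionStage hS K n).hom
  comm' := by
    rintro _ n rfl
    rw [resolution_d]
    exact (resolutionStage hS K n).next_hom_comp hS K

lemma exists_resolution_lift (n : ℕ) {A : C} (z : A ⟶ (resolutionStage hS K n).cycles)
    (k : A ⟶ K.X (n + 1)) (h : z ≫ (resolutionStage hS K n).ι ≫ (resolutionStage hS K n).hom =
      k ≫ K.d (n + 1) n) :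
    ∃ (A' : C) (π : A' ⟶ A) (_ : Epi π) (x : A' ⟶ (resolution hS K).X (n + 1)),
      x ≫ (resolution hS K).d (n + 1) n = π ≫ z ≫ (resolutionStage hS K n).ι ∧
      x ≫ (resolutionHom hS K).f (n + 1) = π ≫ k := by
  rw [resolution_d]
  exact (resolutionStage hS K n).exists_lift hS K z k h

lemma exists_cycles_lift (n : ℕ) {A : C} (x : A ⟶ (resolution hS K).X n)
    (h : x ≫ (resolution hS K).d n ((ComplexShape.down ℕ).next n) = 0) :
    ∃ z : A ⟶ (resolutionStage hS K n).cycles, z ≫ (resolutionStage hS K n).ι = x := by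
  cases n with
  | zero => exact ⟨x, Category.comp_id _⟩
  | succ n =>
    rw [ChainComplex.next_nat_succ, resolution_d] at h
    exact ⟨kernel.lift _ x h, kernel.lift_ι _ _ _⟩

instance : QuasiIso (resolutionHom hS K) := by
  rw [quasiIso_iff]
  intro n
  rw [quasiIsoAt_iff_isIso_homologyMap]
  have hm : Mono (homologyMap (resolutionHom hS K) n) := by
    rw [mono_homologyMap_iff_up_to_refinements _ (n + 1) n _ (by simp) rfl]
    intro A x hx y hy
    obtain ⟨z, rfl⟩ := exists_cycles_lift hS K n x hx
    obtain ⟨A', π, hπ, x', h₁, -⟩ := exists_resolution_lift hS K n z y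
      ((Category.assoc _ _ _).symm.trans hy)
    exact ⟨A', π, hπ, x', h₁.symm⟩
  have he : Epi (homologyMap (resolutionHom hS K) n) := by
    rw [epi_homologyMap_iff_up_to_refinements _ (n + 1) n _ (by simp) rfl]
    intro A y hy
    cases n with
    | zero =>
      obtain ⟨A', π, hπ, (x : A' ⟶ (resolution hS K).X 0), hx⟩ :=
        surjective_up_to_refinements_of_epi (coverπ hS (K.X 0)) y
      refine ⟨A', π, hπ, x, ?_, 0, ?_⟩
      · rw [HomologicalComplex.shape _ _ _ (by simp), comp_zero]
      · rw [zero_comp, add_zero]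
        exact hx
    | succ n =>
      rw [ChainComplex.next_nat_succ] at hy
      obtain ⟨A', π, hπ, x, h₁, h₂⟩ := exists_resolution_lift hS K n 0 y (by simp [hy])
      refine ⟨A', π, hπ, x, ?_, 0, ?_⟩
      · rw [ChainComplex.next_nat_succ, h₁, zero_comp]; exact comp_zero
      · rw [zero_comp, add_zero, h₂]
  exact isIso_of_mono_of_epi _

/-- Bounded above complexes have resolutions by objects in a class that covers all objects. -/
lemma exists_resolution_of_isStrictlyLE
    (hS : ∀ X : C, ∃ (P : C) (_ : S P) (f : P ⟶ X), Epi f) (h0 : ∀ X, IsZero X → S X)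
    (hiso : ∀ {X Y : C} (_ : X ≅ Y), S X → S Y) (K : CochainComplex C ℤ) (N : ℤ)
    [K.IsStrictlyLE N] :
    ∃ (P : CochainComplex C ℤ) (f : P ⟶ K), QuasiIso f ∧ P.IsStrictlyLE N ∧ ∀ i, S (P.X i) := by
  -- The truncation of `K` at `N` is read as a chain complex starting at `N`, resolved there and
  -- extended by zero. The added zero terms have the property by `h0`.
  let e := ComplexShape.embeddingUpIntLE N
  let K' : ChainComplex C ℕ := HomologicalComplex.truncLE' K e
  have h1 : QuasiIso (extendMap (resolutionHom hS K') e) :=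
    (quasiIso_extendMap_iff _ _).2 inferInstance
  let g : (resolution hS K').extend e ⟶ K :=
    extendMap (resolutionHom hS K') e ≫ (K.truncLEIso e).inv ≫ HomologicalComplex.ιTruncLE K e
  have : QuasiIso (HomologicalComplex.ιTruncLE K e) := inferInstance
  have hg : QuasiIso g := quasiIso_comp (extendMap (resolutionHom hS K') e)
    ((K.truncLEIso e).inv ≫ HomologicalComplex.ιTruncLE K e)
  refine ⟨(resolution hS K').extend e, g, hg,
    inferInstanceAs (((resolution hS K').extend e).IsStrictlySupported e), fun i => ?_⟩
  by_cases hi : ∃ n, e.f n = i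
  · obtain ⟨n, hn⟩ := hi
    exact hiso (extendXIso _ e hn).symm (resolutionStage hS K' n).prop
  · exact h0 _ (isZero_extend_X _ _ _ (by simpa using hi))

end resolution

end ObjectProperty

end CategoryTheory

/-! ### Additive functors on acyclic complexes of adapted objects -/

namespace CategoryTheory

open HomologicalComplex

variable {C D : Type*} [Category* C] [Abelian C] [Category* D] [Abelian D]

/-- The short exact sequence of cycles in an acyclic complex. -/
def cyclesShortComplex (K : CochainComplex C ℤ) (i : ℤ) : ShortComplex C :=
  ShortComplex.mk (K.iCycles i) (K.toCycles i (i + 1)) (by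
    rw [← cancel_mono (K.iCycles (i + 1))]; simp)

lemma ShortComplex.exact_mk_iff {X Y Z : C} (f : X ⟶ Y) (g : Y ⟶ Z) (w : f ≫ g = 0) :
    (ShortComplex.mk f g w).Exact ↔ ∀ (A : C) (x : A ⟶ Y), x ≫ g = 0 →
      ∃ (A' : C) (π : A' ⟶ A) (_ : Epi π) (x₁ : A' ⟶ X), π ≫ x = x₁ ≫ f :=
  ShortComplex.exact_iff_exact_up_to_refinements _

lemma cyclesShortComplex_shortExact {K : CochainComplex C ℤ} (hK : K.Acyclic) (i : ℤ) :
    (cyclesShortComplex K i).ShortExact where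
  exact := (ShortComplex.exact_mk_iff _ _ _).2 fun A x hx => by
    have := hx =≫ K.iCycles (i + 1)
    rw [Category.assoc, toCycles_i, zero_comp] at this
    exact ⟨A, 𝟙 A, inferInstance, K.liftCycles x (i + 1) (by simp) this, by simp⟩
  mono_f := inferInstanceAs (Mono (K.iCycles i))
  epi_g := by
    have h := (ShortComplex.exact_mk_iff _ _ _).1
      ((K.exactAt_iff' i (i + 1) (i + 1 + 1) (by simp) (by simp)).1 (hK (i + 1)))
    refine (epi_iff_surjective_up_to_refinements (K.toCycles i (i + 1))).2 fun A y => ?_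
    obtain ⟨A', π, hπ, x, hx⟩ := h _ (y ≫ K.iCycles (i + 1)) (by simp)
    refine ⟨A', π, hπ, x, ?_⟩
    rw [← cancel_mono (K.iCycles (i + 1)), Category.assoc, hx, Category.assoc, toCycles_i]

namespace ObjectProperty.IsAdaptedTo

variable {S : ObjectProperty C} {F : C ⥤ D} [F.Additive] (hS : S.IsAdaptedTo F)
include hS

/-- Descending induction on the degree: cycles vanish above `N`, and by acyclicity the cycles in
degree `i` are the kernel of an epimorphism from the `i`th term onto the cycles in degree `i + 1`.
-/
lemma cycles {K : CochainComplex C ℤ} (hK : K.Acyclic) (N : ℤ) [K.IsStrictlyLE N]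
    (hP : ∀ i, S (K.X i)) (i : ℤ) : S (K.cycles i) := by
  have h (n : ℕ) : ∀ i, N < i + n → S (K.cycles i) := by
    induction n with
    | zero =>
      intro i hi
      exact hS.of_isZero (IsZero.of_mono (K.iCycles i)
        (K.isZero_of_isStrictlyLE N i (by simpa using hi)))
    | succ n ih =>
      intro i hi
      exact hS.kernel (cyclesShortComplex_shortExact hK i) (hP i)
        (ih (i + 1) (by push_cast at hi; lia))
  exact h (N - i + 1).toNat i (by lia)

/-- The complex is spliced from the short exact sequences of its cycles. All their terms have the
property, so `F` keeps them exact and the splice stays exact. -/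
lemma acyclic_map {K : CochainComplex C ℤ} (hK : K.Acyclic) (N : ℤ) [K.IsStrictlyLE N]
    (hP : ∀ i, S (K.X i)) : ((F.mapHomologicalComplex _).obj K).Acyclic := by
  intro j
  obtain ⟨i, rfl⟩ : ∃ i, j = i + 1 := ⟨j - 1, by lia⟩
  have hs (i : ℤ) := hS.exact (cyclesShortComplex_shortExact hK i) (hS.cycles hK N hP i) (hP i)
    (hS.cycles hK N hP _)
  refine (HomologicalComplex.exactAt_iff' _ i (i + 1) (i + 1 + 1) (by simp) (by simp)).2
    ((ShortComplex.exact_mk_iff (F.map (K.d i (i + 1))) (F.map (K.d (i + 1) (i + 1 + 1)))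
      (by rw [← F.map_comp, K.d_comp_d, F.map_zero])).2 fun A x hx => ?_)
  have : Mono (F.map (K.iCycles (i + 1 + 1))) := (hs (i + 1 + 1)).mono_f
  have : Epi (F.map (K.toCycles i (i + 1))) := (hs i).epi_g
  have h1 : x ≫ F.map (K.toCycles (i + 1) (i + 1 + 1)) = 0 := by
    rw [← cancel_mono (F.map (K.iCycles (i + 1 + 1))), Category.assoc, ← F.map_comp, toCycles_i,
      hx, zero_comp]
  obtain ⟨A₁, π₁, hπ₁, (y : A₁ ⟶ F.obj (K.cycles (i + 1))), hy⟩ :=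
    (ShortComplex.exact_mk_iff _ _ _).1 (hs (i + 1)).exact _ x h1
  obtain ⟨A₂, π₂, hπ₂, z, hz⟩ :=
    surjective_up_to_refinements_of_epi (F.map (K.toCycles i (i + 1))) y
  change π₁ ≫ x = y ≫ F.map (K.iCycles (i + 1)) at hy
  refine ⟨A₂, π₂ ≫ π₁, inferInstance, z, ?_⟩
  rw [Category.assoc, hy, reassoc_of% hz, ← F.map_comp, toCycles_i]

end ObjectProperty.IsAdaptedTo

/-- A chain map is a quasi-isomorphism if and only if its mapping cone is acyclic. -/
lemma _root_.CochainComplex.quasiIso_iff_acyclic_mappingCone {K L : CochainComplex C ℤ} (f : K ⟶ L) :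
    QuasiIso f ↔ (CochainComplex.mappingCone f).Acyclic := by
  rw [← mem_quasiIso_iff, ← HomotopyCategory.quotient_map_mem_quasiIso_iff,
    HomotopyCategory.quasiIso_eq_trW_subcategoryAcyclic,
    ← HomotopyCategory.quotient_obj_mem_subcategoryAcyclic_iff_acyclic]
  exact (HomotopyCategory.subcategoryAcyclic C).trW_iff_of_distinguished _
    (HomotopyCategory.mappingCone_triangleh_distinguished f)

lemma _root_.CochainComplex.mappingCone.isStrictlyLE {K L : CochainComplex C ℤ} (f : K ⟶ L) (a b N : ℤ)
    [K.IsStrictlyLE a] [L.IsStrictlyLE b] (ha : a ≤ N + 1) (hb : b ≤ N) :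
    (CochainComplex.mappingCone f).IsStrictlyLE N := by
  rw [CochainComplex.isStrictlyLE_iff]
  intro i hi
  rw [CochainComplex.mappingCone.isZero_X_iff]
  exact ⟨CochainComplex.isZero_of_isStrictlyLE _ a _ (by lia),
    CochainComplex.isZero_of_isStrictlyLE _ b _ (by lia)⟩

/-- `F` commutes with mapping cones, and the terms of the cone of `f` are biproducts of terms of `K`
and `L`, so the acyclic case applies to the cone. -/
lemma ObjectProperty.IsAdaptedTo.quasiIso_map {S : ObjectProperty C} {F : C ⥤ D} [F.Additive]
    (hS : S.IsAdaptedTo F) {K L : CochainComplex C ℤ} (f : K ⟶ L) [QuasiIso f] (a b : ℤ)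
    [K.IsStrictlyLE a] [L.IsStrictlyLE b] (hK : ∀ i, S (K.X i)) (hL : ∀ i, S (L.X i)) :
    QuasiIso ((F.mapHomologicalComplex _).map f) := by
  have h := (CochainComplex.quasiIso_iff_acyclic_mappingCone f).1 inferInstance
  rw [CochainComplex.quasiIso_iff_acyclic_mappingCone]
  have := CochainComplex.mappingCone.isStrictlyLE f a b (max a b) (by lia) (by lia)
  intro i
  refine (exactAt_iff_of_quasiIsoAt (CochainComplex.mappingCone.mapHomologicalComplexIso f F).hom
    i).1 (hS.acyclic_map h (max a b) (fun i => ?_) i)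
  exact hS.of_iso (HomologicalComplex.homotopyCofiber.XIsoBiprod f i (i + 1) (by simp)).symm
    (hS.biprod (hK _) (hL _))

end CategoryTheory

/-! ### The total left derived functor on `D⁻` -/

namespace DerivedCategory

variable {C D : Type*} [Category* C] [Abelian C] [Category* D] [Abelian D]

/-- Both sides say that the cone is acyclic. The right side is attached to a triangulated
subcategory, which provides the calculus of fractions. -/
lemma Minus.quasiIso_eq_trW : Minus.quasiIso C =
    ((HomotopyCategory.subcategoryAcyclic C).inverseImage (HomotopyCategory.minus C).ι).trW := by
  ext K L f
  obtain ⟨M, g, h, mem⟩ := distinguished_cocone_triangle f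
  have := (HomotopyCategory.subcategoryAcyclic C).trW_iff_of_distinguished _
    ((HomotopyCategory.minus C).ι.map_distinguished _ mem)
  rw [← HomotopyCategory.quasiIso_eq_trW_subcategoryAcyclic] at this
  exact this.trans (((HomotopyCategory.subcategoryAcyclic C).inverseImage
    (HomotopyCategory.minus C).ι).trW_iff_of_distinguished _ mem).symm

instance : (Minus.quasiIso C).HasRightCalculusOfFractions := by
  rw [Minus.quasiIso_eq_trW]
  infer_instance

end DerivedCategory

namespace CategoryTheory

variable {C D : Type*} [Category* C] [Abelian C] [HasDerivedCategory C]
  [Category* D] [Abelian D] [HasDerivedCategory D]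

/-- The bounded above complexes whose terms have a given property. -/
def ObjectProperty.termwiseMinus (S : ObjectProperty C) :
    ObjectProperty (HomotopyCategory.Minus C) :=
  fun K => ∀ i, S ((K.obj.as : CochainComplex C ℤ).X i)

/-- The complex as an object of the homotopy category of bounded above complexes. -/
abbrev _root_.HomotopyCategory.Minus.of (K : CochainComplex C ℤ) (N : ℤ) [h : K.IsStrictlyLE N] :
    HomotopyCategory.Minus C :=
  ⟨(HomotopyCategory.quotient _ _).obj K, N, h⟩

omit [HasDerivedCategory C] in
lemma ObjectProperty.IsAdaptedTo.isLeftAdapted {S : ObjectProperty C} {F : C ⥤ D} [F.Additive]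
    (hS : S.IsAdaptedTo F) : (F.mapHomotopyCategoryMinus ⋙ DerivedCategory.Minus.Qh).IsLeftAdapted
      (DerivedCategory.Minus.quasiIso C) S.termwiseMinus where
  exists_resolution := by
    rintro ⟨K, n, hn⟩
    have : CochainComplex.IsStrictlyLE (K.as : CochainComplex C ℤ) n := hn
    obtain ⟨P, f, hf, hP, hPS⟩ := ObjectProperty.exists_resolution_of_isStrictlyLE hS.exists_epi
      (fun _ h => hS.of_isZero h) (fun e h => hS.of_iso e h) (K.as : CochainComplex C ℤ) n
    refine ⟨HomotopyCategory.Minus.of P n, hPS,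
      ObjectProperty.homMk ((HomotopyCategory.quotient _ _).map f), ?_⟩
    exact (HomotopyCategory.quotient_map_mem_quasiIso_iff f).2 hf
  isIso_map := by
    rintro ⟨K, a, ha⟩ ⟨L, b, hb⟩ w hK hL hw
    obtain ⟨f, hf⟩ := (HomotopyCategory.quotient C (ComplexShape.up ℤ)).map_surjective w.hom
    have hw' : HomotopyCategory.quasiIso C (.up ℤ) w.hom := hw
    rw [← hf] at hw'
    have : QuasiIso f := (HomotopyCategory.quotient_map_mem_quasiIso_iff f).1 hw'
    have : CochainComplex.IsStrictlyLE (K.as : CochainComplex C ℤ) a := ha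
    have : CochainComplex.IsStrictlyLE (L.as : CochainComplex C ℤ) b := hb
    have h := hS.quasiIso_map f a b hK hL
    refine Localization.inverts DerivedCategory.Minus.Qh (DerivedCategory.Minus.quasiIso D) _ ?_
    change HomotopyCategory.quasiIso D (.up ℤ) ((F.mapHomotopyCategory _).map w.hom)
    rw [← hf]
    exact (HomotopyCategory.quotient_map_mem_quasiIso_iff _).2 h

omit [HasDerivedCategory C] in
lemma ObjectProperty.IsAdaptedTo.hasLeftDerivedFunctorMinus {S : ObjectProperty C} {F : C ⥤ D}
    [F.Additive] (hS : S.IsAdaptedTo F) : F.HasLeftDerivedFunctorMinus :=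
  have := hS.isLeftAdapted.hasPointwiseLeftDerivedFunctor
  Functor.hasLeftDerivedFunctor_of_hasPointwiseLeftDerivedFunctor _ _

/-- The natural transformation from the total left derived functor. -/
abbrev Functor.leftDerivedFunctorMinusCounit (F : C ⥤ D) [F.Additive]
    [F.HasLeftDerivedFunctorMinus] :
    DerivedCategory.Minus.Qh ⋙ F.leftDerivedFunctorMinus ⟶
      F.mapHomotopyCategoryMinus ⋙ DerivedCategory.Minus.Qh :=
  (F.mapHomotopyCategoryMinus ⋙ DerivedCategory.Minus.Qh).totalLeftDerivedCounit
    DerivedCategory.Minus.Qh (DerivedCategory.Minus.quasiIso C)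

lemma ObjectProperty.IsAdaptedTo.isIso_counit_app {S : ObjectProperty C} {F : C ⥤ D}
    [F.Additive] (hS : S.IsAdaptedTo F) [F.HasLeftDerivedFunctorMinus]
    {P : HomotopyCategory.Minus C} (hP : S.termwiseMinus P) :
    IsIso (F.leftDerivedFunctorMinusCounit.app P) :=
  hS.isLeftAdapted.isIso_app (L := DerivedCategory.Minus.Qh) (LF := (F.mapHomotopyCategoryMinus ⋙
    DerivedCategory.Minus.Qh).totalLeftDerived DerivedCategory.Minus.Qh
      (DerivedCategory.Minus.quasiIso C)) _ hP

end CategoryTheory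

/-! ### Torsion pairs and tilting -/

namespace CategoryTheory

/-- Torsion pairs in an abelian category. -/
structure IsTorsionPair {C : Type*} [Category* C] [Abelian C] (T F : ObjectProperty C) : Prop where
  of_iso_left {X Y : C} (e : X ≅ Y) (hX : T X) : T Y
  of_iso_right {X Y : C} (e : X ≅ Y) (hX : F X) : F Y
  of_isZero_left {X : C} (hX : IsZero X) : T X
  of_isZero_right {X : C} (hX : IsZero X) : F X
  eq_zero {X Y : C} (f : X ⟶ Y) (hX : T X) (hY : F Y) : f = 0
  exists_shortExact (X : C) : ∃ (A B : C) (i : A ⟶ X) (p : X ⟶ B) (w : i ≫ p = 0),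
    T A ∧ F B ∧ (ShortComplex.mk i p w).ShortExact

end CategoryTheory

namespace DerivedCategory

variable {C : Type*} [Category* C] [Abelian C] [HasDerivedCategory C]

section

variable {T : Triangle (DerivedCategory C)} (hT : T ∈ distTriang _)
include hT

lemma isZero_homology₂ (n : ℤ) (h₁ : IsZero ((homologyFunctor C n).obj T.obj₁))
    (h₃ : IsZero ((homologyFunctor C n).obj T.obj₃)) :
    IsZero ((homologyFunctor C n).obj T.obj₂) :=
  (HomologySequence.exact₂ T hT n).isZero_of_both_zeros (h₁.eq_of_src _ _) (h₃.eq_of_tgt _ _)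

lemma isZero_homology₃ (n₀ n₁ : ℤ) (h : n₀ + 1 = n₁)
    (h₁ : IsZero ((homologyFunctor C n₁).obj T.obj₁))
    (h₂ : IsZero ((homologyFunctor C n₀).obj T.obj₂)) :
    IsZero ((homologyFunctor C n₀).obj T.obj₃) :=
  (HomologySequence.exact₃ T hT n₀ n₁ h).isZero_of_both_zeros (h₂.eq_of_src _ _) (h₁.eq_of_tgt _ _)

lemma isZero_homology₁ (n₀ n₁ : ℤ) (h : n₀ + 1 = n₁)
    (h₂ : IsZero ((homologyFunctor C n₁).obj T.obj₂))
    (h₃ : IsZero ((homologyFunctor C n₀).obj T.obj₃)) :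
    IsZero ((homologyFunctor C n₁).obj T.obj₁) :=
  (HomologySequence.exact₁ T hT n₀ n₁ h).isZero_of_both_zeros (h₃.eq_of_src _ _) (h₂.eq_of_tgt _ _)

lemma mono_homologyMap₁ (n₀ n₁ : ℤ) (h : n₀ + 1 = n₁)
    (h₃ : IsZero ((homologyFunctor C n₀).obj T.obj₃)) :
    Mono ((homologyFunctor C n₁).map T.mor₁) :=
  (HomologySequence.mono_homologyMap_mor₁_iff T hT n₀ n₁ h).2 (h₃.eq_of_src _ _)

lemma epi_homologyMap₁ (n : ℤ) (h₃ : IsZero ((homologyFunctor C n).obj T.obj₃)) :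
    Epi ((homologyFunctor C n).map T.mor₁) :=
  (HomologySequence.epi_homologyMap_mor₁_iff T hT n).2 (h₃.eq_of_tgt _ _)

lemma mono_homologyMap₂ (n : ℤ) (h₁ : IsZero ((homologyFunctor C n).obj T.obj₁)) :
    Mono ((homologyFunctor C n).map T.mor₂) :=
  (HomologySequence.mono_homologyMap_mor₂_iff T hT n).2 (h₁.eq_of_src _ _)

lemma epi_homologyMap₂ (n₀ n₁ : ℤ) (h : n₀ + 1 = n₁)
    (h₁ : IsZero ((homologyFunctor C n₁).obj T.obj₁)) :
    Epi ((homologyFunctor C n₀).map T.mor₂) :=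
  (HomologySequence.epi_homologyMap_mor₂_iff T hT n₀ n₁ h).2 (h₁.eq_of_tgt _ _)

end

/-- Both objects are isomorphic to single objects in degree `0`. Between these every morphism comes
from `C`, and homology recovers it. -/
lemma eq_zero_of_homologyMap_eq_zero_of_heart {X Y : DerivedCategory C} [X.IsLE 0] [X.IsGE 0]
    [Y.IsLE 0] [Y.IsGE 0] (f : X ⟶ Y) (hf : (homologyFunctor C 0).map f = 0) : f = 0 := by
  obtain ⟨A, ⟨a⟩⟩ := exists_iso_singleFunctor_obj_of_isGE_of_isLE X 0
  obtain ⟨B, ⟨b⟩⟩ := exists_iso_singleFunctor_obj_of_isGE_of_isLE Y 0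
  obtain ⟨h, hh⟩ := (singleFunctor C 0).map_surjective (a.inv ≫ f ≫ b.hom)
  have h0 : h = 0 := by
    have e := NatIso.naturality_1 (singleFunctorCompHomologyFunctorIso C 0) h
    have e' : (homologyFunctor C 0).map ((singleFunctor C 0).map h) = 0 := by
      rw [hh, Functor.map_comp, Functor.map_comp, hf, zero_comp, comp_zero]
    rw [Functor.comp_map, e', zero_comp, comp_zero] at e
    exact e.symm
  rw [← cancel_epi a.inv, ← cancel_mono b.hom, Category.assoc, ← hh, h0]
  simp

/-- A morphism from a nonpositive object to a nonnegative object is determined by its effect on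
homology in degree zero. -/
lemma eq_zero_of_homologyMap_eq_zero {X Y : DerivedCategory C} [X.IsLE 0] [Y.IsGE 0] (f : X ⟶ Y)
    (hf : (homologyFunctor C 0).map f = 0) : f = 0 := by
  obtain ⟨X', X'', hX', hX'', i, p, δ, hT⟩ := TStructure.t.exists_triangle X (-1) 0 rfl
  have hX' : X'.IsLE (-1) := ⟨hX'⟩
  have hX'' : X''.IsGE 0 := ⟨hX''⟩
  have hX₀ : X''.IsLE 0 := (isLE_iff _ _).2 fun i hi =>
    isZero_homology₃ hT i _ rfl (isZero_of_isLE X' (-1) _ (by lia)) (isZero_of_isLE X 0 _ hi)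
  have : Epi ((homologyFunctor C 0).map p) :=
    epi_homologyMap₂ hT 0 1 rfl (isZero_of_isLE X' (-1) _ (by lia))
  -- `f` factors through `X ⟶ τ^{≥0} X` and then through `τ^{≤0} Y ⟶ Y`. In degree `0` these induce
  -- an epimorphism and a monomorphism on homology, so the vanishing passes to a morphism between
  -- objects of the standard heart.
  obtain ⟨g, rfl⟩ : ∃ g : X'' ⟶ Y, f = p ≫ g := Triangle.yoneda_exact₂ _ hT f
    (TStructure.t.zero_of_isLE_of_isGE _ (-1) 0 (by lia) hX' inferInstance)
  have hg : (homologyFunctor C 0).map g = 0 := by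
    rw [Functor.map_comp] at hf
    rwa [← cancel_epi ((homologyFunctor C 0).map p), comp_zero]
  obtain ⟨Y', Y'', hY', hY'', j, q, δ', hT'⟩ := TStructure.t.exists_triangle Y 0 1 rfl
  have hY' : Y'.IsLE 0 := ⟨hY'⟩
  have hY'' : Y''.IsGE 1 := ⟨hY''⟩
  have hY₀ : Y'.IsGE 0 := (isGE_iff _ _).2 fun i hi =>
    isZero_homology₁ hT' (i - 1) _ (by lia) (isZero_of_isGE Y 0 _ hi)
      (isZero_of_isGE Y'' 1 _ (by lia))
  have : Mono ((homologyFunctor C 0).map j) :=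
    mono_homologyMap₁ hT' (-1) 0 rfl (isZero_of_isGE Y'' 1 _ (by lia))
  obtain ⟨g', rfl⟩ : ∃ g' : X'' ⟶ Y', g = g' ≫ j := Triangle.coyoneda_exact₂ _ hT' g
    (TStructure.t.zero_of_isLE_of_isGE _ 0 1 (by lia) hX₀ hY'')
  have hg' : (homologyFunctor C 0).map g' = 0 := by
    rw [Functor.map_comp] at hg
    rwa [← cancel_mono ((homologyFunctor C 0).map j), zero_comp]
  rw [eq_zero_of_homologyMap_eq_zero_of_heart g' hg', zero_comp, comp_zero]

/-- The aisle of the t-structure obtained by tilting. -/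
def tiltLE (T : ObjectProperty C) (n : ℤ) : ObjectProperty (DerivedCategory C) := fun E =>
  T ((homologyFunctor C n).obj E) ∧ ∀ i : ℤ, n < i → IsZero ((homologyFunctor C i).obj E)

/-- The coaisle of the t-structure obtained by tilting. -/
def tiltGE (F : ObjectProperty C) (n : ℤ) : ObjectProperty (DerivedCategory C) := fun E =>
  F ((homologyFunctor C (n - 1)).obj E) ∧
    ∀ i : ℤ, i < n - 1 → IsZero ((homologyFunctor C i).obj E)

variable {T F : ObjectProperty C}

/-- With `A ⟶ H^0(E) ⟶ B` the torsion sequence, `X` is the fibre of the composite `τ^{≤0} E ⟶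
H^0(E)[0] ⟶ B[0]`, so it has the cohomology of `E` below degree `0` and `A` in degree `0`. The
remaining piece `Y` is the cone of `X ⟶ E`. -/
lemma exists_tilt_triangle (h : IsTorsionPair T F) (E : DerivedCategory C) :
    ∃ (X Y : DerivedCategory C) (_ : tiltLE T 0 X) (_ : tiltGE F 1 Y) (f : X ⟶ E) (g : E ⟶ Y)
      (δ : Y ⟶ X⟦(1 : ℤ)⟧), Triangle.mk f g δ ∈ distTriang _ := by
  obtain ⟨L, G, hL, hG, u₂₃, v₂₃, w₂₃, h₂₃⟩ := TStructure.t.exists_triangle E 0 1 rfl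
  have hL : L.IsLE 0 := ⟨hL⟩
  have hG : G.IsGE 1 := ⟨hG⟩
  obtain ⟨L', L'', hL', hL'', i, p, δ, hT⟩ := TStructure.t.exists_triangle L (-1) 0 rfl
  have hL' : L'.IsLE (-1) := ⟨hL'⟩
  have hL'' : L''.IsGE 0 := ⟨hL''⟩
  have hL₀ : L''.IsLE 0 := (isLE_iff _ _).2 fun i hi =>
    isZero_homology₃ hT i _ rfl (isZero_of_isLE L' (-1) _ (by lia)) (isZero_of_isLE L 0 _ hi)
  have : Epi ((homologyFunctor C 0).map p) :=
    epi_homologyMap₂ hT 0 1 rfl (isZero_of_isLE L' (-1) _ (by lia))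
  have : Mono ((homologyFunctor C 0).map p) :=
    mono_homologyMap₂ hT 0 (isZero_of_isLE L' (-1) _ (by lia))
  have := isIso_of_mono_of_epi ((homologyFunctor C 0).map p)
  obtain ⟨M, ⟨e⟩⟩ := exists_iso_singleFunctor_obj_of_isGE_of_isLE L'' 0
  obtain ⟨A, B, a, b, w, hA, hB, hS⟩ := h.exists_shortExact M
  let q : L ⟶ (singleFunctor C 0).obj B := p ≫ e.hom ≫ (singleFunctor C 0).map b
  obtain ⟨X, u₁₂, w₁₂, h₁₂⟩ := distinguished_cocone_triangle₁ q
  obtain ⟨Y, v₁₃, w₁₃, h₁₃⟩ := distinguished_cocone_triangle (u₁₂ ≫ u₂₃)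
  -- The octahedron gives a triangle `B[0] ⟶ Y ⟶ τ^{≥1} E`, from which the cohomology of `Y` is read
  -- off.
  let oct := someOctahedron rfl h₁₂ h₂₃ h₁₃
  let κ := singleFunctorCompHomologyFunctorIso C 0
  let ε : (homologyFunctor C 0).obj L ≅ M := asIso ((homologyFunctor C 0).map p) ≪≫
    (homologyFunctor C 0).mapIso e ≪≫ κ.app M
  have hq : (homologyFunctor C 0).map q ≫ (κ.app B).hom = ε.hom ≫ b := by
    have := κ.hom.naturality b
    simp only [Functor.comp_map, Functor.id_map] at this
    simp [q, ε, this]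
  have hB0 : IsZero ((homologyFunctor C (-1)).obj ((singleFunctor C 0).obj B)) :=
    isZero_of_isGE _ 0 _ (by lia)
  have hX0 : T ((homologyFunctor C 0).obj X) := by
    have hm : Mono ((homologyFunctor C 0).map u₁₂) := mono_homologyMap₁ h₁₂ (-1) 0 rfl hB0
    have hex := HomologySequence.exact₂ _ h₁₂ 0
    let S := ShortComplex.mk ((homologyFunctor C 0).map u₁₂ ≫ ε.hom) b (by
      rw [Category.assoc, ← hq, ← Functor.map_comp_assoc, show u₁₂ ≫ q = 0 from
        comp_distTriang_mor_zero₁₂ _ h₁₂, Functor.map_zero, zero_comp])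
    let S₀ := ShortComplex.mk ((homologyFunctor C 0).map u₁₂) ((homologyFunctor C 0).map q) (by
      rw [← Functor.map_comp, show u₁₂ ≫ q = 0 from comp_distTriang_mor_zero₁₂ _ h₁₂,
        Functor.map_zero])
    let eS : S₀ ≅ S := ShortComplex.isoMk (Iso.refl _) ε (κ.app B) (by simp [S, S₀]) hq.symm
    have hS' : S.Exact := ShortComplex.exact_of_iso eS hex
    have : Mono S.f := mono_comp ((homologyFunctor C 0).map u₁₂) ε.hom
    have := hS.mono_f
    exact h.of_iso_left (IsLimit.conePointUniqueUpToIso hS.exact.fIsKernel hS'.fIsKernel) hA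
  -- Surjectivity of `H^0(q)` is what forces `H^1(X) = 0`.
  have hq1 : Epi ((homologyFunctor C 0).map q) := by
    have := hS.epi_g
    have : (homologyFunctor C 0).map q = ε.hom ≫ b ≫ (κ.app B).inv := by
      rw [← Category.assoc, ← hq]; simp
    rw [this]
    have : Epi b := hS.epi_g
    infer_instance
  refine ⟨X, Y, ⟨hX0, fun i hi => ?_⟩, ⟨?_, fun i hi => ?_⟩, _, _, _, h₁₃⟩
  · by_cases hi1 : i = 1
    · subst hi1
      refine (HomologySequence.exact₁ _ h₁₂ 0 1 rfl).isZero_of_both_zeros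
        ((HomologySequence.epi_homologyMap_mor₂_iff _ h₁₂ 0 1 rfl).1 hq1)
        ((isZero_of_isLE L 0 1 (by lia)).eq_of_tgt _ _)
    · exact isZero_homology₁ h₁₂ (i - 1) i (by lia) (isZero_of_isLE L 0 i hi)
        (isZero_of_isLE ((singleFunctor C 0).obj B) 0 _ (by lia))
  · have hm : Mono ((homologyFunctor C 0).map oct.m₁) :=
      mono_homologyMap₁ oct.mem (-1) 0 rfl (isZero_of_isGE G 1 _ (by lia))
    have he : Epi ((homologyFunctor C 0).map oct.m₁) :=
      epi_homologyMap₁ oct.mem 0 (isZero_of_isGE G 1 _ (by lia))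
    have := isIso_of_mono_of_epi ((homologyFunctor C 0).map oct.m₁)
    exact h.of_iso_right ((κ.app B).symm ≪≫ asIso ((homologyFunctor C 0).map oct.m₁)) hB
  · exact isZero_homology₂ oct.mem i (isZero_of_isGE ((singleFunctor C 0).obj B) 0 _ (by lia))
      (isZero_of_isGE G 1 _ (by lia))

/-- The t-structure obtained by tilting the canonical t-structure with respect to a torsion
pair. -/
def tilt (h : IsTorsionPair T F) : TStructure (DerivedCategory C) where
  le := tiltLE T
  ge := tiltGE F
  le_isClosedUnderIsomorphisms n := ⟨fun e hX => ⟨h.of_iso_left ((homologyFunctor C n).mapIso e) hX.1,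
    fun i hi => (hX.2 i hi).of_iso ((homologyFunctor C i).mapIso e.symm)⟩⟩
  ge_isClosedUnderIsomorphisms n := ⟨fun e hX => ⟨h.of_iso_right ((homologyFunctor C _).mapIso e) hX.1,
    fun i hi => (hX.2 i hi).of_iso ((homologyFunctor C i).mapIso e.symm)⟩⟩
  le_shift n a n' hn X hX :=
    ⟨h.of_iso_left (((homologyFunctor C 0).shiftIso a n' n hn).symm.app X) hX.1,
      fun i hi => (hX.2 (a + i) (by lia)).of_iso
        (((homologyFunctor C 0).shiftIso a i (a + i) rfl).app X)⟩
  ge_shift n a n' hn X hX :=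
    ⟨h.of_iso_right (((homologyFunctor C 0).shiftIso a (n' - 1) (n - 1) (by lia)).symm.app X) hX.1,
      fun i hi => (hX.2 (a + i) (by lia)).of_iso
        (((homologyFunctor C 0).shiftIso a i (a + i) rfl).app X)⟩
  -- Here `Y` lies in the coaisle of index `1`: its cohomology vanishes in negative degrees and
  -- `H^0(Y)` is torsion-free. So `f` is detected on `H^0`, where it goes from a torsion object to a
  -- torsion-free one.
  zero' X Y f hX hY := by
    have : X.IsLE 0 := (isLE_iff _ _).2 hX.2
    have : Y.IsGE 0 := (isGE_iff _ _).2 hY.2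
    exact eq_zero_of_homologyMap_eq_zero f (h.eq_zero _ hX.1 hY.1)
  le_zero_le X hX := ⟨h.of_isZero_left (hX.2 1 (by lia)), fun i hi => hX.2 i (by lia)⟩
  ge_one_le X hX := ⟨h.of_isZero_right (hX.2 _ (by lia)), fun i hi => hX.2 i (by lia)⟩
  exists_triangle_zero_one := exists_tilt_triangle h

end DerivedCategory

/-! ### Serre classes of noetherian objects as torsion classes -/

namespace CategoryTheory

open HomologicalComplex

section TorsionPair

variable {C : Type*} [Category* C] [Abelian C]

/-- Serre classes: properties of objects that are closed under subobjects, quotients and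
extensions. -/
structure IsSerre (T : ObjectProperty C) : Prop where
  of_isZero {X : C} (hX : IsZero X) : T X
  of_mono {X Y : C} (f : X ⟶ Y) [Mono f] (hY : T Y) : T X
  of_epi {X Y : C} (f : X ⟶ Y) [Epi f] (hX : T X) : T Y
  of_shortExact {S : ShortComplex C} (hS : S.ShortExact) (h₁ : T S.X₁) (h₃ : T S.X₃) : T S.X₂

/-- In a category of noetherian objects, a Serre class is the torsion class of a torsion pair. -/
lemma IsSerre.isTorsionPair {T : ObjectProperty C} (h : IsSerre T)
    (hC : ∀ X : C, IsNoetherianObject X) :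
    IsTorsionPair T (fun E => ∀ X, T X → ∀ f : X ⟶ E, f = 0) where
  of_iso_left e hX := h.of_mono e.inv hX
  of_iso_right e hX Y hY f := by
    rw [← cancel_mono e.inv, zero_comp]
    exact hX Y hY _
  of_isZero_left := h.of_isZero
  of_isZero_right hX Y hY f := hX.eq_of_tgt _ _
  eq_zero f hX hY := hY _ hX f
  exists_shortExact X := by
    have : WellFoundedGT (Subobject X) := inferInstance
    -- The torsion part of `X` is a maximal subobject in the class; one exists because `X` is
    -- noetherian.
    obtain ⟨A, hA, hmax⟩ := this.wf.has_min {A : Subobject X | T (A : C)}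
      ⟨⊥, h.of_isZero ((isZero_zero C).of_iso Subobject.botCoeIsoZero)⟩
    refine ⟨A, cokernel A.arrow, A.arrow, cokernel.π _, cokernel.condition _, hA, ?_,
      { exact := ShortComplex.exact_cokernel A.arrow
        mono_f := inferInstanceAs (Mono A.arrow)
        epi_g := inferInstanceAs (Epi (cokernel.π A.arrow)) }⟩
    intro Y hY f
    let q : Y ⟶ Abelian.image f := Abelian.factorThruImage f
    let I := Abelian.image.ι f
    -- The preimage in `X` of the image of `f` is an extension of that image by `A`, hence in the
    -- class. Maximality forces it to equal `A`, so the image is zero.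
    let A' := pullback (cokernel.π A.arrow) I
    let i : (A : C) ⟶ A' := pullback.lift A.arrow 0 (by simp)
    let S := ShortComplex.mk i (pullback.snd (cokernel.π A.arrow) I) (pullback.lift_snd _ _ _)
    have hi : i ≫ pullback.fst _ _ = A.arrow := pullback.lift_fst _ _ _
    have hS : S.ShortExact :=
      { exact := (ShortComplex.exact_mk_iff _ _ _).2 fun B x hx => by
          have hx' : (x ≫ pullback.fst (cokernel.π A.arrow) I) ≫ cokernel.π A.arrow = 0 := by
            rw [Category.assoc, pullback.condition, reassoc_of% hx, zero_comp]
          obtain ⟨B', π, hπ, y, hy⟩ := (ShortComplex.exact_mk_iff _ _ _).1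
            (ShortComplex.exact_cokernel A.arrow) _ _ hx'
          refine ⟨B', π, hπ, y, ?_⟩
          apply pullback.hom_ext
          · rw [Category.assoc, Category.assoc, hi, hy]
          · rw [Category.assoc, hx, comp_zero, Category.assoc, pullback.lift_snd, comp_zero]
        mono_f := mono_of_mono_fac hi
        epi_g := inferInstanceAs (Epi (pullback.snd (cokernel.π A.arrow) I)) }
    have hA' : T A' := h.of_shortExact hS hA (h.of_epi q hY)
    have hm : Mono (pullback.fst (cokernel.π A.arrow) I) := inferInstance
    have hle : A ≤ Subobject.mk (pullback.fst (cokernel.π A.arrow) I) :=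
      Subobject.le_mk_of_comm i hi
    have heq : A = Subobject.mk (pullback.fst (cokernel.π A.arrow) I) := by
      by_contra hne
      exact hmax _ (h.of_mono (Subobject.underlyingIso _).hom hA') (lt_of_le_of_ne hle hne)
    have h1 : pullback.snd (cokernel.π A.arrow) I ≫ I = 0 := by
      rw [← pullback.condition]
      have : pullback.fst (cokernel.π A.arrow) I =
          Subobject.ofMkLE _ A heq.ge ≫ A.arrow := by simp
      rw [this, Category.assoc, cokernel.condition, comp_zero]
    have h2 : I = 0 := by
      rw [← cancel_epi (pullback.snd (cokernel.π A.arrow) I), h1, comp_zero]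
    rw [← Abelian.image.fac f]
    change _ ≫ I = 0
    rw [h2, comp_zero]

end TorsionPair

/-! ### The kernel estimate in degree `-2` -/

section

variable {C D : Type*} [Category* C] [Abelian C] [Category* D] [Abelian D]

/-- The homology of the image of a complex under a right exact functor embeds in the kernel of
the morphism induced by the differential on opcycles. -/
lemma exists_mono_homology_map (F : C ⥤ D) [F.Additive] [PreservesFiniteColimits F]
    (N : CochainComplex C ℤ) (i : ℤ) :
    ∃ θ : ((F.mapHomologicalComplex (ComplexShape.up ℤ)).obj N).homology i ⟶ F.obj (N.opcycles i),
      Mono θ ∧ θ ≫ F.map (N.fromOpcycles i (i + 1)) = 0 := by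
  let FN := (F.mapHomologicalComplex (ComplexShape.up ℤ)).obj N
  have w : N.d (i - 1) i ≫ N.pOpcycles i = 0 := N.d_pOpcycles _ _
  -- Opcycles are a cokernel, so the right exact functor `F` commutes with them.
  let hc : IsColimit (CokernelCofork.ofπ (N.pOpcycles i) w) :=
    N.opcyclesIsCokernel (i - 1) i (by simp)
  let hc' := CokernelCofork.mapIsColimit _ hc F
  have wF : FN.d (i - 1) i ≫ FN.pOpcycles i = 0 := FN.d_pOpcycles _ _
  let hF : IsColimit (CokernelCofork.ofπ (FN.pOpcycles i) wF) :=
    FN.opcyclesIsCokernel (i - 1) i (by simp)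
  let e : FN.opcycles i ≅ F.obj (N.opcycles i) := IsColimit.coconePointUniqueUpToIso hF hc'
  let q : F.obj (N.X i) ⟶ FN.opcycles i := FN.pOpcycles i
  have he : q ≫ e.hom = F.map (N.pOpcycles i) :=
    IsColimit.comp_coconePointUniqueUpToIso_hom hF hc' .one
  refine ⟨FN.homologyι i ≫ e.hom, inferInstance, ?_⟩
  have h' : q ≫ e.hom ≫ F.map (N.fromOpcycles i (i + 1)) = F.map (N.d i (i + 1)) := by
    rw [reassoc_of% he, ← F.map_comp, p_fromOpcycles]
  have h : e.hom ≫ F.map (N.fromOpcycles i (i + 1)) = FN.fromOpcycles i (i + 1) :=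
    (cancel_epi (FN.pOpcycles i)).1 (h'.trans (FN.p_fromOpcycles i (i + 1)).symm)
  rw [Category.assoc, h]
  exact FN.homologyι_comp_fromOpcycles i (i + 1)

lemma mono_fromOpcycles {N : CochainComplex C ℤ} {i : ℤ} (hN : N.ExactAt i) :
    Mono (N.fromOpcycles i (i + 1)) := by
  rw [Preadditive.mono_iff_cancel_zero]
  intro A x hx
  obtain ⟨A₁, π₁, hπ₁, y, hy⟩ := surjective_up_to_refinements_of_epi (N.pOpcycles i) x
  have h1 : y ≫ N.d i (i + 1) = 0 := by
    rw [← N.p_fromOpcycles, ← reassoc_of% hy, hx, comp_zero]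
  obtain ⟨A₂, π₂, hπ₂, z, hz⟩ := (ShortComplex.exact_mk_iff _ _ _).1
    ((N.exactAt_iff' (i - 1) i (i + 1) (by simp) (by simp)).1 hN) _ y h1
  change π₂ ≫ y = z ≫ N.d (i - 1) i at hz
  rw [← cancel_epi (π₂ ≫ π₁), Category.assoc, hy, reassoc_of% hz, N.d_pOpcycles, comp_zero,
    comp_zero]

lemma epi_fromOpcycles {N : CochainComplex C ℤ} {i : ℤ} (hN : N.ExactAt (i + 1))
    (h : IsZero (N.X (i + 1 + 1))) : Epi (N.fromOpcycles i (i + 1)) := by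
  rw [epi_iff_surjective_up_to_refinements]
  intro A y
  obtain ⟨A', π, hπ, x, hx⟩ := (ShortComplex.exact_mk_iff _ _ _).1
    ((N.exactAt_iff' i (i + 1) (i + 1 + 1) (by simp) (by simp)).1 hN) _ y (h.eq_of_tgt _ _)
  change π ≫ y = x ≫ N.d i (i + 1) at hx
  refine ⟨A', π, hπ, x ≫ N.pOpcycles i, ?_⟩
  rw [hx, Category.assoc, p_fromOpcycles]

/-- At the top end of an acyclic bounded above complex, the map from opcycles to the next term is an
isomorphism. `F` preserves this, and the homology of the image embeds in the kernel of the resulting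
map. -/
lemma isZero_homology_map_of_acyclic (F : C ⥤ D) [F.Additive] [PreservesFiniteColimits F]
    {N : CochainComplex C ℤ} (hN : N.Acyclic) (n : ℤ) [N.IsStrictlyLE n] (i : ℤ) (hi : n ≤ i + 1) :
    IsZero (((F.mapHomologicalComplex (ComplexShape.up ℤ)).obj N).homology i) := by
  obtain ⟨θ, hθ, h⟩ := exists_mono_homology_map F N i
  have := mono_fromOpcycles (hN i)
  have := epi_fromOpcycles (hN (i + 1)) (N.isZero_of_isStrictlyLE n _ (by lia))
  have := isIso_of_mono_of_epi (N.fromOpcycles i (i + 1))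
  have : θ = 0 := by
    rw [← cancel_mono (F.map (N.fromOpcycles i (i + 1))), h, zero_comp]
  rw [this] at hθ
  exact IsZero.of_mono_eq_zero (0 : _ ⟶ F.obj (N.opcycles i)) rfl

/-- The kernel estimate behind the comparison of a two term complex with the derived inverse image
of its direct image. -/
lemma prop_of_mono_of_comp_eq_zero (F : C ⥤ D) [F.Additive] [PreservesFiniteColimits F]
    (G : D ⥤ C) [G.Additive] [PreservesFiniteLimits G] [PreservesFiniteColimits G]
    (hFG : ∀ {X Y : D} (f : X ⟶ Y) [Mono f], Mono (F.map (G.map f)))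
    {T : ObjectProperty D} (hT : ∀ {X Y : D} (f : X ⟶ Y) [Mono f], T Y → T X) {S : ObjectProperty C}
    (htor : ∀ (P : C) (_ : S P) (Q : D) (_ : T Q) (r : P ⟶ G.obj Q) [Epi r],
      T (Limits.kernel (F.map (kernel.ι r))))
    {K₁ K₀ : D} (d : K₁ ⟶ K₀) (hd : T (cokernel d)) {P : C} (hP : S P) (w : P ⟶ G.obj K₀)
    {Z : C} (j : Z ⟶ P ⊞ G.obj K₁) [Mono j] (hj : j ≫ biprod.desc w (G.map d) = 0)
    (hex : (ShortComplex.mk j _ hj).Exact) [Epi (biprod.desc w (G.map d))]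
    {H : D} (θ : H ⟶ F.obj Z) [Mono θ] (hθ : θ ≫ F.map j = 0) : T H := by
  let q := G.map (cokernel.π d)
  have hq : G.map d ≫ q = 0 := by rw [← G.map_comp, cokernel.condition, G.map_zero]
  -- Modulo the image of `G d`, the element `w` alone must already hit everything. So `Z` is
  -- compared with the kernel of this epimorphism from `P`.
  let r : P ⟶ G.obj (cokernel d) := w ≫ q
  have hr : Epi r := by
    refine Preadditive.epi_of_cancel_zero _ fun g hg => ?_
    rw [← cancel_epi q, ← cancel_epi (biprod.desc w (G.map d)), comp_zero, comp_zero]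
    apply biprod.hom_ext'
    · simpa [r] using hg
    · rw [biprod.inr_desc_assoc, reassoc_of% hq, zero_comp, comp_zero]
  have hj' : (j ≫ biprod.fst) ≫ w = - ((j ≫ biprod.snd) ≫ G.map d) := by
    rw [eq_neg_iff_add_eq_zero, ← hj, biprod.desc_eq]
    simp
  let ι := kernel.ι r
  let z : Z ⟶ Limits.kernel r := kernel.lift r (j ≫ biprod.fst) (by
    simp only [r]
    rw [← Category.assoc, hj', Preadditive.neg_comp, Category.assoc, hq, comp_zero, neg_zero])
  have hz : z ≫ ι = j ≫ biprod.fst := kernel.lift_ι _ _ _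
  have hex' := (ShortComplex.exact_mk_iff _ _ _).1 hex
  -- An element of `P` killed by `r` has image under `w` in the image of `G d`; the negative of a
  -- preimage supplies the second coordinate of an element of `Z`.
  have hze : Epi z := by
    rw [epi_iff_surjective_up_to_refinements]
    intro A y
    have hS := ((ShortComplex.exact_cokernel d).map G)
    obtain ⟨A₁, π₁, hπ₁, k, hk⟩ := (ShortComplex.exact_mk_iff _ _ _).1 hS _ (y ≫ ι ≫ w) (by
      change (y ≫ ι ≫ w) ≫ q = 0
      rw [Category.assoc, Category.assoc]
      change y ≫ ι ≫ r = 0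
      rw [kernel.condition, comp_zero])
    change π₁ ≫ y ≫ ι ≫ w = k ≫ G.map d at hk
    obtain ⟨A₂, π₂, hπ₂, x, hx⟩ := hex' _ (biprod.lift (π₁ ≫ y ≫ ι) (-k)) (by
      simp [biprod.lift_desc, hk])
    refine ⟨A₂, π₂ ≫ π₁, inferInstance, x, ?_⟩
    rw [← cancel_mono ι, Category.assoc, Category.assoc x z ι, hz, ← reassoc_of% hx,
      biprod.lift_fst]
    simp
  -- The elements of `Z` with zero first coordinate form the kernel of `G d`, that is `G (ker d)`.
  let κ := kernel.ι z
  have hκ : κ ≫ j ≫ biprod.fst = 0 := by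
    rw [← hz, kernel.condition_assoc, zero_comp]
  let m := κ ≫ j ≫ biprod.snd
  have hm : Mono m := by
    refine Preadditive.mono_of_cancel_zero _ fun u hu => ?_
    rw [← cancel_mono κ, ← cancel_mono j, zero_comp, zero_comp]
    apply biprod.hom_ext
    · simp only [Category.assoc, zero_comp]
      rw [hκ, comp_zero]
    · simpa [m] using hu
  have hmd : m ≫ G.map d = 0 := by
    have := κ ≫= hj'
    rw [← Category.assoc κ, hκ, zero_comp, Preadditive.comp_neg, zero_eq_neg] at this
    simpa [m] using this
  have hmex : (ShortComplex.mk m (G.map d) hmd).Exact := by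
    refine (ShortComplex.exact_mk_iff _ _ _).2 fun A x hx => ?_
    obtain ⟨A', π, hπ, y, hy⟩ := hex' _ (biprod.lift 0 x) (by simp [biprod.lift_desc, hx])
    have hyz : y ≫ z = 0 := by
      rw [← cancel_mono ι, Category.assoc, hz, ← reassoc_of% hy, biprod.lift_fst, comp_zero,
        zero_comp]
    refine ⟨A', π, hπ, kernel.lift z y hyz, ?_⟩
    simp only [m, κ]
    rw [kernel.lift_ι_assoc, ← reassoc_of% hy, biprod.lift_snd]
  have hGd : (ShortComplex.mk (G.map (kernel.ι d)) (G.map d)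
      (by rw [← G.map_comp, kernel.condition, G.map_zero])).Exact :=
    (ShortComplex.exact_kernel d).map G
  have : Mono (ShortComplex.mk m (G.map d) hmd).f := hm
  have : Mono (ShortComplex.mk (G.map (kernel.ι d)) (G.map d)
      (by rw [← G.map_comp, kernel.condition, G.map_zero])).f :=
    inferInstanceAs (Mono (G.map (kernel.ι d)))
  let e : Limits.kernel z ≅ G.obj (Limits.kernel d) :=
    IsLimit.conePointUniqueUpToIso hmex.fIsKernel hGd.fIsKernel
  have he : e.hom ≫ G.map (kernel.ι d) = m :=
    IsLimit.conePointUniqueUpToIso_hom_comp hmex.fIsKernel hGd.fIsKernel .zero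
  -- Because `F G` preserves monomorphisms, the part of `F Z` coming from `G (ker d)` still embeds
  -- in `F (G K₁)`.
  have hFm : Mono (F.map m) := by
    have := hFG (kernel.ι d)
    rw [← he, F.map_comp]
    infer_instance
  have hFz : (ShortComplex.mk (F.map κ) (F.map z)
      (by rw [← F.map_comp, kernel.condition, F.map_zero])).Exact := by
    have : Epi (ShortComplex.mk κ z (kernel.condition z)).g := hze
    exact (ShortComplex.exact_kernel z).map_of_epi_of_preservesCokernel F hze inferInstance
  -- What dies under `F z` comes from `F (ker z)`. An element of `H` also dies under `F j`, which is
  -- injective on the image of `F (ker z)`, so nothing of `H` is lost.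
  have hθz : Mono (θ ≫ F.map z) := by
    refine Preadditive.mono_of_cancel_zero _ fun x hx => ?_
    obtain ⟨A', π, hπ, y, hy⟩ := (ShortComplex.exact_mk_iff _ _ _).1 hFz _ (x ≫ θ) (by simpa using hx)
    have hy0 : y = 0 := by
      rw [← cancel_mono (F.map m), zero_comp, F.map_comp, ← reassoc_of% hy, F.map_comp,
        reassoc_of% hθ, zero_comp, comp_zero, comp_zero]
    rw [hy0, zero_comp] at hy
    rw [← cancel_mono θ, ← cancel_epi π, hy, zero_comp, comp_zero]
  have hl : (θ ≫ F.map z) ≫ F.map ι = 0 := by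
    rw [Category.assoc, ← F.map_comp, hz, F.map_comp, reassoc_of% hθ, zero_comp]
  have : Mono (kernel.lift (F.map ι) _ hl) := mono_of_mono_fac (kernel.lift_ι _ _ hl)
  exact hT (kernel.lift (F.map ι) _ hl) (htor P hP _ hd r)

end

end CategoryTheory

namespace CategoryTheory

open HomologicalComplex CochainComplex

variable {C D : Type*} [Category* C] [Abelian C] [Category* D] [Abelian D]

/-- Since `P` and `K` stop in degree `0`, the cone ends in `P^0 ⊕ G K^{-1} ⟶ G K^0`. Exactness
identifies its opcycles in degree `-2` with the kernel of this map, and the cokernel of `K^{-1} ⟶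
K^0` is `H^0(K)`, so the preceding estimate applies. -/
lemma prop_homology_map_mappingCone (F : C ⥤ D) [F.Additive] [PreservesFiniteColimits F]
    (G : D ⥤ C) [G.Additive] [PreservesFiniteLimits G] [PreservesFiniteColimits G]
    (hFG : ∀ {X Y : D} (f : X ⟶ Y) [Mono f], Mono (F.map (G.map f)))
    {T : ObjectProperty D} (hT : ∀ {X Y : D} (f : X ⟶ Y) [Mono f], T Y → T X) {S : ObjectProperty C}
    (htor : ∀ (P : C) (_ : S P) (Q : D) (_ : T Q) (r : P ⟶ G.obj Q) [Epi r],
      T (Limits.kernel (F.map (kernel.ι r))))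
    (K : CochainComplex D ℤ) [K.IsStrictlyLE 0] (hK : T (K.homology 0))
    {P : CochainComplex C ℤ} [P.IsStrictlyLE 0] (hP : ∀ i, S (P.X i))
    (w : P ⟶ (G.mapHomologicalComplex _).obj K) [QuasiIso w] :
    T (((F.mapHomologicalComplex (ComplexShape.up ℤ)).obj (mappingCone w)).homology (-2)) := by
  have hN := (CochainComplex.quasiIso_iff_acyclic_mappingCone w).1 inferInstance
  set N := mappingCone w with hNdef
  obtain ⟨θ, hθ, hθ0⟩ := exists_mono_homology_map F N (-2)
  have hm := mono_fromOpcycles (hN (-2))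
  let a : N.X (-1) ⟶ P.X 0 := (mappingCone.fst w).1.v (-1) 0 rfl
  let b : N.X (-1) ⟶ G.obj (K.X (-1)) := (mappingCone.snd w).v (-1) (-1) rfl
  let a' : P.X 0 ⟶ N.X (-1) := (mappingCone.inl w).v 0 (-1) rfl
  let b' : G.obj (K.X (-1)) ⟶ N.X (-1) := (mappingCone.inr w).f (-1)
  let b₀ : N.X 0 ⟶ G.obj (K.X 0) := (mappingCone.snd w).v 0 0 rfl
  let b₀' : G.obj (K.X 0) ⟶ N.X 0 := (mappingCone.inr w).f 0
  let w₀ : P.X 0 ⟶ G.obj (K.X 0) := w.f 0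
  have hd : N.d (-1) 0 ≫ b₀ = a ≫ w₀ + b ≫ G.map (K.d (-1) 0) :=
    mappingCone.d_snd_v w (-1) 0 rfl
  have ha : a ≫ a' + b ≫ b' = 𝟙 _ := mappingCone.id_X w (-1) 0 rfl
  have h1 : a' ≫ a = 𝟙 _ := mappingCone.inl_v_fst_v w 0 (-1) rfl
  have h2 : a' ≫ b = 0 := mappingCone.inl_v_snd_v w 0 (-1) rfl
  have h3 : b' ≫ a = 0 := mappingCone.inr_f_fst_v w (-1) 0 rfl
  have h4 : b' ≫ b = 𝟙 _ := mappingCone.inr_f_snd_v w (-1)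
  have hP1 : IsZero (P.X 1) := P.isZero_of_isStrictlyLE 0 1 (by lia)
  -- The other summand of the cone in degree `0` is `P^1`, which vanishes.
  have hb₀ : b₀ ≫ b₀' = 𝟙 _ := by
    have : ((mappingCone.fst w).1.v 0 1 rfl ≫ (mappingCone.inl w).v 1 0 rfl : N.X 0 ⟶ N.X 0) +
      b₀ ≫ b₀' = 𝟙 _ := mappingCone.id_X w 0 1 rfl
    rw [hP1.eq_of_tgt ((mappingCone.fst w).1.v 0 1 rfl) 0, zero_comp, zero_add] at this
    exact this
  have hb₀' : b₀' ≫ b₀ = 𝟙 _ := mappingCone.inr_f_snd_v w 0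
  obtain ⟨e, hea⟩ : ∃ e : N.X (-1) ≅ P.X 0 ⊞ G.obj (K.X (-1)), e.hom = biprod.lift a b :=
    ⟨{ hom := biprod.lift a b
       inv := biprod.desc a' b'
       hom_inv_id := by rw [biprod.lift_desc, ha]
       inv_hom_id := by
         apply biprod.hom_ext' <;> apply biprod.hom_ext <;> simp [h1, h2, h3, h4] }, rfl⟩
  have he : e.hom ≫ biprod.desc w₀ (G.map (K.d (-1) 0)) = N.d (-1) 0 ≫ b₀ := by
    simp [hea, hd, biprod.lift_desc]
  have hNd : N.d (-1) 0 = e.hom ≫ biprod.desc w₀ (G.map (K.d (-1) 0)) ≫ b₀' := by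
    rw [reassoc_of% he, hb₀, Category.comp_id]
  let j : N.opcycles (-2) ⟶ N.X (-1) := N.fromOpcycles (-2) (-1)
  have hj : (j ≫ e.hom) ≫ biprod.desc w₀ (G.map (K.d (-1) 0)) = 0 := by
    have hj0 : j ≫ N.d (-1) 0 = 0 := N.fromOpcycles_d (-2) (-1) 0
    rw [Category.assoc, he, reassoc_of% hj0, zero_comp]
  have hjm : Mono j := hm
  have hb₀m : Mono b₀' := mono_of_mono_fac hb₀'
  have hex : (ShortComplex.mk _ _ hj).Exact := by
    refine (ShortComplex.exact_mk_iff _ _ _).2 fun A x hx => ?_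
    obtain ⟨A', π, hπ, y, hy⟩ := (ShortComplex.exact_mk_iff _ _ _).1
      ((N.exactAt_iff' (-2) (-1) 0 (by simp) (by simp)).1 (hN (-1))) _ (x ≫ e.inv) (by
        rw [hNd]
        simp [reassoc_of% hx])
    change π ≫ x ≫ e.inv = y ≫ N.d (-2) (-1) at hy
    refine ⟨A', π, hπ, y ≫ N.pOpcycles (-2), ?_⟩
    have := e.isIso_inv
    rw [← cancel_mono e.inv, Category.assoc, hy, ← N.p_fromOpcycles]
    simp [j]
  have hdesc : Epi (biprod.desc w₀ (G.map (K.d (-1) 0))) := by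
    have hN1 : IsZero (N.X 1) := by
      rw [mappingCone.isZero_X_iff]
      exact ⟨P.isZero_of_isStrictlyLE 0 _ (by lia),
        G.map_isZero (K.isZero_of_isStrictlyLE 0 1 (by lia))⟩
    have hdepi : Epi (N.d (-1) 0) := by
      rw [epi_iff_surjective_up_to_refinements]
      intro A y
      exact (ShortComplex.exact_mk_iff _ _ _).1
        ((N.exactAt_iff' (-1) 0 1 (by simp) (by simp)).1 (hN 0)) _ y (hN1.eq_of_tgt _ _)
    have hw : biprod.desc w₀ (G.map (K.d (-1) 0)) = e.inv ≫ N.d (-1) 0 ≫ b₀ := by rw [← he]; simp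
    have : Epi b₀ := epi_of_epi_fac hb₀'
    have := e.isIso_inv
    rw [hw]
    exact epi_comp e.inv (N.d (-1) 0 ≫ b₀)
  have := e.isIso_hom
  have : Mono (j ≫ e.hom) := mono_comp j e.hom
  refine prop_of_mono_of_comp_eq_zero F G hFG hT htor (K.d (-1) 0) ?_ (hP 0) w₀ (j ≫ e.hom) hj hex
    θ ?_
  · have h01 : K.d 0 1 = 0 := (K.isZero_of_isStrictlyLE 0 1 (by lia)).eq_of_tgt _ _
    have := K.isIso_homologyι 0 1 (by simp) h01
    let hc := K.opcyclesIsCokernel (-1) 0 (by simp)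
    let e₀ : Limits.cokernel (K.d (-1) 0) ≅ K.opcycles 0 :=
      IsColimit.coconePointUniqueUpToIso (cokernelIsCokernel _) hc
    have := mono_comp e₀.hom (CategoryTheory.inv (K.homologyι 0))
    exact hT (e₀.hom ≫ CategoryTheory.inv (K.homologyι 0)) hK
  · have hθ' : θ ≫ F.map j = 0 := hθ0
    rw [F.map_comp, reassoc_of% hθ', zero_comp]

end CategoryTheory

/-! ### The counit on derived categories -/

namespace CategoryTheory

open HomologicalComplex CochainComplex _root_.DerivedCategory

variable {C D : Type*} [Category* C] [Abelian C] [HasDerivedCategory C]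
  [Category* D] [Abelian D] [HasDerivedCategory D]

/-- The exact functor between bounded above derived categories is computed on complexes. -/
def Functor.mapDerivedCategoryMinusFactors (G : D ⥤ C) [G.Additive] [PreservesFiniteLimits G]
    [PreservesFiniteColimits G] : Minus.Qh ⋙ G.mapDerivedCategoryMinus ≅
      G.mapHomotopyCategoryMinus ⋙ Minus.Qh :=
  NatIso.ofComponents (fun K => ObjectProperty.isoMk _ (G.mapDerivedCategoryFactorsh.app K.obj))
    (fun f => ObjectProperty.hom_ext _ (G.mapDerivedCategoryFactorsh.hom.naturality f.hom))

/-- The counit of an adjunction on complexes. -/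
def Adjunction.mapHomotopyCategoryMinusCounit {F : C ⥤ D} {G : D ⥤ C} [F.Additive] [G.Additive]
    (adj : F ⊣ G) : G.mapHomotopyCategoryMinus ⋙ F.mapHomotopyCategoryMinus ⟶
      𝟭 (HomotopyCategory.Minus D) where
  app K := ObjectProperty.homMk ((HomotopyCategory.quotient _ _).map
    ((NatTrans.mapHomologicalComplex adj.counit _).app K.obj.as))
  naturality := by
    rintro ⟨K, hK⟩ ⟨L, hL⟩ ⟨f⟩
    obtain ⟨f, rfl⟩ := (HomotopyCategory.quotient D (ComplexShape.up ℤ)).map_surjective f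
    ext : 1
    exact congrArg (HomotopyCategory.quotient D (ComplexShape.up ℤ)).map
      ((NatTrans.mapHomologicalComplex adj.counit (ComplexShape.up ℤ)).naturality f)

instance {F : C ⥤ D} {G : D ⥤ C} [F.Additive] [G.Additive] (adj : F ⊣ G) [IsIso adj.counit]
    (K : HomotopyCategory.Minus D) : IsIso (adj.mapHomotopyCategoryMinusCounit.app K) := by
  have h : IsIso ((NatTrans.mapHomologicalComplex adj.counit (ComplexShape.up ℤ)).app K.obj.as) := by
    have (i : ℤ) : IsIso (((NatTrans.mapHomologicalComplex adj.counit
        (ComplexShape.up ℤ)).app K.obj.as).f i) := inferInstanceAs (IsIso (adj.counit.app _))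
    exact HomologicalComplex.Hom.isIso_of_components _
  have : IsIso ((HomotopyCategory.minus D).ι.map (adj.mapHomotopyCategoryMinusCounit.app K)) :=
    inferInstanceAs (IsIso ((HomotopyCategory.quotient _ _).map
      ((NatTrans.mapHomologicalComplex adj.counit (ComplexShape.up ℤ)).app K.obj.as)))
  exact isIso_of_reflects_iso _ (HomotopyCategory.minus D).ι

section

variable {F : C ⥤ D} {G : D ⥤ C} [F.Additive] [G.Additive] [PreservesFiniteLimits G]
    [PreservesFiniteColimits G] [F.HasLeftDerivedFunctorMinus] (adj : F ⊣ G)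

/-- The counit of an adjunction on bounded above derived categories. -/
def Adjunction.derivedCounit :
    G.mapDerivedCategoryMinus ⋙ F.leftDerivedFunctorMinus ⟶ 𝟭 (DerivedCategory.Minus D) :=
  Localization.liftNatTrans Minus.Qh (Minus.quasiIso D)
    (Minus.Qh ⋙ G.mapDerivedCategoryMinus ⋙ F.leftDerivedFunctorMinus) (Minus.Qh ⋙ 𝟭 _) _ _
    ((Functor.associator _ _ _).inv ≫
      Functor.whiskerRight G.mapDerivedCategoryMinusFactors.hom _ ≫
      (Functor.associator _ _ _).hom ≫
      Functor.whiskerLeft G.mapHomotopyCategoryMinus F.leftDerivedFunctorMinusCounit ≫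
      (Functor.associator _ _ _).inv ≫
      Functor.whiskerRight adj.mapHomotopyCategoryMinusCounit Minus.Qh ≫
      (Functor.leftUnitor _).hom ≫ (Functor.rightUnitor _).inv)

lemma Adjunction.derivedCounit_app_Qh (K : HomotopyCategory.Minus D) :
    adj.derivedCounit.app (Minus.Qh.obj K) =
      F.leftDerivedFunctorMinus.map (G.mapDerivedCategoryMinusFactors.hom.app K) ≫
        F.leftDerivedFunctorMinusCounit.app (G.mapHomotopyCategoryMinus.obj K) ≫
          Minus.Qh.map (adj.mapHomotopyCategoryMinusCounit.app K) := by
  simp only [Adjunction.derivedCounit]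
  rw [Localization.liftNatTrans_app]
  simp

end

end CategoryTheory

/-! ### Cohomology with values in the heart -/

namespace CategoryTheory.Triangulated.TStructure

variable {C : Type*} [Category* C] [Preadditive C] [HasZeroObject C] [HasShift C ℤ]
  [∀ n : ℤ, (shiftFunctor C n).Additive] [Pretriangulated C] [IsTriangulated C] (t : TStructure C)

lemma isIso_heartCohomology_map {X Y : C} (f : X ⟶ Y) (h : IsIso ((t.truncGE 0).map f)) :
    IsIso (t.heartCohomology.map f) := by
  have : IsIso (t.heart.ι.map (t.heartCohomology.map f)) :=
    inferInstanceAs (IsIso ((t.truncLE 0).map ((t.truncGE 0).map f)))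
  exact isIso_of_reflects_iso _ t.heart.ι

/-- The bound `-2` rather than `-1` is needed: rotating back puts the third object shifted by `-1`
in front of the morphism, and it must lie in degrees at most `-1` for `τ^{≥0}` not to see it. -/
lemma isIso_heartCohomology_map_of_distTriang {T : Triangle C} (hT : T ∈ distTriang _)
    (h : t.le (-2) T.obj₃) : IsIso (t.heartCohomology.map T.mor₁) :=
  t.isIso_heartCohomology_map _ (t.isIso₂_truncGE_map_of_isLE _ (inv_rot_of_distTriang _ hT)
    (-1) 0 rfl ⟨t.le_shift (-2) (-1) (-1) rfl _ h⟩)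

omit [IsTriangulated C] in
lemma isIso_truncGEπ_app_of_heart (X : t.heart.FullSubcategory) :
    IsIso ((t.truncGEπ 0).app X.obj) := by
  have : t.IsGE X.obj 0 := ((t.mem_heart_iff _).1 X.2).2
  infer_instance

omit [IsTriangulated C] in
lemma isIso_truncLEι_app_of_heart (X : t.heart.FullSubcategory) :
    IsIso ((t.truncLEι 0).app ((t.truncGE 0).obj X.obj)) := by
  have : t.IsLE X.obj 0 := ((t.mem_heart_iff _).1 X.2).1
  have := t.isIso_truncGEπ_app_of_heart X
  have e : X.obj ≅ (t.truncGE 0).obj X.obj := asIso ((t.truncGEπ 0).app X.obj)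
  have : t.IsLE ((t.truncGE 0).obj X.obj) 0 := t.isLE_of_iso e 0
  infer_instance

/-- The cohomology functor restricts to the identity of the heart. -/
def heartιCompHeartCohomology : t.heart.ι ⋙ t.heartCohomology ≅ 𝟭 _ :=
  NatIso.ofComponents
    (fun X => ObjectProperty.isoMk _
      (@asIso _ _ _ _ _ (t.isIso_truncLEι_app_of_heart X) ≪≫
        (@asIso _ _ _ _ _ (t.isIso_truncGEπ_app_of_heart X)).symm))
    (fun {X Y} f => by
      let p (X : t.heart.FullSubcategory) : X.obj ⟶ (t.truncGE 0).obj X.obj :=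
        (t.truncGEπ 0).app X.obj
      have hp (X) : IsIso (p X) := t.isIso_truncGEπ_app_of_heart X
      let i (X : C) : (t.truncLE 0).obj X ⟶ X := (t.truncLEι 0).app X
      have e₁ : (t.truncLE 0).map ((t.truncGE 0).map f.hom) ≫ i _ = i _ ≫ (t.truncGE 0).map f.hom :=
        (t.truncLEι 0).naturality ((t.truncGE 0).map f.hom)
      have e₂ : f.hom ≫ p Y = p X ≫ (t.truncGE 0).map f.hom := (t.truncGEπ 0).naturality f.hom
      have e₃ : (t.truncLE 0).map ((t.truncGE 0).map f.hom) ≫ i _ ≫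
          CategoryTheory.inv (p Y) = (i _ ≫ CategoryTheory.inv (p X)) ≫ f.hom := by
        rw [reassoc_of% e₁, Category.assoc]
        congr 1
        rw [IsIso.eq_inv_comp, ← reassoc_of% e₂, IsIso.hom_inv_id, Category.comp_id]
      exact ObjectProperty.hom_ext _ e₃)

end CategoryTheory.Triangulated.TStructure

/-! ### The comparison on the heart of a tilted t-structure -/

namespace CategoryTheory

open HomologicalComplex CochainComplex _root_.DerivedCategory

/-- The transformation `ε` need not be invertible; it has to become so only on objects coming from
`A` and after `I` and `H`. -/
lemma Functor.nonempty_iso_id_of_isIso {A B E M : Type*} [Category* A] [Category* B] [Category* E]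
    [Category* M] {U : A ⥤ B} {G : B ⥤ M} {L : M ⥤ B} (ε : G ⋙ L ⟶ 𝟭 B) {I : B ⥤ E}
    {H : E ⥤ A} {J : A ⥤ E} (eU : U ⋙ I ≅ J) (eH : J ⋙ H ≅ 𝟭 A)
    (h : ∀ X, IsIso (H.map (I.map (ε.app (U.obj X))))) :
    Nonempty (U ⋙ G ⋙ L ⋙ I ⋙ H ≅ 𝟭 A) := by
  let τ : U ⋙ (G ⋙ L) ⋙ I ⋙ H ⟶ U ⋙ 𝟭 B ⋙ I ⋙ H := whiskerLeft U (whiskerRight ε (I ⋙ H))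
  have (X : A) : IsIso (τ.app X) := h X
  have := NatIso.isIso_of_isIso_app τ
  exact ⟨isoWhiskerLeft U (associator _ _ _).symm ≪≫ asIso τ ≪≫
    isoWhiskerLeft U (leftUnitor _) ≪≫ (associator _ _ _).symm ≪≫ isoWhiskerRight eU H ≪≫ eH⟩

variable {C D : Type*} [Category* C] [Abelian C] [HasDerivedCategory C]
  [Category* D] [Abelian D] [HasDerivedCategory D]

section

variable {F : C ⥤ D} {G : D ⥤ C} [F.Additive] [G.Additive] [PreservesFiniteLimits G]
    [PreservesFiniteColimits G] (adj : F ⊣ G) [IsIso adj.counit]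

omit [Abelian C] [HasDerivedCategory C] [HasDerivedCategory D] [F.Additive] [G.Additive]
  [PreservesFiniteLimits G] [PreservesFiniteColimits G] in
include adj in
-- The counit conjugates `F (G f)` to `f`.
lemma Adjunction.mono_map_map_of_isIso_counit {X Y : D} (f : X ⟶ Y) [Mono f] :
    Mono (F.map (G.map f)) := by
  have h : F.map (G.map f) = adj.counit.app X ≫ f ≫ CategoryTheory.inv (adj.counit.app Y) := by
    rw [← Category.assoc, IsIso.eq_comp_inv]
    exact adj.counit.naturality f
  rw [h]
  infer_instance

omit [PreservesFiniteLimits G] [PreservesFiniteColimits G] [IsIso adj.counit] [G.Additive] in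
lemma Functor.leftDerivedFunctorMinusCounit_naturality [F.HasLeftDerivedFunctorMinus]
    {P P' : HomotopyCategory.Minus C} (w : P ⟶ P') :
    F.leftDerivedFunctorMinus.map (Minus.Qh.map w) ≫ F.leftDerivedFunctorMinusCounit.app P' =
      F.leftDerivedFunctorMinusCounit.app P ≫ Minus.Qh.map (F.mapHomotopyCategoryMinus.map w) :=
  F.leftDerivedFunctorMinusCounit.naturality w

variable {T T' : ObjectProperty D} (hTT' : IsTorsionPair T T')
  (hT : ∀ {X Y : D} (f : X ⟶ Y) [Mono f], T Y → T X)
  {S : ObjectProperty C} (hS : S.IsAdaptedTo F)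
  (htor : ∀ (P : C) (_ : S P) (Q : D) (_ : T Q) (r : P ⟶ G.obj Q) [Epi r],
      T (Limits.kernel (F.map (kernel.ι r))))

omit [HasDerivedCategory C] in
include adj hTT' hT htor in
-- The cone of `F w` is `F` of the acyclic cone of `w`. Its homology vanishes in degrees at least
-- `-1` by right exactness, and degree `-2` is the kernel estimate.
lemma tiltLE_map_mappingCone [PreservesFiniteColimits F]
    (K : CochainComplex D ℤ) [K.IsStrictlyLE 0] (hK : T (K.homology 0))
    {P : CochainComplex C ℤ} [P.IsStrictlyLE 0] (hP : ∀ i, S (P.X i))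
    (w : P ⟶ (G.mapHomologicalComplex _).obj K) [QuasiIso w] :
    tiltLE T (-2) (Q.obj (mappingCone ((F.mapHomologicalComplex (ComplexShape.up ℤ)).map w))) := by
  let e := mappingCone.mapHomologicalComplexIso w F
  have e' (i : ℤ) : (homologyFunctor D i).obj (Q.obj (mappingCone ((F.mapHomologicalComplex
      (ComplexShape.up ℤ)).map w))) ≅ ((F.mapHomologicalComplex
        (ComplexShape.up ℤ)).obj (mappingCone w)).homology i :=
    (homologyFunctorFactors D i).app _ ≪≫ (HomologicalComplex.homologyFunctor _ _ i).mapIso e.symm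
  refine ⟨hTT'.of_iso_left (e' (-2)).symm (prop_homology_map_mappingCone F G
    (fun f _ => adj.mono_map_map_of_isIso_counit f) hT htor K hK hP w), fun i hi => ?_⟩
  have : CochainComplex.IsStrictlyLE ((G.mapHomologicalComplex (ComplexShape.up ℤ)).obj K) 0 :=
    inferInstance
  have := mappingCone.isStrictlyLE w 0 0 0 (by lia) (by lia)
  exact (isZero_homology_map_of_acyclic F
    ((CochainComplex.quasiIso_iff_acyclic_mappingCone w).1 inferInstance) 0 i (by lia)).of_iso (e' i)

variable [F.HasLeftDerivedFunctorMinus]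

include hS in
omit [IsIso adj.counit] in
-- By naturality along the resolution `w`, the derived counit at `K` is `F w` composed with
-- isomorphisms: the derived functor inverts `w`, its comparison map is invertible at the adapted
-- `P`, and the termwise counit is invertible.
lemma isIso_map_derivedCounit_app_Qh [IsIso adj.counit] {E : Type*} [Category* E]
    (Φ : DerivedCategory.Minus D ⥤ E) {K : HomotopyCategory.Minus D} {P : HomotopyCategory.Minus C}
    (w : P ⟶ G.mapHomotopyCategoryMinus.obj K) (hw : Minus.quasiIso C w) (hP : S.termwiseMinus P)
    (h : IsIso (Φ.map (Minus.Qh.map (F.mapHomotopyCategoryMinus.map w)))) :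
    IsIso (Φ.map (adj.derivedCounit.app (Minus.Qh.obj K))) := by
  have hw' : IsIso (Minus.Qh.map w) := Localization.inverts Minus.Qh (Minus.quasiIso C) _ hw
  have hα := hS.isIso_counit_app hP
  have hα' : F.leftDerivedFunctorMinusCounit.app (G.mapHomotopyCategoryMinus.obj K) =
      CategoryTheory.inv (F.leftDerivedFunctorMinus.map (Minus.Qh.map w)) ≫
        F.leftDerivedFunctorMinusCounit.app P ≫
          Minus.Qh.map (F.mapHomotopyCategoryMinus.map w) :=
    (IsIso.eq_inv_comp _).2 (Functor.leftDerivedFunctorMinusCounit_naturality w)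
  rw [adj.derivedCounit_app_Qh, hα']
  simp only [Functor.map_comp]
  infer_instance

variable (t : TStructure (DerivedCategory D)) (ht : ∀ n, t.le n = tiltLE T n)

omit [IsIso adj.counit] in
lemma isIso_heartCohomology_map_Q_map (t : TStructure (DerivedCategory D))
    {K L : CochainComplex D ℤ} (f : K ⟶ L) (h : t.le (-2) (Q.obj (mappingCone f))) :
    IsIso (t.heartCohomology.map (Q.map f)) :=
  t.isIso_heartCohomology_map_of_distTriang
    (T := Q.mapTriangle.obj (CochainComplex.mappingCone.triangle f))
    (DerivedCategory.mappingCone_triangle_distinguished f) h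

omit [IsIso adj.counit] in
lemma isIso_map_Qh_map {E : Type*} [Category* E] (Φ : DerivedCategory D ⥤ E)
    {K L : CochainComplex D ℤ} (f : K ⟶ L) (h : IsIso (Φ.map (Q.map f))) :
    IsIso (Φ.map (Qh.map ((HomotopyCategory.quotient D (ComplexShape.up ℤ)).map f))) := by
  have h2 : Qh.map ((HomotopyCategory.quotient _ _).map f) =
      (quotientCompQhIso D).hom.app _ ≫ Q.map f ≫ (quotientCompQhIso D).inv.app _ := by
    have := (quotientCompQhIso D).hom.naturality f
    rw [← reassoc_of% this]
    simp
  rw [h2, Functor.map_comp, Functor.map_comp]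
  infer_instance

include hTT' hT hS htor ht in
-- After replacing `X` by a complex in degrees at most `0` and resolving its image under `G`, the
-- only morphism left to invert is `F w`, whose cone lies in the aisle of index `-2`.
lemma isIso_heartCohomology_map_derivedCounit (X : DerivedCategory.Minus D)
    (hX : tiltLE T 0 X.obj) :
    IsIso (t.heartCohomology.map (Minus.ι.map (adj.derivedCounit.app X))) := by
  have := adj.leftAdjoint_preservesColimits
  have : PreservesFiniteColimits F := ⟨fun _ => inferInstance⟩
  let Φ := Minus.ι ⋙ t.heartCohomology
  change IsIso (Φ.map (adj.derivedCounit.app X))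
  have hX0 : X.obj.IsLE 0 := (DerivedCategory.isLE_iff _ _).2 hX.2
  obtain ⟨K, hK, ⟨e⟩⟩ := exists_iso_Q_obj_of_isLE X.obj 0
  let K' := HomotopyCategory.Minus.of K 0
  let e' : X ≅ Minus.Qh.obj K' := ObjectProperty.isoMk _ (e ≪≫ ((quotientCompQhIso D).app K).symm)
  suffices h : IsIso (Φ.map (adj.derivedCounit.app (Minus.Qh.obj K'))) by
    have nat := adj.derivedCounit.naturality e'.hom
    have nat' := (Iso.eq_comp_inv e').2 nat.symm
    rw [nat', Φ.map_comp, Φ.map_comp]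
    infer_instance
  have hKT : T (K.homology 0) := hTT'.of_iso_left ((homologyFunctor D 0).mapIso e ≪≫
    (homologyFunctorFactors D 0).app K) hX.1
  have : CochainComplex.IsStrictlyLE ((G.mapHomologicalComplex (ComplexShape.up ℤ)).obj K) 0 :=
    inferInstance
  obtain ⟨P, w, hw, hP0, hP⟩ := ObjectProperty.exists_resolution_of_isStrictlyLE hS.exists_epi
    (fun _ h => hS.of_isZero h) (fun e h => hS.of_iso e h)
    ((G.mapHomologicalComplex (ComplexShape.up ℤ)).obj K) 0
  let P' := HomotopyCategory.Minus.of P 0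
  let w' : P' ⟶ G.mapHomotopyCategoryMinus.obj K' :=
    ObjectProperty.homMk ((HomotopyCategory.quotient _ _).map w)
  have hle : t.le (-2) (Q.obj (mappingCone ((F.mapHomologicalComplex (ComplexShape.up ℤ)).map w))) := by
    rw [ht]
    exact tiltLE_map_mappingCone adj hTT' hT htor K hKT hP w
  have hFw : IsIso (Φ.map (Minus.Qh.map (F.mapHomotopyCategoryMinus.map w'))) :=
    isIso_map_Qh_map t.heartCohomology _ (isIso_heartCohomology_map_Q_map t _ hle)
  exact isIso_map_derivedCounit_app_Qh adj hS Φ w'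
    ((HomotopyCategory.quotient_map_mem_quasiIso_iff w).2 hw) hP hFw

include hTT' hT hS htor adj ht in
/-- The comparison of the heart of a tilted t-structure with its derived inverse image. -/
theorem nonempty_iso_heart_of_adjunction (U : t.heart.FullSubcategory ⥤
    DerivedCategory.Minus D) (eU : U ⋙ Minus.ι ≅ t.heart.ι) :
    Nonempty (U ⋙ G.mapDerivedCategoryMinus ⋙ F.leftDerivedFunctorMinus ⋙ Minus.ι ⋙
      t.heartCohomology ≅ 𝟭 _) := by
  have hU (X : t.heart.FullSubcategory) : tiltLE T 0 (U.obj X).obj :=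
    ht 0 ▸ (t.le_isClosedUnderIsomorphisms 0).of_iso (eU.app X).symm X.2.1
  exact Functor.nonempty_iso_id_of_isIso adj.derivedCounit eU t.heartιCompHeartCohomology
    fun X => isIso_heartCohomology_map_derivedCounit adj hTT' hT hS htor t ht (U.obj X) (hU X)

end

end CategoryTheory

/-! ### Sections on affine charts and inverse images -/

namespace AlgebraicGeometry

/-- Global sections of a direct image between spectra. -/
def pushforwardCompModuleSpecΓIso {R S : CommRingCat.{u}} (φ : R ⟶ S) :
    Scheme.Modules.pushforward (Spec.map φ) ⋙ moduleSpecΓFunctor (R := R) ≅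
      moduleSpecΓFunctor (R := S) ⋙ ModuleCat.restrictScalars φ.hom :=
  Functor.isoWhiskerRight (pushforwardCompModulesSpecToSheafIso φ)
    (TopCat.Sheaf.forget _ _ ⋙ (CategoryTheory.evaluation _ _).obj (.op ⊤))

/-- The inverse image of `N^~` is `(N ⊗ S)^~`. -/
def tildePullbackIso {R S : CommRingCat.{u}} (φ : R ⟶ S) :
    tilde.functor R ⋙ Scheme.Modules.pullback (Spec.map φ) ≅
      ModuleCat.extendScalars φ.hom ⋙ tilde.functor S :=
  -- Both composites are left adjoint to global sections followed by restriction of scalars.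
  (tilde.adjunction.comp (Scheme.Modules.pullbackPushforwardAdjunction (Spec.map φ))).leftAdjointUniq
    (((ModuleCat.extendRestrictScalarsAdj φ.hom).comp tilde.adjunction).ofNatIsoRight
      (pushforwardCompModuleSpecΓIso φ).symm)

namespace Scheme

open Modules

variable {X Y : Scheme.{u}}

/-- The module of sections of a coherent sheaf on an affine chart. -/
def chartSections {R : CommRingCat.{u}} (c : Spec R ⟶ Y) [IsOpenImmersion c] :
    Coh Y ⥤ ModuleCat.{u} R :=
  (IsCoherent Y).ι ⋙ Modules.restrictFunctor c ⋙ moduleSpecΓFunctor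

/-- A coherent sheaf on an affine chart is determined by its sections. -/
def restrictIsoTilde {R : CommRingCat.{u}} (c : Spec R ⟶ Y) [IsOpenImmersion c] :
    (IsCoherent Y).ι ⋙ Modules.restrictFunctor c ≅ chartSections c ⋙ tilde.functor R :=
  haveI (E : Coh Y) : IsIso ((Functor.whiskerLeft ((IsCoherent Y).ι ⋙ Modules.restrictFunctor c)
      (fromTildeΓNatTrans (R := R))).app E) := by
    have : SheafOfModules.IsQuasicoherent.{u} E.obj := E.2.1
    have : SheafOfModules.IsQuasicoherent.{u} (E.obj.restrict c) := inferInstance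
    exact (inferInstance : IsIso ((E.obj.restrict c).fromTildeΓ))
  haveI := NatIso.isIso_of_isIso_app (Functor.whiskerLeft ((IsCoherent Y).ι ⋙ Modules.restrictFunctor c)
      (fromTildeΓNatTrans (R := R)))
  (asIso (Functor.whiskerLeft ((IsCoherent Y).ι ⋙ Modules.restrictFunctor c)
      (fromTildeΓNatTrans (R := R)))).symm

/-- Sections of an inverse image on an affine chart. -/
def cohPullbackCompChartSectionsIso [IsLocallyNoetherian Y] (g : X ⟶ Y) {R S : CommRingCat.{u}}
    (φ : R ⟶ S) (c : Spec R ⟶ Y) (d : Spec S ⟶ X) [IsOpenImmersion c] [IsOpenImmersion d]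
    (h : d ≫ g = Spec.map φ ≫ c) :
    cohPullback g ⋙ chartSections d ≅ chartSections c ⋙ ModuleCat.extendScalars φ.hom :=
  let e1 : pullback g ⋙ Modules.restrictFunctor d ≅ Modules.restrictFunctor c ⋙ pullback (Spec.map φ) :=
    Functor.isoWhiskerLeft _ (restrictFunctorIsoPullback d) ≪≫ pullbackComp d g ≪≫
      pullbackCongr h ≪≫ (pullbackComp _ _).symm ≪≫
        Functor.isoWhiskerRight (restrictFunctorIsoPullback c).symm _
  let e2 : (IsCoherent Y).ι ⋙ Modules.restrictFunctor c ⋙ pullback (Spec.map φ) ≅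
      (chartSections c ⋙ ModuleCat.extendScalars φ.hom) ⋙ tilde.functor S :=
    Functor.isoWhiskerRight (restrictIsoTilde c) (pullback (Spec.map φ)) ≪≫
      Functor.isoWhiskerLeft (chartSections c) (tildePullbackIso φ)
  Functor.isoWhiskerRight (Functor.isoWhiskerLeft (IsCoherent Y).ι e1 ≪≫ e2) moduleSpecΓFunctor ≪≫
    Functor.isoWhiskerLeft (chartSections c ⋙ ModuleCat.extendScalars φ.hom)
      (tilde.toTildeΓNatIso (R := S)).symm ≪≫ Functor.rightUnitor _

end Scheme
end AlgebraicGeometry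

/-! ### Flat modules and base change -/

lemma Module.Flat.of_exact {R M N P : Type u} [CommRing R] [AddCommGroup M] [Module R M]
    [AddCommGroup N] [Module R N] [AddCommGroup P] [Module R P] [Module.Flat R N] [Module.Flat R P]
    (f : N →ₗ[R] P) (hf : Function.Surjective f) (g : M →ₗ[R] N) (hg : Function.Injective g)
    (H : Function.Exact g f) : Module.Flat R M := by
  rw [Module.Flat.iff_rTensor_preserves_injective_linearMap'.{u}]
  intro Q A _ _ _ _ q hq
  -- Flatness of the quotient `P` keeps `g` injective after tensoring with `Q`. Flatness of `N` then
  -- gives injectivity of the diagonal of the square `h3`.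
  have h1 := LinearMap.lTensor_injective_of_exact_of_flat f hf g hg H Q
  have h2 := Module.Flat.rTensor_preserves_injective_linearMap (M := N) q hq
  have h3 : (LinearMap.lTensor A g) ∘ₗ (LinearMap.rTensor M q) =
      (LinearMap.rTensor N q) ∘ₗ (LinearMap.lTensor Q g) := by
    rw [LinearMap.lTensor_comp_rTensor, LinearMap.rTensor_comp_lTensor]
  have h4 := h2.comp h1
  rw [← LinearMap.coe_comp, ← h3, LinearMap.coe_comp] at h4
  exact h4.of_comp

lemma Module.Flat.prod {R : Type u} [CommRing R] (M N : Type u) [AddCommGroup M] [Module R M]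
    [AddCommGroup N] [Module R N] [Module.Flat R M] [Module.Flat R N] : Module.Flat R (M × N) := by
  rw [Module.Flat.iff_rTensor_preserves_injective_linearMap'.{u}]
  intro Q A _ _ _ _ q hq
  have hM := Module.Flat.rTensor_preserves_injective_linearMap (M := M) q hq
  have hN := Module.Flat.rTensor_preserves_injective_linearMap (M := N) q hq
  let e := TensorProduct.prodRight R R Q M N
  let e' := TensorProduct.prodRight R R A M N
  have h : e'.toLinearMap ∘ₗ q.rTensor (M × N) =
      ((q.rTensor M).prodMap (q.rTensor N)) ∘ₗ e.toLinearMap := by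
    ext <;> simp [e, e']
  have h2 : Function.Injective (((q.rTensor M).prodMap (q.rTensor N)) ∘ₗ e.toLinearMap) :=
    (Prod.map_injective.2 ⟨hM, hN⟩).comp e.injective
  rw [← h, LinearMap.coe_comp] at h2
  exact h2.of_comp

open TensorProduct in
-- Since `B = S ⊗_R A`, tensoring over `A` with `B` is tensoring over `R` with `S`, where flatness
-- of `P` over `R` suffices.
lemma Algebra.IsPushout.lTensor_injective (R S A B : Type*) [CommRing R] [CommRing S]
    [CommRing A] [CommRing B] [Algebra R S] [Algebra S B] [Algebra R A] [Algebra A B] [Algebra R B]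
    [IsScalarTower R A B] [IsScalarTower R S B] [Algebra.IsPushout R S A B]
    {M N P : Type*} [AddCommGroup M] [Module R M] [Module A M] [IsScalarTower R A M]
    [AddCommGroup N] [Module R N] [Module A N] [IsScalarTower R A N]
    [AddCommGroup P] [Module R P] [Module A P] [IsScalarTower R A P] [Module.Flat R P]
    (f : N →ₗ[A] P) (hf : Function.Surjective f) (g : M →ₗ[A] N) (hg : Function.Injective g)
    (H : Function.Exact g f) : Function.Injective (g.lTensor B) := by
  have h1 := LinearMap.lTensor_injective_of_exact_of_flat (f.restrictScalars R) hf
    (g.restrictScalars R) hg H S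
  let e := Algebra.IsPushout.cancelBaseChange R S A B M
  let e' := Algebra.IsPushout.cancelBaseChange R S A B N
  have h2 : ∀ x, g.lTensor B (e.symm x) = e'.symm ((g.restrictScalars R).lTensor S x) := by
    intro x
    induction x with
    | zero => simp
    | add x y hx hy => simp only [map_add, hx, hy]
    | tmul s m => simp [e, e']
  intro x y hxy
  obtain ⟨x, rfl⟩ := e.symm.surjective x
  obtain ⟨y, rfl⟩ := e.symm.surjective y
  rw [h2, h2] at hxy
  rw [h1 (e'.symm.injective hxy)]

namespace ModuleCat

variable {R S A B : CommRingCat.{u}}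

/-- Flatness of a module over a ring `A` with respect to a ring homomorphism `i : R ⟶ A`. -/
def IsFlatOver (i : R ⟶ A) (M : ModuleCat.{u} A) : Prop :=
  Module.Flat R ((ModuleCat.restrictScalars i.hom).obj M)

lemma IsFlatOver.of_iso {i : R ⟶ A} {M N : ModuleCat.{u} A} (e : M ≅ N) (h : IsFlatOver i M) :
    IsFlatOver i N :=
  have := (show Module.Flat R ((ModuleCat.restrictScalars i.hom).obj M) from h)
  Module.Flat.of_linearEquiv ((ModuleCat.restrictScalars i.hom).mapIso e).symm.toLinearEquiv

lemma isFlatOver_of_isZero {i : R ⟶ A} {M : ModuleCat.{u} A} (h : IsZero M) : IsFlatOver i M := by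
  have h' := (ModuleCat.restrictScalars i.hom).map_isZero h
  have := ModuleCat.subsingleton_of_isZero h'
  exact (inferInstance : Module.Flat R ((ModuleCat.restrictScalars i.hom).obj M))

lemma IsFlatOver.biprod {i : R ⟶ A} {M N : ModuleCat.{u} A} (hM : IsFlatOver i M)
    (hN : IsFlatOver i N) : IsFlatOver i (M ⊞ N) := by
  refine .of_iso (ModuleCat.biprodIsoProd M N).symm ?_
  let (M : ModuleCat.{u} A) : Module R M := Module.compHom M i.hom
  have h1 : Module.Flat R M := hM
  have h2 : Module.Flat R N := hN
  have h3 : Module.Flat R (M × N) := Module.Flat.prod M N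
  exact h3

lemma IsFlatOver.of_shortExact {i : R ⟶ A} {T : ShortComplex (ModuleCat.{u} A)}
    (hT : T.ShortExact) (h₂ : IsFlatOver i T.X₂) (h₃ : IsFlatOver i T.X₃) : IsFlatOver i T.X₁ := by
  have h2 : Module.Flat R ((ModuleCat.restrictScalars i.hom).obj T.X₂) := h₂
  have h3 : Module.Flat R ((ModuleCat.restrictScalars i.hom).obj T.X₃) := h₃
  exact Module.Flat.of_exact ((ModuleCat.restrictScalars i.hom).map T.g).hom hT.moduleCat_surjective_g
    ((ModuleCat.restrictScalars i.hom).map T.f).hom hT.moduleCat_injective_f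
    ((ShortComplex.ShortExact.moduleCat_exact_iff_function_exact T).1 hT.exact)

lemma mono_extendScalars_map {r : R ⟶ S} {i : R ⟶ A} {j : S ⟶ B} {s : A ⟶ B}
    (h : IsPushout r i j s) {T : ShortComplex (ModuleCat.{u} A)} (hT : T.ShortExact)
    (h₃ : IsFlatOver i T.X₃) : Mono ((ModuleCat.extendScalars s.hom).map T.f) := by
  algebraize [r.hom, i.hom, j.hom, s.hom, s.hom.comp i.hom]
  have : IsScalarTower R S B := .of_algebraMap_eq' congr(($h.w).hom).symm
  have : Algebra.IsPushout R S A B := CommRingCat.isPushout_iff_isPushout.1 h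
  let (M : ModuleCat.{u} A) : Module R M := Module.compHom M i.hom
  have (M : ModuleCat.{u} A) : IsScalarTower R A M := .of_algebraMap_smul fun _ _ => rfl
  have : Module.Flat R T.X₃ := h₃
  rw [ModuleCat.mono_iff_injective]
  exact Algebra.IsPushout.lTensor_injective R S A B T.g.hom hT.moduleCat_surjective_g T.f.hom
    hT.moduleCat_injective_f ((ShortComplex.ShortExact.moduleCat_exact_iff_function_exact T).1 hT.exact)

/-- As an `S`-module, `B ⊗_A M` is the base change `S ⊗_R M`. -/
lemma isFlatOver_extendScalars {r : R ⟶ S} {i : R ⟶ A} {j : S ⟶ B} {s : A ⟶ B}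
    (h : IsPushout r i j s) {M : ModuleCat.{u} A} (hM : IsFlatOver i M) :
    IsFlatOver j ((ModuleCat.extendScalars s.hom).obj M) := by
  algebraize [r.hom, i.hom, j.hom, s.hom, s.hom.comp i.hom]
  have : IsScalarTower R S B := .of_algebraMap_eq' congr(($h.w).hom).symm
  have : Algebra.IsPushout R S A B := CommRingCat.isPushout_iff_isPushout.1 h
  let : Module R M := Module.compHom M i.hom
  have : IsScalarTower R A M := .of_algebraMap_smul fun _ _ => rfl
  have : Module.Flat R M := hM
  exact Module.Flat.of_linearEquiv (Algebra.IsPushout.cancelBaseChange R S A B M)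

open ChangeOfRings in
-- Every `b ⊗ m` equals `1 ⊗ a m` for any lift `a` of `b`, so the unit of the adjunction is onto.
lemma exists_surjective_extendScalars (s : A ⟶ B) (hs : Function.Surjective s.hom)
    (M : ModuleCat.{u} A) :
    ∃ l : M →ₛₗ[s.hom] (ModuleCat.extendScalars s.hom).obj M, Function.Surjective l := by
  let u := (ModuleCat.extendRestrictScalarsAdj s.hom).unit.app M
  let l : M →ₛₗ[s.hom] (ModuleCat.extendScalars s.hom).obj M :=
    { toFun := u, map_add' := map_add u.hom, map_smul' := map_smul u.hom }
  have hl (b : B) (m : M) : ∃ y, l y = b • l m := by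
    obtain ⟨a, rfl⟩ := hs b
    exact ⟨a • m, map_smulₛₗ l a m⟩
  refine ⟨l, fun x => ?_⟩
  induction x using TensorProduct.induction_on with
  | zero => exact ⟨0, map_zero l⟩
  | tmul b m =>
    obtain ⟨y, hy⟩ := hl b m
    refine ⟨y, hy.trans ?_⟩
    refine (ModuleCat.ExtendScalars.smul_tmul (f := s.hom) (M := M) b 1 m).trans ?_
    exact congrArg (fun b : B => b ⊗ₜ[A, s.hom] m) (mul_one (M := B) b)
  | add x y hx hy =>
    obtain ⟨a, ha⟩ := hx
    obtain ⟨b, hb⟩ := hy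
    exact ⟨a + b, (map_add l a b).trans (by rw [ha, hb]; rfl)⟩

end ModuleCat

/-! ### Coherent sheaves tested on affine charts -/

namespace AlgebraicGeometry.Scheme

open Modules

variable {X Y : Scheme.{u}}

instance [IsLocallyNoetherian X] : PreservesFiniteLimits (IsCoherent X).ι :=
  ((IsCoherent X).ι.preservesFiniteLimits_tfae.out 2 3).1 fun _ _ φ =>
    (IsCoherent X).preservesKernels_ι φ

lemma coh_app_injective [IsLocallyNoetherian X] {E F : Coh X} (φ : E ⟶ F) [Mono φ] (U : X.Opens) :
    Function.Injective (φ.hom.app U) :=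
  have : Mono φ.hom := (inferInstance : Mono ((IsCoherent X).ι.map φ))
  app_injective_of_mono φ.hom U

lemma coh_app_exact [IsLocallyNoetherian X] {T : ShortComplex (Coh X)} (hT : T.ShortExact)
    (U : X.Opens) : Function.Exact (T.f.hom.app U) (T.g.hom.app U) := by
  have := hT.mono_f
  have hw : T.f.hom ≫ T.g.hom = 0 := congr($(T.zero).hom)
  refine fun x => ⟨fun hx => ?_, ?_⟩
  · have h := KernelFork.mapIsLimit _ hT.exact.fIsKernel (IsCoherent X).ι
    exact exists_app_kernel_ι T.g.hom T.f.hom hw h U x hx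
  · rintro ⟨y, rfl⟩
    exact congr(Modules.Hom.app $hw U y)

section

variable {R : CommRingCat.{u}} (c : Spec R ⟶ Y) [IsOpenImmersion c]

instance : (chartSections c).Additive where
  map_add := rfl

/-- The image of the chart is an affine open subset, over which sections of coherent sheaves
preserve epimorphisms; left exactness holds over any open subset. -/
lemma shortExact_map_chartSections [IsLocallyNoetherian Y] {T : ShortComplex (Coh Y)}
    (hT : T.ShortExact) : (T.map (chartSections c)).ShortExact := by
  have := hT.mono_f
  have := hT.epi_g
  have ha : IsAffineOpen (c ''ᵁ ⊤) := (isAffineOpen_top _).image_of_isOpenImmersion c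
  refine { exact := ?_, mono_f := ?_, epi_g := ?_ }
  · rw [ShortComplex.ShortExact.moduleCat_exact_iff_function_exact]
    exact coh_app_exact hT _
  · exact (ModuleCat.mono_iff_injective _).2 (coh_app_injective T.f _)
  · exact (ModuleCat.epi_iff_surjective _).2 ((epi_coh_iff T.g).1 inferInstance _ ha)

lemma preservesFiniteLimits_and_colimits_chartSections [IsLocallyNoetherian Y] :
    PreservesFiniteLimits (chartSections c) ∧ PreservesFiniteColimits (chartSections c) :=
  ((chartSections c).exact_tfae.out 0 3).1 fun _ hT => shortExact_map_chartSections c hT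

instance [IsLocallyNoetherian Y] : PreservesFiniteLimits (chartSections c) :=
  (preservesFiniteLimits_and_colimits_chartSections c).1

instance [IsLocallyNoetherian Y] : PreservesFiniteColimits (chartSections c) :=
  (preservesFiniteLimits_and_colimits_chartSections c).2

lemma finite_chartSections (E : Coh Y) : Module.Finite R ((chartSections c).obj E) := by
  have ha : IsAffineOpen (c ''ᵁ ⊤) := (isAffineOpen_top _).image_of_isOpenImmersion c
  have := E.2.2 _ ha
  let σ : R →+* Γ(Y, c ''ᵁ ⊤) := ((ΓSpecIso R).inv ≫ (c.appIso ⊤).inv).hom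
  have hσ : Function.Surjective σ :=
    (ConcreteCategory.bijective_of_isIso ((ΓSpecIso R).inv ≫ (c.appIso ⊤).inv)).2
  obtain ⟨s, hs⟩ := Module.Finite.fg_top (R := Γ(Y, c ''ᵁ ⊤)) (M := Γ(E.obj, c ''ᵁ ⊤))
  have hsm (r : R) (x : (chartSections c).obj E) :
      r • x = (show (chartSections c).obj E from σ r • (show Γ(E.obj, c ''ᵁ ⊤) from x)) := rfl
  refine ⟨⟨s, ?_⟩⟩
  rw [eq_top_iff]
  rintro (x : Γ(E.obj, c ''ᵁ ⊤)) -
  have hx : x ∈ Submodule.span Γ(Y, c ''ᵁ ⊤) (s : Set Γ(E.obj, c ''ᵁ ⊤)) := hs ▸ Submodule.mem_top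
  induction hx using Submodule.span_induction with
  | mem x hx => exact Submodule.subset_span hx
  | zero => exact zero_mem _
  | add x y _ _ hx hy => exact add_mem hx hy
  | smul a x _ hx =>
    obtain ⟨b, rfl⟩ := hσ a
    exact Submodule.smul_mem _ b hx

lemma isZero_restrict_of_chartSections {E : Coh Y} (h : IsZero ((chartSections c).obj E)) :
    IsZero (E.obj.restrict c) :=
  ((tilde.functor R).map_isZero h).of_iso ((restrictIsoTilde c).app E)

lemma subsingleton_of_isZero_chartSections {E : Coh Y} (h : IsZero ((chartSections c).obj E))
    (W : Y.Opens) (hW : W ≤ c.opensRange) : Subsingleton Γ(E.obj, W) := by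
  have h1 := (sections _ (c ⁻¹ᵁ W)).map_isZero (isZero_restrict_of_chartSections c h)
  have h2 : Subsingleton Γ(E.obj.restrict c, c ⁻¹ᵁ W) :=
    AddCommGrpCat.subsingleton_of_isZero h1
  have h3 : c ''ᵁ c ⁻¹ᵁ W = W := by
    rw [c.image_preimage_eq_opensRange_inf, inf_eq_right.2 hW]
  have h4 : Subsingleton Γ(E.obj, c ''ᵁ c ⁻¹ᵁ W) := h2
  rwa [h3] at h4

lemma isZero_chartSections_of_subsingleton {E : Coh Y} (h : Subsingleton Γ(E.obj, c.opensRange)) :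
    IsZero ((chartSections c).obj E) := by
  rw [← c.image_top_eq_opensRange] at h
  exact @ModuleCat.isZero_of_subsingleton _ _ ((chartSections c).obj E) h

end

lemma Modules.isZero_of_cover {M : Y.Modules} {I : Type*} (U : I → Y.Opens)
    (hU : ∀ y, ∃ i, y ∈ U i) (h : ∀ i, ∀ W ≤ U i, Subsingleton Γ(M, W)) : IsZero M := by
  rw [IsZero.iff_id_eq_zero]
  ext V x
  refine TopCat.Sheaf.eq_of_locally_eq' ⟨M.presheaf, M.isSheaf⟩
    (fun i => V ⊓ U i) V (fun i => homOfLE inf_le_left) ?_ _ _ fun i => ?_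
  · intro y hy
    obtain ⟨i, hi⟩ := hU y
    exact Opens.mem_iSup.2 ⟨i, hy, hi⟩
  · have := h i (V ⊓ U i) inf_le_right
    exact Subsingleton.elim _ _

section

variable {I : Type*} {R : I → CommRingCat.{u}} (c : ∀ i, Spec (R i) ⟶ Y)
  [∀ i, IsOpenImmersion (c i)] (hc : ∀ y, ∃ i, y ∈ (c i).opensRange)
include hc

lemma isZero_of_chartSections {E : Coh Y} (h : ∀ i, IsZero ((chartSections (c i)).obj E)) :
    IsZero E :=
  (IsZero.iff_id_eq_zero _).2 (ObjectProperty.hom_ext _ ((Modules.isZero_of_cover _ hc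
    fun i W hW => subsingleton_of_isZero_chartSections (c i) (h i) W hW).eq_of_src _ _))

variable [IsLocallyNoetherian Y]

/-- Sections on a chart are exact, so the kernel has no sections on any chart, and on a chart a
coherent sheaf is determined by its sections. -/
lemma mono_of_chartSections {E F : Coh Y} (φ : E ⟶ F)
    (h : ∀ i, Mono ((chartSections (c i)).map φ)) : Mono φ :=
  Preadditive.mono_of_isZero_kernel φ (isZero_of_chartSections c hc fun i =>
    have := h i
    (isZero_kernel_of_mono ((chartSections (c i)).map φ)).of_iso (PreservesKernel.iso _ _))

lemma epi_of_chartSections {E F : Coh Y} (φ : E ⟶ F)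
    (h : ∀ i, Epi ((chartSections (c i)).map φ)) : Epi φ :=
  Preadditive.epi_of_isZero_cokernel φ (isZero_of_chartSections c hc fun i =>
    have := h i
    (isZero_cokernel_of_epi ((chartSections (c i)).map φ)).of_iso (PreservesCokernel.iso _ _))

end

end AlgebraicGeometry.Scheme

/-! ### The counit along a closed immersion -/

lemma ModuleCat.mono_of_epi_of_iso_extendScalars {A B : CommRingCat.{u}} [IsNoetherianRing B]
    (s : A ⟶ B) (hs : Function.Surjective s.hom) {M : ModuleCat.{u} A} {N P : ModuleCat.{u} B}
    [Module.Finite B N] (j : N →+ M) (hj : Function.Surjective j)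
    (hj' : ∀ (a : A) (x : N), j (s.hom a • x) = a • j x)
    (e : P ≅ (ModuleCat.extendScalars s.hom).obj M) (δ : P ⟶ N) [Epi δ] : Mono δ := by
  obtain ⟨l, hl⟩ := ModuleCat.exists_surjective_extendScalars s hs M
  have h3 := (ModuleCat.epi_iff_surjective δ).1 inferInstance
  have he := ConcreteCategory.bijective_of_isIso e.inv
  -- Going around `N ⟶ M ⟶ B ⊗ M ≅ P ⟶ N` gives a surjective endomorphism of a noetherian module,
  -- hence an injective one. As `N` maps onto `P`, the last map `δ` is injective, so the counit
  -- never has to be identified with an explicit multiplication map.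
  let θ : N →ₗ[B] N :=
    { toFun := fun x => δ (e.inv (l (j x)))
      map_add' := fun x y => by simp only [map_add]
      map_smul' := fun b x => by
        obtain ⟨a, rfl⟩ := hs b
        rw [hj', map_smulₛₗ]
        simp only [map_smul, RingHom.id_apply] }
  have hs' : Function.Surjective fun x => e.inv (l (j x)) := he.2.comp (hl.comp hj)
  have : IsNoetherian B N := isNoetherian_of_isNoetherianRing_of_finite _ _
  have hi := IsNoetherian.injective_of_surjective_endomorphism θ (h3.comp hs')
  rw [ModuleCat.mono_iff_injective]
  intro x y hxy
  obtain ⟨x, rfl⟩ := hs' x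
  obtain ⟨y, rfl⟩ := hs' y
  rw [hi (a₁ := x) (a₂ := y) hxy]

namespace AlgebraicGeometry.Scheme

open Modules

lemma Modules.fromSpecIso_top_smul {X : Scheme.{u}} {U : X.Opens} (hU : IsAffineOpen U)
    (M : X.Modules) (h : hU.fromSpec ''ᵁ ⊤ = U) (a : Γ(X, U)) (x : Γ(M.restrict hU.fromSpec, ⊤)) :
    (fromSpecIso hU M ⊤ U h).hom (a • x) = a • (fromSpecIso hU M ⊤ U h).hom x := by
  simpa using fromSpecIso_smul hU M ⊤ U h le_rfl a x

variable {X Y : Scheme.{u}}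

/-- Inverse and direct image of coherent sheaves along a closed immersion are adjoint. -/
def cohPullbackPushforwardAdjunction [IsLocallyNoetherian Y] (f : X ⟶ Y) [IsClosedImmersion f] :
    cohPullback f ⊣ cohPushforward f :=
  (pullbackPushforwardAdjunction f).restrictFullyFaithful (IsCoherent Y).fullyFaithfulι
    (IsCoherent X).fullyFaithfulι (Iso.refl _) (Iso.refl _)

/-- Every open subset of `X` is the preimage of one of `Y`, so a morphism is determined by its
direct image. Faithfulness of the right adjoint makes the counit an epimorphism. -/
instance (f : X ⟶ Y) [IsClosedImmersion f] : (cohPushforward f).Faithful where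
  map_injective {M N φ ψ} h := by
    ext U x
    obtain ⟨V, hV⟩ := (f.isClosedEmbedding.isInducing.isOpen_iff).1 U.2
    obtain ⟨V, rfl⟩ : ∃ V' : Y.Opens, f ⁻¹ᵁ V' = U := ⟨⟨V, hV.1⟩, Opens.ext hV.2⟩
    exact congr(($h).hom.app V x)

lemma fromSpec_cover (Y : Scheme.{u}) (y : Y) :
    ∃ U : {U : Y.Opens // IsAffineOpen U}, y ∈ U.2.fromSpec.opensRange := by
  obtain ⟨U, hU, hy, -⟩ := exists_isAffineOpen_mem_and_subset (X := Y) (x := y) (U := ⊤) trivial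
  exact ⟨⟨U, hU⟩, by rwa [hU.opensRange_fromSpec]⟩

/-- The sections of a direct image on an affine chart. -/
lemma exists_chartSections_cohPushforward (f : X ⟶ Y) [IsClosedImmersion f] {U : Y.Opens}
    (hU : IsAffineOpen U) (E : Coh X) :
    ∃ l : (chartSections (hU.preimage f).fromSpec).obj E →+
        (chartSections hU.fromSpec).obj ((cohPushforward f).obj E), Function.Bijective l ∧
      ∀ (a : Γ(Y, U)) x, l (f.app U a • x) = a • l x := by
  let e := fromSpecIso (hU.preimage f) E.obj ⊤ (f ⁻¹ᵁ U) (fromSpec_image_top _)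
  let e' : Γ(((cohPushforward f).obj E).obj.restrict hU.fromSpec, ⊤) ≅ Γ(E.obj, f ⁻¹ᵁ U) :=
    fromSpecIso hU ((cohPushforward f).obj E).obj ⊤ U (fromSpec_image_top _)
  have he (a : Γ(X, f ⁻¹ᵁ U)) (x : Γ(E.obj.restrict (hU.preimage f).fromSpec, ⊤)) :
      e.hom (a • x) = a • e.hom x := fromSpecIso_top_smul _ _ _ _ _
  have he' (a : Γ(Y, U)) (x : Γ(((cohPushforward f).obj E).obj.restrict hU.fromSpec, ⊤)) :
      e'.hom (a • x) = f.app U a • e'.hom x :=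
    fromSpecIso_top_smul hU ((cohPushforward f).obj E).obj _ _ _
  have h1 (y) : e'.hom (e'.inv y) = y := by simp
  refine ⟨e'.inv.hom.comp e.hom.hom, (ConcreteCategory.bijective_of_isIso e'.inv).comp
    (ConcreteCategory.bijective_of_isIso e.hom), fun a x => ?_⟩
  apply (ConcreteCategory.bijective_of_isIso e'.hom).1
  refine Eq.trans ?_ (he' a (e'.inv (e.hom x))).symm
  exact (h1 _).trans ((he _ _).trans (congrArg (fun y => f.app U a • y) (h1 _).symm))

lemma fromSpec_preimage_comm (f : X ⟶ Y) [IsAffineHom f] {U : Y.Opens} (hU : IsAffineOpen U) :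
    (hU.preimage f).fromSpec ≫ f = Spec.map (f.app U) ≫ hU.fromSpec := by
  have := IsAffineOpen.SpecMap_appLE_fromSpec f hU (hU.preimage f) le_rfl
  rw [Scheme.Hom.app_eq_appLE]
  exact this.symm

/-- The counit is epi by faithfulness of the direct image. Injectivity is checked on preimages of
affine open subsets of `Y`, where its source is an extension of scalars along a surjection. -/
instance [IsLocallyNoetherian X] [IsLocallyNoetherian Y] (f : X ⟶ Y) [IsClosedImmersion f] :
    IsIso (cohPullbackPushforwardAdjunction f).counit := by
  let ε := (cohPullbackPushforwardAdjunction f).counit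
  suffices h : ∀ E, IsIso (ε.app E) from NatIso.isIso_of_isIso_app ε
  intro E
  have h1 : Epi (ε.app E) := inferInstance
  have h2 : Mono (ε.app E) := by
    refine mono_of_chartSections (fun U : {U : Y.Opens // IsAffineOpen U} => (U.2.preimage f).fromSpec) ?_ _ ?_
    · intro x
      obtain ⟨U, hU⟩ := fromSpec_cover Y (f x)
      refine ⟨U, ?_⟩
      rw [IsAffineOpen.opensRange_fromSpec] at hU ⊢
      exact hU
    · rintro ⟨U, hU⟩
      have : IsNoetherianRing Γ(X, f ⁻¹ᵁ U) :=
        IsLocallyNoetherian.component_noetherian ⟨_, hU.preimage f⟩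
      obtain ⟨j, hj, hj'⟩ := exists_chartSections_cohPushforward f hU E
      have hs : Function.Surjective (f.app U).hom := f.app_surjective U hU
      have := finite_chartSections (hU.preimage f).fromSpec E
      exact ModuleCat.mono_of_epi_of_iso_extendScalars (f.app U) hs j hj.2 hj'
        ((cohPullbackCompChartSectionsIso f (f.app U) hU.fromSpec (hU.preimage f).fromSpec
          (fromSpec_preimage_comm f hU)).app ((cohPushforward f).obj E))
        ((chartSections (hU.preimage f).fromSpec).map (ε.app E))
  exact isIso_of_mono_of_epi _

end AlgebraicGeometry.Scheme

/-! ### Coherent sheaves flat over the base ring -/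

namespace AlgebraicGeometry.Scheme

open Modules

section

variable {k : Type u} [Field k] {X : Scheme.{u}} (p : X ⟶ Spec (.of k)) {A B : Type u} [CommRing A]
  [Algebra k A] [CommRing B] [Algebra k B]

variable (A) in
/-- The projection of a base change to the scheme. -/
def baseChangeFst : baseChange p A ⟶ X :=
  pullback.fst p (Spec.map (CommRingCat.ofHom (algebraMap k A)))

variable (A) in
/-- The projection of a base change to the spectrum of the algebra. -/
def baseChangeSnd : baseChange p A ⟶ Spec (.of A) :=
  pullback.snd p (Spec.map (CommRingCat.ofHom (algebraMap k A)))

variable (A) in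
lemma isPullback_baseChange : IsPullback (baseChangeFst p A) (baseChangeSnd p A) p
    (Spec.map (CommRingCat.ofHom (algebraMap k A))) :=
  IsPullback.of_hasPullback _ _

lemma baseChangeMap_fst (φ : A →ₐ[k] B) :
    baseChangeMap p φ ≫ baseChangeFst p A = baseChangeFst p B :=
  (pullback.lift_fst _ _ _).trans (Category.comp_id _)

lemma baseChangeMap_snd (φ : A →ₐ[k] B) :
    baseChangeMap p φ ≫ baseChangeSnd p A =
      baseChangeSnd p B ≫ Spec.map (CommRingCat.ofHom φ.toRingHom) :=
  pullback.lift_snd _ _ _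

/-- The affine chart of `X ⊗ A` that is given by an affine chart of `X`. -/
def baseChangeChart (A : Type u) [CommRing A] [Algebra k A] {S : CommRingCat.{u}} (s : .of k ⟶ S)
    (c : Spec S ⟶ X) (h : c ≫ p = Spec.map s) :
    Spec (pushout s (CommRingCat.ofHom (algebraMap k A))) ⟶ baseChange p A :=
  (isPullback_baseChange p A).lift (Spec.map (pushout.inl _ _) ≫ c) (Spec.map (pushout.inr _ _)) (by
    rw [Category.assoc, h, ← Spec.map_comp, ← Spec.map_comp, pushout.condition])

variable {S : CommRingCat.{u}} (s : .of k ⟶ S) (c : Spec S ⟶ X) (h : c ≫ p = Spec.map s)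

lemma baseChangeChart_fst : baseChangeChart p A s c h ≫ baseChangeFst p A =
    Spec.map (pushout.inl s (CommRingCat.ofHom (algebraMap k A))) ≫ c :=
  (isPullback_baseChange p A).lift_fst _ _ _

lemma baseChangeChart_snd : baseChangeChart p A s c h ≫ baseChangeSnd p A =
    Spec.map (pushout.inr s (CommRingCat.ofHom (algebraMap k A))) :=
  (isPullback_baseChange p A).lift_snd _ _ _

lemma isPullback_baseChangeChart : IsPullback (baseChangeChart p A s c h)
    (Spec.map (pushout.inl s (CommRingCat.ofHom (algebraMap k A)))) (baseChangeFst p A) c := by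
  refine IsPullback.of_right (h₁₂ := baseChangeSnd p A) (h₂₂ := p)
    (v₁₃ := Spec.map (CommRingCat.ofHom (algebraMap k A))) ?_ (baseChangeChart_fst p s c h)
    (isPullback_baseChange p A).flip
  rw [h, baseChangeChart_snd]
  exact (isPullback_SpecMap_pushout _ _).flip

instance [IsOpenImmersion c] : IsOpenImmersion (baseChangeChart p A s c h) :=
  MorphismProperty.of_isPullback (isPullback_baseChangeChart p s c h).flip inferInstance

lemma mem_opensRange_baseChangeChart [IsOpenImmersion c] (x : baseChange p A)
    (hx : baseChangeFst p A x ∈ c.opensRange) : x ∈ (baseChangeChart p A s c h).opensRange := by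
  obtain ⟨y, hy⟩ := hx
  obtain ⟨z, hz, -⟩ := Scheme.Pullback.exists_preimage_pullback x y hy.symm
  refine ⟨(isPullback_baseChangeChart (A := A) p s c h).isoPullback.inv z, ?_⟩
  have := (isPullback_baseChangeChart (A := A) p s c h).isoPullback_inv_fst
  rw [← hz, ← this]
  rfl

/-- The homomorphism of coordinate rings of charts that is induced by `A ⟶ B`. -/
def pushoutMap (φ : A →ₐ[k] B) : pushout s (CommRingCat.ofHom (algebraMap k A)) ⟶
    pushout s (CommRingCat.ofHom (algebraMap k B)) :=
  pushout.desc (pushout.inl _ _) (CommRingCat.ofHom φ.toRingHom ≫ pushout.inr _ _) (by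
    rw [pushout.condition, ← Category.assoc, ← CommRingCat.ofHom_comp]
    congr 3
    exact φ.comp_algebraMap.symm)

/-- By pasting of pushouts, `S ⊗_k B` is the base change of `S ⊗_k A` along `A ⟶ B`. Thus pullback
on a chart is base change over the ring with respect to which flatness is measured. -/
lemma isPushout_pushoutMap (φ : A →ₐ[k] B) : IsPushout (CommRingCat.ofHom φ.toRingHom)
    (pushout.inr s _) (pushout.inr s _) (pushoutMap s φ) := by
  have h : CommRingCat.ofHom (algebraMap k A) ≫ CommRingCat.ofHom φ.toRingHom =
      CommRingCat.ofHom (algebraMap k B) := by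
    rw [← CommRingCat.ofHom_comp]
    congr 1
    exact φ.comp_algebraMap
  refine IsPushout.of_left (h₁₁ := CommRingCat.ofHom (algebraMap k A)) (v₁₁ := s)
    (h₂₁ := pushout.inl _ _) ?_ ?_ (IsPushout.of_hasPushout _ _).flip
  · rw [h, pushoutMap, pushout.inl_desc]
    exact (IsPushout.of_hasPushout _ _).flip
  · exact (pushout.inr_desc _ _ _).symm

lemma baseChangeChart_comp_baseChangeMap (φ : A →ₐ[k] B) :
    baseChangeChart p B s c h ≫ baseChangeMap p φ =
      Spec.map (pushoutMap s φ) ≫ baseChangeChart p A s c h := by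
  refine (isPullback_baseChange p A).hom_ext ?_ ?_
  · rw [Category.assoc, Category.assoc, baseChangeMap_fst, baseChangeChart_fst,
      baseChangeChart_fst, ← Spec.map_comp_assoc, pushoutMap, pushout.inl_desc]
  · rw [Category.assoc, Category.assoc, baseChangeMap_snd, baseChangeChart_snd,
      ← Category.assoc, baseChangeChart_snd, ← Spec.map_comp, ← Spec.map_comp, pushoutMap,
      pushout.inr_desc]

/-- A coherent sheaf on `X ⊗ A` is flat over `A` if its modules of sections on the charts
that are given by affine charts of `X` are flat. -/
def IsFlatOver (A : Type u) [CommRing A] [Algebra k A] : ObjectProperty (Coh (baseChange p A)) :=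
  fun E => ∀ (S : CommRingCat.{u}) (s : .of k ⟶ S) (c : Spec S ⟶ X) [IsOpenImmersion c]
    (h : c ≫ p = Spec.map s), ModuleCat.IsFlatOver
      (pushout.inr s (CommRingCat.ofHom (algebraMap k A)))
      ((chartSections (baseChangeChart p A s c h)).obj E)

/-- The charts that are given by affine open subsets. -/
lemma exists_baseChangeChart_cover : ∃ (I : Type u) (S : I → CommRingCat.{u})
    (s : ∀ i, .of k ⟶ S i) (c : ∀ i, Spec (S i) ⟶ X) (_ : ∀ i, IsOpenImmersion (c i))
    (h : ∀ i, c i ≫ p = Spec.map (s i)),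
    ∀ (A : Type u) [CommRing A] [Algebra k A] (x : baseChange p A),
      ∃ i, x ∈ (baseChangeChart p A (s i) (c i) (h i)).opensRange := by
  refine ⟨{U : X.Opens // IsAffineOpen U}, fun U => Γ(X, U.1),
    fun U => Spec.preimage (U.2.fromSpec ≫ p), fun U => U.2.fromSpec, fun U => inferInstance,
    fun U => (Spec.map_preimage _).symm, fun A _ _ x => ?_⟩
  obtain ⟨U, hU⟩ := fromSpec_cover X (baseChangeFst p A x)
  exact ⟨U, mem_opensRange_baseChangeChart p _ _ _ x hU⟩

end

section

variable {k : Type u} [Field k] {X : Scheme.{u}} (p : X ⟶ Spec (.of k)) [LocallyOfFiniteType p]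
  {A B : Type u} [CommRing A] [Algebra k A] [IsNoetherianRing A] [CommRing B] [Algebra k B]
  [IsNoetherianRing B]

/-- On each chart of `X` the pullback is base change along `A ⟶ B`, which keeps a monomorphism
injective when its cokernel is flat over `A`. -/
lemma mono_cohPullback_map (φ : A →ₐ[k] B) {T : ShortComplex (Coh (baseChange p A))}
    (hT : T.ShortExact) (h₃ : IsFlatOver p A T.X₃) :
    Mono ((cohPullback (baseChangeMap p φ)).map T.f) := by
  obtain ⟨I, S, s, c, hc, h, hcov⟩ := exists_baseChangeChart_cover p
  refine mono_of_chartSections (fun i => baseChangeChart p B (s i) (c i) (h i)) (hcov B) _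
    fun i => ?_
  let e := cohPullbackCompChartSectionsIso (baseChangeMap p φ) (pushoutMap (s i) φ)
    (baseChangeChart p A (s i) (c i) (h i)) (baseChangeChart p B (s i) (c i) (h i))
    (baseChangeChart_comp_baseChangeMap p _ _ _ φ)
  have := ModuleCat.mono_extendScalars_map (isPushout_pushoutMap (s i) φ)
    (shortExact_map_chartSections (baseChangeChart p A (s i) (c i) (h i)) hT)
    (h₃ (S i) (s i) (c i) (h i))
  exact ((MorphismProperty.monomorphisms _).arrow_mk_iso_iff
    (((Functor.mapArrowFunctor _ _).mapIso e).app (Arrow.mk T.f))).2 this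

omit [LocallyOfFiniteType p] [IsNoetherianRing A] in
-- On a chart this is the base change to `A` of a module over the field `k`, where every module is
-- flat.
lemma isFlatOver_cohPullback_fst [IsLocallyNoetherian X] (G : Coh X) :
    IsFlatOver p A ((cohPullback (baseChangeFst p A)).obj G) := by
  intro S s c _ h
  refine .of_iso ((cohPullbackCompChartSectionsIso _ _ c _
    (baseChangeChart_fst p s c h)).symm.app G) ?_
  refine ModuleCat.isFlatOver_extendScalars (IsPushout.of_hasPushout s _).flip ?_
  exact (inferInstanceAs (Module.Flat k _))

/-- The inverse image is a left adjoint, so only the left end of the sequence is in doubt. -/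
lemma exact_cohPullback_map {X Y : Scheme.{u}} [IsLocallyNoetherian X] [IsLocallyNoetherian Y]
    (f : X ⟶ Y) [IsClosedImmersion f] {T : ShortComplex (Coh Y)} (hT : T.ShortExact)
    (h : Mono ((cohPullback f).map T.f)) : (T.map (cohPullback f)).ShortExact := by
  have := (cohPullbackPushforwardAdjunction f).leftAdjoint_preservesColimits
  have := hT.epi_g
  have : Epi ((cohPullback f).map T.g) := inferInstance
  exact { exact := hT.exact.map_of_epi_of_preservesCokernel _ inferInstance inferInstance
          mono_f := h
          epi_g := this }

omit [LocallyOfFiniteType p] [IsNoetherianRing A] in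
lemma isFlatOver_of_isZero {E : Coh (baseChange p A)} (hE : IsZero E) : IsFlatOver p A E :=
  fun _ _ _ _ _ => ModuleCat.isFlatOver_of_isZero ((chartSections _).map_isZero hE)

lemma isFlatOver_biprod {E F : Coh (baseChange p A)} (hE : IsFlatOver p A E)
    (hF : IsFlatOver p A F) : IsFlatOver p A (E ⊞ F) := fun S s c _ hc =>
  have : PreservesBinaryBiproducts (chartSections (baseChangeChart p A s c hc)) :=
    preservesBinaryBiproducts_of_preservesBinaryProducts _
  .of_iso ((chartSections (baseChangeChart p A s c hc)).mapBiprod E F).symm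
    ((hE S s c hc).biprod (hF S s c hc))

/-- Surjectivity of `φ` makes the base change map a closed immersion, hence provides the adjunction
on coherent sheaves and right exactness; flatness of the quotient provides left exactness. -/
lemma isAdaptedTo_isFlatOver (φ : A →ₐ[k] B) (hφ : Function.Surjective φ)
    (hs : ∀ E : Coh (baseChange p A), ∃ (P : Coh (baseChange p A)) (_ : IsFlatOver p A P)
      (f : P ⟶ E), Epi f) :
    (IsFlatOver p A).IsAdaptedTo (cohPullback (baseChangeMap p φ)) where
  of_iso e h := fun S s c _ hc => .of_iso ((chartSections _).mapIso e) (h S s c hc)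
  of_isZero := isFlatOver_of_isZero p
  biprod := isFlatOver_biprod p
  exists_epi := hs
  kernel hT h₂ h₃ := fun S s c _ hc =>
    .of_shortExact (shortExact_map_chartSections _ hT) (h₂ S s c hc) (h₃ S s c hc)
  exact hT _ _ h₃ := by
    have := isClosedImmersion_baseChangeMap p φ hφ
    exact exact_cohPullback_map _ hT (mono_cohPullback_map p φ hT h₃)

end

end AlgebraicGeometry.Scheme

/-! ### Supports of dimension at most one -/

lemma topologicalKrullDim_le_one_iff_of_isClosed {X : Type*} [TopologicalSpace X] {Z : Set X}
    (hZ : IsClosed Z) : topologicalKrullDim Z ≤ 1 ↔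
      ∀ C₀ C₁ C₂ : IrreducibleCloseds X, C₀ < C₁ → C₁ < C₂ → ¬ (C₂ : Set X) ⊆ Z := by
  -- Dimension at most one means that there are no strict chains of three irreducible closed
  -- subsets. Chains in `Z` and chains in `X` inside `Z` correspond by closure and preimage.
  have key : topologicalKrullDim Z ≤ 1 ↔
      ∀ C₀ C₁ C₂ : IrreducibleCloseds Z, C₀ < C₁ → C₁ < C₂ → False := by
    rw [topologicalKrullDim, Order.krullDim_le_one_iff]
    simp_rw [isMin_iff_forall_not_lt, isMax_iff_forall_not_lt]
    constructor
    · intro h C₀ C₁ C₂ h₁ h₂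
      rcases h C₁ with h | h
      exacts [h _ h₁, h _ h₂]
    · intro h C
      by_contra! hC
      obtain ⟨⟨C₀, h₀⟩, C₂, h₂⟩ := hC
      exact h C₀ C C₂ h₀ h₂
  rw [key]
  constructor
  · intro h C₀ C₁ C₂ h₁ h₂ hC
    have e (C : IrreducibleCloseds X) (hCZ : (C : Set X) ⊆ Z) :
        ∃ D : IrreducibleCloseds Z, (D : Set Z) = Subtype.val ⁻¹' (C : Set X) := by
      refine ⟨⟨Subtype.val ⁻¹' (C : Set X), ?_, C.isClosed.preimage continuous_subtype_val⟩, rfl⟩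
      obtain ⟨⟨x, hx⟩, hp⟩ := C.isIrreducible
      refine ⟨⟨⟨x, hCZ hx⟩, hx⟩, ?_⟩
      rintro u v hu hv ⟨a, ha, hau⟩ ⟨b, hb, hbv⟩
      obtain ⟨u, hu', rfl⟩ := isOpen_induced_iff.1 hu
      obtain ⟨v, hv', rfl⟩ := isOpen_induced_iff.1 hv
      obtain ⟨z, hz, hzu, hzv⟩ := hp u v hu' hv' ⟨a.1, ha, hau⟩ ⟨b.1, hb, hbv⟩
      exact ⟨⟨z, hCZ hz⟩, hz, hzu, hzv⟩
    have h1 : (C₁ : Set X) ⊆ Z := fun x hx => hC (h₂.le hx)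
    have h0 : (C₀ : Set X) ⊆ Z := fun x hx => h1 (h₁.le hx)
    obtain ⟨D₀, hD₀⟩ := e C₀ h0
    obtain ⟨D₁, hD₁⟩ := e C₁ h1
    obtain ⟨D₂, hD₂⟩ := e C₂ hC
    have lt {C C' : IrreducibleCloseds X} (hlt : C < C') (hC' : (C' : Set X) ⊆ Z)
        {D D' : IrreducibleCloseds Z} (hD : (D : Set Z) = Subtype.val ⁻¹' (C : Set X))
        (hD' : (D' : Set Z) = Subtype.val ⁻¹' (C' : Set X)) : D < D' := by
      rw [← SetLike.coe_ssubset_coe, hD, hD']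
      obtain ⟨hs, x, hx, hx'⟩ := Set.ssubset_iff_exists.1 (SetLike.coe_ssubset_coe.2 hlt)
      exact Set.ssubset_iff_exists.2 ⟨Set.preimage_mono hs, ⟨x, hC' hx⟩, hx, hx'⟩
    exact h D₀ D₁ D₂ (lt h₁ h1 hD₀ hD₁) (lt h₂ hC hD₁ hD₂)
  · intro h C₀ C₁ C₂ h₁ h₂
    have hi : Topology.IsInducing (Subtype.val : Z → X) := .subtypeVal
    refine h _ _ _ (IrreducibleCloseds.map_strictMono_of_isInducing hi h₁)
      (IrreducibleCloseds.map_strictMono_of_isInducing hi h₂) ?_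
    rw [IrreducibleCloseds.coe_map]
    exact closure_minimal (by rintro _ ⟨x, -, rfl⟩; exact x.2) hZ

/-- The largest member of a chain in `Z ∪ Z'` is irreducible, so it lies in one of the two closed
sets, and the chain with it. -/
lemma topologicalKrullDim_union_le_one {X : Type*} [TopologicalSpace X] {Z Z' : Set X}
    (hZ : IsClosed Z) (hZ' : IsClosed Z') (h : topologicalKrullDim Z ≤ 1)
    (h' : topologicalKrullDim Z' ≤ 1) : topologicalKrullDim ↑(Z ∪ Z') ≤ 1 := by
  rw [topologicalKrullDim_le_one_iff_of_isClosed (hZ.union hZ')]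
  intro C₀ C₁ C₂ h₁ h₂ hC
  rcases isPreirreducible_iff_isClosed_union_isClosed.1 C₂.isIrreducible.2 _ _ hZ hZ' hC with hC | hC
  · exact (topologicalKrullDim_le_one_iff_of_isClosed hZ).1 h C₀ C₁ C₂ h₁ h₂ hC
  · exact (topologicalKrullDim_le_one_iff_of_isClosed hZ').1 h' C₀ C₁ C₂ h₁ h₂ hC

lemma topologicalKrullDim_le_one_of_subset {X : Type*} [TopologicalSpace X] {Z Z' : Set X}
    (h : Z ⊆ Z') (h' : topologicalKrullDim Z' ≤ 1) : topologicalKrullDim Z ≤ 1 :=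
  (Topology.IsEmbedding.inclusion h).isInducing.topologicalKrullDim_le.trans h'

namespace AlgebraicGeometry.Scheme

open Modules

variable {Y : Scheme.{u}}

lemma Modules.isZero_stalk {M : Y.Modules} {U : Y.Opens}
    (h : ∀ W ≤ U, Subsingleton Γ(M, W)) {y : Y} (hy : y ∈ U) : IsZero (M.presheaf.stalk y) := by
  have : Subsingleton (M.presheaf.stalk y) := by
    refine subsingleton_of_forall_eq 0 fun t => ?_
    obtain ⟨W, hW, hyW, s, rfl⟩ := M.presheaf.exists_le_germ_eq t hy
    have := h W hW
    rw [show s = 0 from Subsingleton.elim _ _, map_zero]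
  exact AddCommGrpCat.isZero_of_subsingleton _

lemma subsingleton_of_le {E : Coh Y} {U : Y.Opens} (hU : IsAffineOpen U)
    (h : Subsingleton Γ(E.obj, U)) {W : Y.Opens} (hW : W ≤ U) : Subsingleton Γ(E.obj, W) := by
  refine subsingleton_of_isZero_chartSections hU.fromSpec
    (isZero_chartSections_of_subsingleton hU.fromSpec ?_) W ?_
  · rwa [hU.opensRange_fromSpec]
  · rwa [hU.opensRange_fromSpec]

lemma Modules.eventually_res_eq_zero {M : Y.Modules} {U : Y.Opens} {y : Y} (hy : y ∈ U)
    (h : IsZero (M.presheaf.stalk y)) (t : Γ(M, U)) :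
    ∃ (W : Y.Opens) (hW : W ≤ U), y ∈ W ∧ M.presheaf.map (homOfLE hW).op t = 0 := by
  have : Subsingleton (M.presheaf.stalk y) := AddCommGrpCat.subsingleton_of_isZero h
  obtain ⟨W, hyW, i, j, hij⟩ := M.presheaf.germ_eq y hy hy t 0 (Subsingleton.elim _ _)
  exact ⟨W, i.le, hyW, hij.trans (map_zero _)⟩

lemma Modules.res_eq_zero {M : Y.Modules} {U V W : Y.Opens} (hV : V ≤ U) (hW : W ≤ V) (t : Γ(M, U))
    (ht : M.presheaf.map (homOfLE hV).op t = 0) :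
    M.presheaf.map (homOfLE (hW.trans hV)).op t = 0 := by
  have : M.presheaf.map (homOfLE (hW.trans hV)).op t =
      M.presheaf.map (homOfLE hW).op (M.presheaf.map (homOfLE hV).op t) := by
    rw [← ConcreteCategory.comp_apply, ← Functor.map_comp]
    rfl
  rw [this, ht, map_zero]

/-- If the stalk vanishes, finitely many generators over an affine neighbourhood vanish together on
some basic open set, and sections there are fractions of sections that already vanish. This makes
the support closed and testable on affine open subsets. -/
lemma notMem_supp_iff (E : Coh Y) (y : Y) : y ∉ Modules.supp E.obj ↔
    ∃ U : Y.Opens, IsAffineOpen U ∧ y ∈ U ∧ Subsingleton Γ(E.obj, U) := by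
  constructor
  · intro hy
    have hy : IsZero (E.obj.presheaf.stalk y) := not_not.1 hy
    obtain ⟨U, hU, hyU, -⟩ := exists_isAffineOpen_mem_and_subset (X := Y) (x := y) (U := ⊤) trivial
    have := E.2.2 U hU
    obtain ⟨s, hs⟩ := Module.Finite.fg_top (R := Γ(Y, U)) (M := Γ(E.obj, U))
    have h1 : ∀ s : Finset Γ(E.obj, U), ∃ (W : Y.Opens) (hW : W ≤ U), y ∈ W ∧
        ∀ t ∈ s, E.obj.presheaf.map (homOfLE hW).op t = 0 := by
      intro s
      induction s using Finset.cons_induction with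
      | empty => exact ⟨U, le_rfl, hyU, by simp⟩
      | cons a s ha ih =>
        obtain ⟨W, hW, hyW, h⟩ := ih
        obtain ⟨W', hW', hyW', h'⟩ := Modules.eventually_res_eq_zero hyU hy a
        refine ⟨W ⊓ W', inf_le_left.trans hW, ⟨hyW, hyW'⟩, fun t ht => ?_⟩
        rcases Finset.mem_cons.1 ht with rfl | ht
        · exact Modules.res_eq_zero hW' inf_le_right t h'
        · exact Modules.res_eq_zero hW inf_le_left t (h t ht)
    obtain ⟨W, hW, hyW, h⟩ := h1 s
    obtain ⟨f, hf, hyf⟩ := hU.exists_basicOpen_le ⟨y, hyW⟩ hyU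
    refine ⟨Y.basicOpen f, hU.basicOpen f, hyf, ?_⟩
    have h2 : ∀ t : Γ(E.obj, U), E.obj.presheaf.map (homOfLE (Y.basicOpen_le f)).op t = 0 := by
      intro t
      have ht : t ∈ Submodule.span Γ(Y, U) (s : Set Γ(E.obj, U)) := hs ▸ Submodule.mem_top
      induction ht using Submodule.span_induction with
      | mem x hx => exact Modules.res_eq_zero hW hf x (h x hx)
      | zero => exact map_zero _
      | add x y _ _ hx hy => rw [map_add, hx, hy, add_zero]
      | smul a x _ hx => rw [Modules.map_smul, hx, smul_zero]
    refine subsingleton_of_forall_eq 0 fun x => ?_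
    obtain ⟨n, t, ht⟩ := (E.2.isLocalizingOn hU).exists_lift f x
    have hu : IsUnit (Y.presheaf.map (homOfLE (Y.basicOpen_le f)).op (f ^ n)) := by
      rw [map_pow]
      exact (RingedSpace.isUnit_res_basicOpen _ f).pow n
    rw [h2] at ht
    exact (hu.smul_eq_zero).1 ht.symm
  · rintro ⟨U, hU, hy, h⟩ hs
    exact hs (Modules.isZero_stalk (fun W hW => subsingleton_of_le hU h hW) hy)

lemma isClosed_supp (E : Coh Y) : IsClosed (Modules.supp E.obj) := by
  rw [← isOpen_compl_iff, isOpen_iff_forall_mem_open]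
  intro y hy
  obtain ⟨U, hU, hyU, h⟩ := (notMem_supp_iff E y).1 hy
  exact ⟨U, fun z hz => (notMem_supp_iff E z).2 ⟨U, hU, hz, h⟩, U.2, hyU⟩

variable [IsLocallyNoetherian Y]

lemma supp_subset_of_mono {E F : Coh Y} (φ : E ⟶ F) [Mono φ] :
    Modules.supp E.obj ⊆ Modules.supp F.obj := by
  intro y
  contrapose
  simp only [notMem_supp_iff]
  rintro ⟨U, hU, hy, h⟩
  exact ⟨U, hU, hy, (coh_app_injective φ U).subsingleton⟩

omit [IsLocallyNoetherian Y] in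
lemma supp_subset_of_epi {E F : Coh Y} (φ : E ⟶ F) [Epi φ] :
    Modules.supp F.obj ⊆ Modules.supp E.obj := by
  intro y
  contrapose
  simp only [notMem_supp_iff]
  rintro ⟨U, hU, hy, h⟩
  exact ⟨U, hU, hy, ((epi_coh_iff φ).1 inferInstance U hU).subsingleton⟩

lemma supp_subset_of_shortExact {T : ShortComplex (Coh Y)} (hT : T.ShortExact) :
    Modules.supp T.X₂.obj ⊆ Modules.supp T.X₁.obj ∪ Modules.supp T.X₃.obj := by
  intro y
  contrapose
  rw [Set.mem_union, not_or, notMem_supp_iff, notMem_supp_iff, notMem_supp_iff]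
  rintro ⟨⟨U, hU, hyU, h⟩, V, hV, hyV, h'⟩
  obtain ⟨W, hW, hyW, hle⟩ :=
    exists_isAffineOpen_mem_and_subset (X := Y) (x := y) (U := U ⊓ V) ⟨hyU, hyV⟩
  have h1 : Subsingleton Γ(T.X₁.obj, W) := subsingleton_of_le hU h (le_trans hle inf_le_left)
  have h3 : Subsingleton Γ(T.X₃.obj, W) := subsingleton_of_le hV h' (le_trans hle inf_le_right)
  refine ⟨W, hW, hyW, subsingleton_of_forall_eq 0 fun x => ?_⟩
  obtain ⟨x, rfl⟩ := (coh_app_exact hT W x).1 (Subsingleton.elim _ _)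
  rw [Subsingleton.elim x 0, map_zero]

lemma isSerre_cohLEOne : IsSerre (cohLEOne Y) where
  of_isZero {E} hE := by
    have : Modules.supp E.obj = ∅ := by
      rw [Set.eq_empty_iff_forall_notMem]
      intro y hy
      obtain ⟨U, hU, hyU, -⟩ := exists_isAffineOpen_mem_and_subset (X := Y) (x := y) (U := ⊤) trivial
      have h0 := (sections _ U).map_isZero ((IsCoherent Y).ι.map_isZero hE)
      exact (notMem_supp_iff E y).2 ⟨U, hU, hyU, AddCommGrpCat.subsingleton_of_isZero h0⟩ hy
    unfold cohLEOne
    rw [this, topologicalKrullDim_le_one_iff_of_isClosed isClosed_empty]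
    intro C₀ C₁ C₂ _ _ hC
    obtain ⟨x, hx⟩ := C₂.isIrreducible.nonempty
    exact hC hx
  of_mono f _ hF := topologicalKrullDim_le_one_of_subset (supp_subset_of_mono f) hF
  of_epi f _ hE := topologicalKrullDim_le_one_of_subset (supp_subset_of_epi f) hE
  of_shortExact hT h₁ h₃ := topologicalKrullDim_le_one_of_subset (supp_subset_of_shortExact hT)
    (topologicalKrullDim_union_le_one (isClosed_supp _) (isClosed_supp _) h₁ h₃)

end AlgebraicGeometry.Scheme

/-! ### Kernels of inverse images, and noetherian objects -/

namespace AlgebraicGeometry.Scheme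

open Modules

variable {X Y : Scheme.{u}} [IsLocallyNoetherian X] [IsLocallyNoetherian Y]

omit [IsLocallyNoetherian X] [IsLocallyNoetherian Y] in
lemma exists_affine_preimage_le (f : X ⟶ Y) [IsClosedImmersion f] {U : X.Opens} {x : X}
    (hx : x ∈ U) : ∃ W : Y.Opens, IsAffineOpen W ∧ f x ∈ W ∧ f ⁻¹ᵁ W ≤ U := by
  obtain ⟨V, hV, hVU⟩ := (f.isClosedEmbedding.isInducing.isOpen_iff).1 U.2
  have hxV : f x ∈ (⟨V, hV⟩ : Y.Opens) := by
    have : x ∈ f ⁻¹' V := hVU ▸ hx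
    exact this
  obtain ⟨W, hW, hxW, hWV⟩ := exists_isAffineOpen_mem_and_subset hxV
  refine ⟨W, hW, hxW, fun z hz => ?_⟩
  have : z ∈ f ⁻¹' V := hWV hz
  rw [hVU] at this
  exact this

/-- If `P ⟶ f_* Q` is an epimorphism with kernel `K`, then `f^* K ⟶ f^* P` is an isomorphism
away from the support of `Q`. -/
lemma supp_kernel_cohPullback_map_subset (f : X ⟶ Y) [IsClosedImmersion f] {P : Coh Y} {Q : Coh X}
    (r : P ⟶ (cohPushforward f).obj Q) [Epi r] :
    Modules.supp (Limits.kernel ((cohPullback f).map (kernel.ι r))).obj ⊆ Modules.supp Q.obj := by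
  intro x
  contrapose
  rw [notMem_supp_iff, notMem_supp_iff]
  rintro ⟨U, hU, hxU, h⟩
  obtain ⟨W, hW, hxW, hWU⟩ := exists_affine_preimage_le f hxU
  -- Over `W` the target of `r` vanishes, so the inclusion of `kernel r` in `P` is an isomorphism
  -- there, and it remains one after extension of scalars.
  have h0 : IsZero ((chartSections hW.fromSpec).obj ((cohPushforward f).obj Q)) := by
    refine isZero_chartSections_of_subsingleton _ ?_
    rw [hW.opensRange_fromSpec]
    exact subsingleton_of_le hU h hWU
  let T := ShortComplex.mk (kernel.ι r) r (kernel.condition r)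
  have hT : T.ShortExact := { exact := T.exact_of_f_is_kernel (kernelIsKernel r) }
  have hT' := shortExact_map_chartSections hW.fromSpec hT
  have h1 : Mono ((chartSections hW.fromSpec).map (kernel.ι r)) := hT'.mono_f
  have h2 : Epi ((chartSections hW.fromSpec).map (kernel.ι r)) :=
    hT'.exact.epi_f (h0.eq_of_tgt _ _)
  have h3 : IsIso ((chartSections hW.fromSpec).map (kernel.ι r)) := isIso_of_mono_of_epi _
  let e := cohPullbackCompChartSectionsIso f (f.app W) hW.fromSpec (hW.preimage f).fromSpec
    (fromSpec_preimage_comm f hW)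
  have h4 : IsIso ((chartSections (hW.preimage f).fromSpec).map
      ((cohPullback f).map (kernel.ι r))) :=
    (NatIso.isIso_map_iff e (kernel.ι r)).2 (inferInstanceAs (IsIso
      ((ModuleCat.extendScalars (f.app W).hom).map ((chartSections hW.fromSpec).map (kernel.ι r)))))
  have h5 : IsZero ((chartSections (hW.preimage f).fromSpec).obj
      (Limits.kernel ((cohPullback f).map (kernel.ι r)))) :=
    (isZero_kernel_of_mono _).of_iso (PreservesKernel.iso (chartSections (hW.preimage f).fromSpec) _)
  refine ⟨f ⁻¹ᵁ W, hW.preimage f, hxW, subsingleton_of_isZero_chartSections _ h5 _ ?_⟩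
  rw [(hW.preimage f).opensRange_fromSpec]

lemma cohLEOne_kernel_cohPullback_map (f : X ⟶ Y) [IsClosedImmersion f] {P : Coh Y} {Q : Coh X}
    (hQ : cohLEOne X Q) (r : P ⟶ (cohPushforward f).obj Q) [Epi r] :
    cohLEOne X (Limits.kernel ((cohPullback f).map (kernel.ι r))) :=
  topologicalKrullDim_le_one_of_subset (supp_kernel_cohPullback_map_subset f r) hQ

omit [IsLocallyNoetherian X] [IsLocallyNoetherian Y] in
lemma exists_finite_affine_cover (Y : Scheme.{u}) [CompactSpace Y] :
    ∃ s : Finset {U : Y.Opens // IsAffineOpen U}, ∀ y, ∃ U ∈ s, y ∈ U.1 := by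
  have h (y : Y) : ∃ U : {U : Y.Opens // IsAffineOpen U}, y ∈ U.1 := by
    obtain ⟨U, hU, hy, -⟩ := exists_isAffineOpen_mem_and_subset (X := Y) (x := y) (U := ⊤) trivial
    exact ⟨⟨U, hU⟩, hy⟩
  choose U hU using h
  obtain ⟨s, hs⟩ := CompactSpace.elim_nhds_subcover (fun y : Y => ((U y).1 : Set Y))
    (fun y => (U y).1.isOpen.mem_nhds (hU y))
  classical
  refine ⟨s.image U, fun y => ?_⟩
  have : y ∈ ⋃ x ∈ s, ((U x).1 : Set Y) := by rw [hs]; trivial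
  obtain ⟨x, hx, hy⟩ := Set.mem_iUnion₂.1 this
  exact ⟨_, Finset.mem_image_of_mem _ hx, hy⟩

omit [IsLocallyNoetherian X] in
-- A subobject is determined among those containing it by its submodules of sections on finitely
-- many affine charts. These are submodules of finite modules over noetherian rings, so all of them
-- become stationary together along a chain.
lemma isNoetherianObject_coh [CompactSpace Y] (E : Coh Y) : IsNoetherianObject E := by
  obtain ⟨s, hs⟩ := exists_finite_affine_cover Y
  let R (U : s) : CommRingCat.{u} := Γ(Y, U.1.1)
  let c (U : s) : Spec (R U) ⟶ Y := U.1.2.fromSpec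
  have hc (y : Y) : ∃ U : s, y ∈ (c U).opensRange := by
    obtain ⟨U, hU, hy⟩ := hs y
    exact ⟨⟨U, hU⟩, by rwa [U.2.opensRange_fromSpec]⟩
  let Φ (Z : Subobject E) (U : s) : Submodule (R U) ((chartSections (c U)).obj E) :=
    LinearMap.range ((chartSections (c U)).map Z.arrow).hom
  have hN (U : s) : _root_.IsNoetherian (R U) ((chartSections (c U)).obj E) :=
    have : IsNoetherianRing (R U) := IsLocallyNoetherian.component_noetherian U.1
    have := finite_chartSections (c U) E
    isNoetherian_of_isNoetherianRing_of_finite _ _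
  have hcomp {Z Z' : Subobject E} (h : Z ≤ Z') (U : s) (x) :
      (chartSections (c U)).map Z'.arrow ((chartSections (c U)).map (Z.ofLE Z' h) x) =
        (chartSections (c U)).map Z.arrow x := by
    rw [← ConcreteCategory.comp_apply, ← Functor.map_comp, Subobject.ofLE_arrow]
  have hmono : Monotone Φ := by
    rintro Z Z' h U _ ⟨x, rfl⟩
    exact ⟨_, hcomp h U x⟩
  have hle {Z Z' : Subobject E} (h : Z ≤ Z') (hΦ : Φ Z = Φ Z') : Z' ≤ Z := by
    have : Epi (Z.ofLE Z' h) := by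
      refine epi_of_chartSections c hc _ fun U => ?_
      rw [ModuleCat.epi_iff_surjective]
      intro y
      have hy : (chartSections (c U)).map Z'.arrow y ∈ Φ Z U := hΦ ▸ ⟨y, rfl⟩
      obtain ⟨x, hx⟩ := hy
      exact ⟨x, (ModuleCat.mono_iff_injective ((chartSections (c U)).map Z'.arrow)).1 inferInstance
        ((hcomp h U x).trans hx)⟩
    have := isIso_of_mono_of_epi (Z.ofLE Z' h)
    exact Subobject.le_of_comm (CategoryTheory.inv (Z.ofLE Z' h)) (by simp)
  rw [isNoetherianObject_iff_not_strictMono]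
  intro f hf
  have h1 (U : s) : ∃ n, ∀ m, n ≤ m → Φ (f n) U = Φ (f m) U :=
    WellFoundedGT.monotone_chain_condition ⟨fun n => Φ (f n) U, fun m n h => hmono (hf.monotone h) U⟩
  choose n hn using h1
  let N := Finset.univ.sup n
  have h2 : Φ (f N) = Φ (f (N + 1)) := by
    ext1 U
    have hU : n U ≤ N := Finset.le_sup (Finset.mem_univ U)
    rw [← hn U N hU, hn U (N + 1) (by omega)]
  exact (hf (Nat.lt_succ_self N)).not_ge (hle (hf.monotone (Nat.le_succ N)) h2)

end AlgebraicGeometry.Scheme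

/-! ### Coherent subsheaves of quasi-coherent sheaves -/

namespace AlgebraicGeometry.Scheme.Modules

variable {X Y : Scheme.{u}}

lemma isLocalizingOn_pushforward (f : X ⟶ Y) [IsAffineHom f] {M : X.Modules}
    {U : Y.Opens} (h : M.IsLocalizingOn (f ⁻¹ᵁ U)) :
    ((Modules.pushforward f).obj M).IsLocalizingOn U := by
  have key (s : Γ(Y, U)) (D : X.Opens) (hD : D = X.basicOpen (f.app U s)) (hDU : D ≤ f ⁻¹ᵁ U) :
     (∀ x : Γ(M, D), ∃ (n : ℕ) (t : Γ(M, f ⁻¹ᵁ U)), M.presheaf.map (homOfLE hDU).op t =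
        X.presheaf.map (homOfLE hDU).op (f.app U s ^ n) • x) ∧
     (∀ t : Γ(M, f ⁻¹ᵁ U), M.presheaf.map (homOfLE hDU).op t = 0 →
       ∃ n : ℕ, f.app U s ^ n • t = 0) := by
    subst hD
    exact ⟨h.exists_lift _, h.exists_pow_smul _⟩
  refine ⟨fun s x => ?_, fun s t ht => ?_⟩
  · obtain ⟨n, t, ht⟩ := (key s _ (Scheme.preimage_basicOpen f s)
      (f.preimage_mono (Y.basicOpen_le s))).1 x
    refine ⟨n, t, ht.trans ?_⟩
    have : (f.app (Y.basicOpen s)) (Y.presheaf.map (homOfLE (Y.basicOpen_le s)).op (s ^ n)) =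
      X.presheaf.map (homOfLE (f.preimage_mono (Y.basicOpen_le s))).op (f.app U s ^ n) := by
      rw [← map_pow]
      exact congr($(f.naturality (homOfLE (Y.basicOpen_le s)).op) (s ^ n))
    rw [← this]
    rfl
  · obtain ⟨n, hn⟩ := (key s _ (Scheme.preimage_basicOpen f s)
      (f.preimage_mono (Y.basicOpen_le s))).2 t ht
    refine ⟨n, ?_⟩
    rw [← map_pow] at hn
    exact hn

lemma map_homOfLE_comp (M : X.Modules) {U V W : X.Opens} (hV : V ≤ U) (hW : W ≤ V) (t : Γ(M, U)) :
    M.presheaf.map (homOfLE hW).op (M.presheaf.map (homOfLE hV).op t) =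
      M.presheaf.map (homOfLE (hW.trans hV)).op t := by
  rw [← ConcreteCategory.comp_apply, ← Functor.map_comp]
  rfl

lemma map_homOfLE_injective (M : X.Modules) {U V : X.Opens} (hV : V ≤ U) (h : U ≤ V) :
    Function.Injective (M.presheaf.map (homOfLE hV).op) := by
  obtain rfl := le_antisymm hV h
  intro x y hxy
  have e : (homOfLE hV).op = 𝟙 _ := rfl
  simpa [e] using hxy

lemma Hom.app_map_homOfLE {M N : X.Modules} (φ : M ⟶ N) {U V : X.Opens} (h : U ≤ V) (x : Γ(M, V)) :
    φ.app U (M.presheaf.map (homOfLE h).op x) = N.presheaf.map (homOfLE h).op (φ.app V x) :=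
  congr($(φ.mapPresheaf.naturality (homOfLE h).op) x)

/-- The sections of a quasi-coherent sheaf on a smaller affine open subset are generated by
restrictions of sections. -/
lemma mem_span_range_map {M : X.Modules} {U V : X.Opens} (hU : IsAffineOpen U) (hV : IsAffineOpen V)
    (h : V ≤ U) (hMU : M.IsLocalizingOn U) (hMV : M.IsLocalizingOn V) (s : Γ(M, V)) :
    s ∈ Submodule.span Γ(X, V) (Set.range (M.presheaf.map (homOfLE h).op)) := by
  set P := Submodule.span Γ(X, V) (Set.range (M.presheaf.map (homOfLE h).op))
  -- It suffices that the functions with a power multiplying `s` into the span generate the unit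
  -- ideal, that is, that their basic open sets cover `V`.
  let S : Set Γ(X, V) := {f | ∃ n : ℕ, f ^ n • s ∈ P}
  refine Submodule.mem_of_span_eq_top_of_smul_pow_mem P S ?_ s fun r => r.2
  rw [← hV.iSup_basicOpen_eq_self_iff]
  refine le_antisymm (iSup_le fun f => X.basicOpen_le _) fun x hx => ?_
  obtain ⟨f, hf, hxf⟩ := hU.exists_basicOpen_le ⟨x, hx⟩ (h hx)
  -- A basic open set of `U` contained in `V` is also a basic open set of `V`, so `s` can be
  -- extended over `U` there and compared on `V`.
  let f' : Γ(X, V) := X.presheaf.map (homOfLE h).op f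
  have hf' : X.basicOpen f' = X.basicOpen f := by
    refine (X.basicOpen_res f (homOfLE h).op).trans ?_
    exact inf_eq_right.2 hf
  refine Opens.mem_iSup.2 ⟨⟨f', ?_⟩, by rwa [hf']⟩
  obtain ⟨n, t, ht⟩ := hMU.exists_lift f (M.presheaf.map (homOfLE hf).op s)
  let t' : Γ(M, V) := M.presheaf.map (homOfLE h).op t
  have h0 : M.presheaf.map (homOfLE hf).op (t' - f' ^ n • s) = 0 := by
    rw [map_sub, map_smul, map_homOfLE_comp, sub_eq_zero]
    refine ht.trans ?_
    congr 1
    change _ = X.presheaf.map (homOfLE hf).op ((X.presheaf.map (homOfLE h).op f) ^ n)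
    rw [← map_pow, ← ConcreteCategory.comp_apply, ← Functor.map_comp]
    rfl
  obtain ⟨m, hm⟩ := hMV.exists_pow_smul f' (t' - f' ^ n • s) (by
    have := congrArg (M.presheaf.map (homOfLE hf'.le).op) h0
    rwa [map_homOfLE_comp, map_zero] at this)
  refine ⟨m + n, ?_⟩
  rw [smul_sub, sub_eq_zero, smul_smul, ← pow_add] at hm
  rw [← hm]
  exact Submodule.smul_mem _ _ (Submodule.subset_span ⟨t, rfl⟩)

/-- The target needs only the half about sections that vanish on `D(f)`. This allows a finite
product of quasi-coherent sheaves, for which the other half is not checked. -/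
lemma isLocalizingOn_kernel {M N K : X.Modules} (φ : M ⟶ N) (i : K ⟶ M)
    (w : i ≫ φ = 0) (hi : IsLimit (KernelFork.ofι i w)) {U : X.Opens} (hM : M.IsLocalizingOn U)
    (hN : ∀ (f : Γ(X, U)) (t : Γ(N, U)),
      N.presheaf.map (homOfLE (X.basicOpen_le f)).op t = 0 → ∃ n : ℕ, f ^ n • t = 0) :
    K.IsLocalizingOn U := by
  have : Mono i := Fork.IsLimit.mono hi
  have h0 {U : X.Opens} (y : Γ(K, U)) : φ.app U (i.app U y) = 0 :=
    congr(Modules.Hom.app $w U y)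
  refine ⟨fun f s => ?_, fun f t ht => ?_⟩
  · obtain ⟨n, t, ht⟩ := hM.exists_lift f (i.app _ s)
    obtain ⟨m, hm⟩ := hN f (φ.app _ t) (by
      rw [← Hom.app_map_homOfLE, ht, Modules.Hom.app_smul, h0, smul_zero])
    obtain ⟨y, hy⟩ := exists_app_kernel_ι φ i w hi U (f ^ m • t) (by rw [Modules.Hom.app_smul, hm])
    refine ⟨m + n, y, ?_⟩
    apply app_injective_of_mono i
    rw [Hom.app_map_homOfLE, hy, map_smul, ht, Modules.Hom.app_smul, pow_add, map_mul, mul_smul]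
  · obtain ⟨n, hn⟩ := hM.exists_pow_smul f (i.app _ t) (by
      rw [← Hom.app_map_homOfLE, ht, map_zero])
    refine ⟨n, app_injective_of_mono i U ?_⟩
    rw [Modules.Hom.app_smul, hn, map_zero]

lemma pi_section_eq_zero {I : Type u} {K : I → X.Modules} {U : X.Opens} (x : Γ(∏ᶜ K, U))
    (h : ∀ i, (Pi.π K i).app U x = 0) : x = 0 := by
  have hl := isLimitOfPreserves (sections X U) (productIsProduct K)
  refine Concrete.isLimit_ext _ hl x 0 ?_
  rintro ⟨i⟩
  exact (h i).trans (map_zero _).symm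

lemma finite_of_cover {M : X.Modules} (hM : ∀ U : X.Opens, IsAffineOpen U → M.IsLocalizingOn U)
    {I : Type*} (W : I → {U : X.Opens // IsAffineOpen U}) (hW : ∀ x, ∃ i, x ∈ (W i).1)
    (h : ∀ i, Module.Finite Γ(X, (W i).1) Γ(M, (W i).1)) (U : X.Opens) (hU : IsAffineOpen U) :
    Module.Finite Γ(X, U) Γ(M, U) := by
  refine of_affine_open_cover (P := fun U => Module.Finite Γ(X, U) Γ(M, U))
    (ι := I) W ?_ ⟨U, hU⟩ ?_ ?_ h
  · rw [eq_top_iff]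
    rintro x -
    obtain ⟨i, hi⟩ := hW x
    exact Opens.mem_iSup.2 ⟨i, hi⟩
  · intro U f hf
    exact finite_sections_basicOpen (hM U U.2) f
  · intro U s hs H
    exact finite_of_basicOpen U.2 (hM U U.2) s hs H

end AlgebraicGeometry.Scheme.Modules

lemma CategoryTheory.Adjunction.map_inv_counit_comp {C D : Type*} [Category* C] [Category* D]
    {F : C ⥤ D} {G : D ⥤ C} (adj : F ⊣ G) {M : D} [IsIso (adj.counit.app M)] {Q : C}
    (q : G.obj M ⟶ Q) : G.map (inv (adj.counit.app M) ≫ F.map q) = q ≫ adj.unit.app Q := by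
  rw [G.map_comp, Functor.map_inv, IsIso.inv_comp_eq, ← Category.assoc]
  have h1 := adj.unit.naturality q
  have h2 := adj.right_triangle_components M
  have h3 : G.map (adj.counit.app M) ≫ adj.unit.app (G.obj M) = 𝟙 _ := by
    have : IsIso (G.map (adj.counit.app M)) := inferInstance
    rw [← cancel_mono (G.map (adj.counit.app M)), Category.assoc, h2]
    simp
  rw [Category.assoc]
  have h4 : q ≫ adj.unit.app Q = adj.unit.app (G.obj M) ≫ G.map (F.map q) := h1
  rw [h4, ← Category.assoc, h3, Category.id_comp]

namespace AlgebraicGeometry.Scheme.Modules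

/-- The morphism is the sheaf associated with `q`. The unit of the tilde adjunction is invertible,
so on global sections nothing is added to the kernel of `q`. -/
lemma exists_hom_spec {R : CommRingCat.{u}} (M : (Spec R).Modules) [IsIso M.fromTildeΓ]
    {Q : ModuleCat.{u} R} (q : moduleSpecΓFunctor.obj M ⟶ Q) :
    ∃ (K : (Spec R).Modules) (ψ : M ⟶ K), IsIso K.fromTildeΓ ∧
      ∀ x : Γ(M, ⊤), ψ.app ⊤ x = 0 ↔ q x = 0 := by
  have : IsIso (tilde.adjunction.counit.app M) := ‹IsIso M.fromTildeΓ›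
  let ψ := inv (tilde.adjunction.counit.app M) ≫ (tilde.functor R).map q
  refine ⟨_, ψ, isIso_fromTildeΓ_iff.2 ⟨_, ⟨Iso.refl _⟩⟩, fun x => ?_⟩
  have h := tilde.adjunction.map_inv_counit_comp q
  let η := tilde.adjunction.unit.app Q
  have h1 : ψ.app ⊤ x = η (q x) := congr($h x)
  have h2 := ConcreteCategory.bijective_of_isIso η
  rw [h1]
  exact ⟨fun h3 => h2.1 (h3.trans (map_zero η.hom).symm),
    fun h3 => (congrArg η.hom h3).trans (map_zero η.hom)⟩

variable {X : Scheme.{u}}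

/-- With `j` the inclusion of `U`, the sheaf is `j_*` of the sheaf associated with `Γ(M, U) / N`. It
is quasi-coherent because `j` is affine, and its sections are determined by their restrictions to
`U`. -/
lemma exists_hom_of_submodule {M : X.Modules} {U : X.Opens} (hU : IsAffineOpen U)
    [IsAffineHom hU.fromSpec] (hM : M.IsLocalizingOn U) (N : Submodule Γ(X, U) Γ(M, U)) :
    ∃ (K : X.Modules) (φ : M ⟶ K), (∀ V : X.Opens, IsAffineOpen V → K.IsLocalizingOn V) ∧
      (∀ x : Γ(M, U), φ.app U x = 0 ↔ x ∈ N) ∧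
      ∀ (V : X.Opens) (y : Γ(K, V)),
        K.presheaf.map (homOfLE (inf_le_left : V ⊓ U ≤ V)).op y = 0 → y = 0 := by
  have := (IsLocalizingOn.iff_isIso_fromTildeΓ M hU).1 hM
  let e := fromSpecIso hU M ⊤ U (fromSpec_image_top hU)
  let Q : ModuleCat.{u} Γ(X, U) := ModuleCat.of _ (Γ(M, U) ⧸ N)
  have he (a : Γ(X, U)) (x : Γ(M.restrict hU.fromSpec, ⊤)) : e.hom (a • x) = a • e.hom x :=
    fromSpecIso_top_smul hU M (fromSpec_image_top hU) a x
  let l : Γ(M.restrict hU.fromSpec, ⊤) → Q := fun x => N.mkQ (e.hom x)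
  let P : ModuleCat.{u} Γ(X, U) := moduleSpecΓFunctor.obj (M.restrict hU.fromSpec)
  let l' : P →ₗ[Γ(X, U)] Q :=
    { toFun := l
      map_add' := fun x y => (congrArg N.mkQ (map_add e.hom.hom x y)).trans (map_add N.mkQ _ _)
      map_smul' := fun a x => (congrArg N.mkQ (he a x)).trans (_root_.map_smul N.mkQ _ _) }
  let q : P ⟶ Q := ConcreteCategory.ofHom (C := ModuleCat.{u} Γ(X, U)) (X := P) (Y := Q) l'
  obtain ⟨K, ψ, hK, hψ⟩ := exists_hom_spec (M.restrict hU.fromSpec) q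
  refine ⟨(Modules.pushforward hU.fromSpec).obj K,
    (restrictAdjunction hU.fromSpec).unit.app M ≫ (Modules.pushforward hU.fromSpec).map ψ,
    fun V hV => ?_, fun x => ?_, fun V y hy => ?_⟩
  · refine isLocalizingOn_pushforward _ ((isQuasicoherent_iff_isLocalizingOn K).1 ?_ _
      (hV.preimage _))
    rwa [isQuasicoherent_iff_isIso_fromTildeΓ]
  · have hle : ⊤ ≤ hU.fromSpec ⁻¹ᵁ U := hU.fromSpec_preimage_self.ge
    let z : Γ(M.restrict hU.fromSpec, hU.fromSpec ⁻¹ᵁ U) :=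
      M.presheaf.map (homOfLE (hU.fromSpec.image_preimage_le U)).op x
    let z' : Γ(M.restrict hU.fromSpec, ⊤) := (M.restrict hU.fromSpec).presheaf.map (homOfLE hle).op z
    have h1 : e.hom z' = x := by
      change M.presheaf.map _ (M.presheaf.map _ (M.presheaf.map _ x)) = x
      rw [← ConcreteCategory.comp_apply, ← ConcreteCategory.comp_apply, ← Functor.map_comp,
        ← Functor.map_comp]
      exact congr($(M.presheaf.map_id _) x)
    have h2 : ψ.app ⊤ z' = K.presheaf.map (homOfLE hle).op (ψ.app _ z) := ψ.app_map_homOfLE hle z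
    have h4 : q z' = 0 ↔ x ∈ N := by
      refine Iff.trans ?_ (Submodule.Quotient.mk_eq_zero N)
      change N.mkQ (e.hom z') = 0 ↔ N.mkQ x = 0
      rw [h1]
    rw [← h4, ← hψ z', h2]
    change ψ.app _ z = 0 ↔ _
    exact (map_eq_zero_iff (K.presheaf.map (homOfLE hle).op).hom
      (map_homOfLE_injective K hle le_top)).symm
  · have hle : hU.fromSpec ⁻¹ᵁ (V ⊓ U) ≤ hU.fromSpec ⁻¹ᵁ V :=
      hU.fromSpec.preimage_mono inf_le_left
    refine map_homOfLE_injective K hle ?_ (hy.trans (map_zero _).symm)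
    rw [Scheme.Hom.preimage_inf, hU.fromSpec_preimage_self]
    exact le_inf le_rfl le_top

end AlgebraicGeometry.Scheme.Modules

namespace AlgebraicGeometry.Scheme.Modules

variable {X : Scheme.{u}}

instance [X.IsSeparated] {R : CommRingCat.{u}} (c : Spec R ⟶ X) : IsAffineHom c :=
  have : IsAffineHom (c ≫ terminal.from X) := inferInstance
  IsAffineHom.of_comp c (terminal.from X)

lemma exists_finset_mem_span {M : X.Modules} {U V : X.Opens} (hU : IsAffineOpen U)
    (hV : IsAffineOpen V) (h : V ≤ U) (hMU : M.IsLocalizingOn U) (hMV : M.IsLocalizingOn V)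
    (s : Γ(M, V)) : ∃ T : Finset Γ(M, U),
      s ∈ Submodule.span Γ(X, V) (M.presheaf.map (homOfLE h).op '' (T : Set Γ(M, U))) := by
  classical
  obtain ⟨T, hT, hs⟩ := Submodule.mem_span_finite_of_mem_span (mem_span_range_map hU hV h hMU hMV s)
  rw [← Set.image_univ, Finset.subset_set_image_iff] at hT
  obtain ⟨T', -, rfl⟩ := hT
  exact ⟨T', by simpa using hs⟩

lemma app_eq_zero_of_mem_span {M K : X.Modules} (φ : M ⟶ K) {V : X.Opens} {T : Set Γ(M, V)}
    (hT : ∀ t ∈ T, φ.app V t = 0) {s : Γ(M, V)} (hs : s ∈ Submodule.span Γ(X, V) T) :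
    φ.app V s = 0 := by
  induction hs using Submodule.span_induction with
  | mem x h => exact hT x h
  | zero => exact map_zero _
  | add x y _ _ hx hy => rw [map_add, hx, hy, add_zero]
  | smul a x _ hx => rw [Modules.Hom.app_smul, hx, smul_zero]

/-- Finiteness of the index set lets one exponent serve all components. -/
lemma exists_pow_smul_eq_zero_pi {I : Type u} [Finite I] {K : I → X.Modules} {U : X.Opens}
    (hK : ∀ i, (K i).IsLocalizingOn U) (f : Γ(X, U)) (t : Γ(∏ᶜ K, U))
    (ht : (∏ᶜ K).presheaf.map (homOfLE (X.basicOpen_le f)).op t = 0) : ∃ n : ℕ, f ^ n • t = 0 := by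
  have (i : I) : ∃ n : ℕ, f ^ n • (Pi.π K i).app U t = 0 := by
    refine (hK i).exists_pow_smul f _ ?_
    rw [← Hom.app_map_homOfLE, ht, map_zero]
  choose n hn using this
  obtain ⟨N, hN⟩ := Finite.exists_le n
  refine ⟨N, pi_section_eq_zero _ fun i => ?_⟩
  rw [Modules.Hom.app_smul, ← Nat.sub_add_cancel (hN i), pow_add, mul_smul, hn, smul_zero]

end AlgebraicGeometry.Scheme.Modules

namespace AlgebraicGeometry.Scheme

open Modules

variable {X : Scheme.{u}}

/-- Every section of a quasi-coherent sheaf over an affine open subset lies in the image of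
a coherent sheaf. -/
lemma exists_coh_hom [X.IsSeparated] [CompactSpace X] [IsLocallyNoetherian X] {M : X.Modules}
    (hM : ∀ U : X.Opens, IsAffineOpen U → M.IsLocalizingOn U) {V : X.Opens} (hV : IsAffineOpen V)
    (s : Γ(M, V)) : ∃ (G : Coh X) (i : G.obj ⟶ M) (g : Γ(G.obj, V)), i.app V g = s := by
  obtain ⟨S, hS⟩ := exists_finite_affine_cover X
  have (U : {U : X.Opens // IsAffineOpen U}) : IsAffineHom U.2.fromSpec := inferInstance
  -- For each affine `U` choose finitely many sections of `M` over `U` that generate `s` on `V ⊓ U`.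
  have (U : {U : X.Opens // IsAffineOpen U}) := exists_finset_mem_span U.2 (hV.inf U.2) inf_le_right
    (hM _ U.2) (hM _ (hV.inf U.2)) (M.presheaf.map (homOfLE inf_le_left).op s)
  choose T hT using this
  have (U : {U : X.Opens // IsAffineOpen U}) := exists_hom_of_submodule U.2 (hM _ U.2)
    (Submodule.span Γ(X, U.1) (T U))
  choose K φ hK hφ hK' using this
  let K' (U : S) := K U
  -- The kernel of `Φ` consists of the sections that, on each member of the finite cover, lie in the
  -- submodule generated by the chosen ones. It contains `s` by construction.
  let Φ : M ⟶ ∏ᶜ K' := Pi.lift fun U => φ U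
  have hΦ (U : S) : Φ ≫ Pi.π K' U = φ U := Pi.lift_π _ _
  have hΦ' (U : S) (W : X.Opens) (x : Γ(M, W)) : (Pi.π K' U).app W (Φ.app W x) = (φ U).app W x :=
    congr(Modules.Hom.app $(hΦ U) W x)
  have hs : Φ.app V s = 0 := by
    refine pi_section_eq_zero _ fun U => ?_
    rw [hΦ']
    refine hK' U V _ ?_
    rw [← Hom.app_map_homOfLE]
    refine app_eq_zero_of_mem_span (φ U) ?_ (hT U)
    rintro _ ⟨t, ht, rfl⟩
    rw [Hom.app_map_homOfLE, (hφ U t).2 (Submodule.subset_span ht), map_zero]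
  have hG (U : X.Opens) (hU : IsAffineOpen U) : (kernel Φ).IsLocalizingOn U :=
    isLocalizingOn_kernel Φ (kernel.ι Φ) (kernel.condition Φ) (kernelIsKernel Φ) (hM U hU)
      (exists_pow_smul_eq_zero_pi fun i => hK i U hU)
  obtain ⟨g, hg⟩ := exists_app_kernel_ι Φ (kernel.ι Φ) (kernel.condition Φ) (kernelIsKernel Φ) V s hs
  refine ⟨⟨kernel Φ, (isQuasicoherent_iff_isLocalizingOn _).2 hG, ?_⟩, kernel.ι Φ, g, hg⟩
  refine finite_of_cover hG (fun U : S => U.1) (fun x => ?_) fun U => ?_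
  · obtain ⟨U, hU, hx⟩ := hS x
    exact ⟨⟨U, hU⟩, hx⟩
  · have : IsNoetherianRing Γ(X, U.1.1) := IsLocallyNoetherian.component_noetherian U.1
    let l : Γ(kernel Φ, U.1.1) →ₗ[Γ(X, U.1.1)] Γ(M, U.1.1) :=
      { toFun := (kernel.ι Φ).app U.1.1
        map_add' := map_add _
        map_smul' := Modules.Hom.app_smul (kernel.ι Φ) }
    -- Over a member of the cover, the kernel embeds in a finitely generated submodule, hence is
    -- finite by noetherianity.
    have hl (x) : l x ∈ Submodule.span Γ(X, U.1.1) (T U.1 : Set Γ(M, U.1.1)) := by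
      rw [← hφ U.1, ← hΦ' U]
      refine (congrArg _ ?_).trans (map_zero ((Pi.π K' U).app U.1.1).hom)
      exact congr(Modules.Hom.app $(kernel.condition Φ) U.1.1 x)
    have : Module.Finite Γ(X, U.1.1) (Submodule.span Γ(X, U.1.1) (T U.1 : Set Γ(M, U.1.1))) :=
      Module.Finite.span_of_finite _ (T U.1).finite_toSet
    exact Module.Finite.of_injective (l.codRestrict _ hl) fun x y h =>
      app_injective_of_mono (kernel.ι Φ) _ congr(($h).1)

end AlgebraicGeometry.Scheme

/-! ### Enough flat sheaves -/

namespace AlgebraicGeometry.Scheme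

open Modules

variable {X Y : Scheme.{u}}

lemma epi_of_surjective_of_cover [IsLocallyNoetherian Y] {I : Type u}
    (W : I → {U : Y.Opens // IsAffineOpen U}) (hW : ∀ y, ∃ i, y ∈ (W i).1) {E F : Coh Y}
    (φ : E ⟶ F) (h : ∀ i, Function.Surjective (φ.hom.app (W i).1)) : Epi φ := by
  have hc (y : Y) : ∃ i, y ∈ (W i).2.fromSpec.opensRange := by
    obtain ⟨i, hi⟩ := hW y
    exact ⟨i, by rwa [(W i).2.opensRange_fromSpec]⟩
  refine epi_of_chartSections (fun i => (W i).2.fromSpec) hc φ fun i => ?_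
  rw [ModuleCat.epi_iff_surjective]
  have h' {D : Y.Opens} (hD : D = (W i).1) : Function.Surjective (φ.hom.app D) := by
    subst hD
    exact h i
  exact h' (fromSpec_image_top (W i).2)

variable [IsLocallyNoetherian X] [IsLocallyNoetherian Y] [X.IsSeparated] [CompactSpace X]
  (f : Y ⟶ X) [IsAffineHom f]

omit [IsLocallyNoetherian Y] in
-- A section of `E` over `f ⁻¹ᵁ V` is a section of `f_* E` over `V`, which lies in the image of a
-- coherent `G ⟶ f_* E`. The adjoint morphism from the inverse image of `G` then hits it.
lemma exists_cohPullback_hom (E : Coh Y) {V : X.Opens} (hV : IsAffineOpen V)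
    (e : Γ(E.obj, f ⁻¹ᵁ V)) : ∃ (G : Coh X) (φ : (cohPullback f).obj G ⟶ E)
      (g : Γ(((cohPullback f).obj G).obj, f ⁻¹ᵁ V)), φ.hom.app (f ⁻¹ᵁ V) g = e := by
  obtain ⟨G, i, g, hg⟩ := exists_coh_hom (M := (Modules.pushforward f).obj E.obj)
    (fun U hU => isLocalizingOn_pushforward f (E.2.isLocalizingOn (hU.preimage f))) hV e
  let ψ := ((pullbackPushforwardAdjunction f).homEquiv _ _).symm i
  have h : (pullbackPushforwardAdjunction f).unit.app G.obj ≫ (Modules.pushforward f).map ψ = i := by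
    have := ((pullbackPushforwardAdjunction f).homEquiv _ _).apply_symm_apply i
    rwa [Adjunction.homEquiv_unit] at this
  refine ⟨G, ObjectProperty.homMk ψ, ((pullbackPushforwardAdjunction f).unit.app G.obj).app V g, ?_⟩
  exact (congr(Modules.Hom.app $h V g)).trans hg

lemma exists_hom_of_finset {P : ObjectProperty (Coh Y)} (h0 : ∀ {E : Coh Y}, IsZero E → P E)
    (hb : ∀ {E F : Coh Y}, P E → P F → P (E ⊞ F)) (hP : ∀ G, P ((cohPullback f).obj G)) (E : Coh Y)
    (T : Finset (Σ V : {V : X.Opens // IsAffineOpen V}, Γ(E.obj, f ⁻¹ᵁ V.1))) :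
    ∃ (Q : Coh Y) (_ : P Q) (φ : Q ⟶ E),
      ∀ t ∈ T, t.2 ∈ Set.range (φ.hom.app (f ⁻¹ᵁ t.1.1)) := by
  classical
  induction T using Finset.induction_on with
  | empty => exact ⟨0, h0 (isZero_zero _), 0, by simp⟩
  | insert t T _ ih =>
    obtain ⟨Q, hQ, φ, hφ⟩ := ih
    obtain ⟨G, ψ, g, hg⟩ := exists_cohPullback_hom f E t.1.2 t.2
    refine ⟨_, hb (hP G) hQ, biprod.desc ψ φ, fun t' ht' => ?_⟩
    obtain rfl | ht' := Finset.mem_insert.1 ht'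
    · have h : biprod.inl ≫ biprod.desc ψ φ = ψ := biprod.inl_desc _ _
      exact ⟨biprod.inl (C := Coh Y).hom.app _ g, (congr(Modules.Hom.app ($h).hom _ g)).trans hg⟩
    · obtain ⟨q, hq⟩ := hφ t' ht'
      have h : biprod.inr ≫ biprod.desc ψ φ = φ := biprod.inr_desc _ _
      exact ⟨biprod.inr (C := Coh Y).hom.app _ q, (congr(Modules.Hom.app ($h).hom _ q)).trans hq⟩

/-- Along an affine morphism every coherent sheaf is a quotient of a finite sum of inverse
images of coherent sheaves. -/
lemma exists_epi_of_cohPullback {P : ObjectProperty (Coh Y)} (h0 : ∀ {E : Coh Y}, IsZero E → P E)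
    (hb : ∀ {E F : Coh Y}, P E → P F → P (E ⊞ F)) (hP : ∀ G, P ((cohPullback f).obj G))
    (E : Coh Y) : ∃ (Q : Coh Y) (_ : P Q) (φ : Q ⟶ E), Epi φ := by
  classical
  obtain ⟨S, hS⟩ := exists_finite_affine_cover X
  have (V : {V : X.Opens // IsAffineOpen V}) := (E.2.2 _ (V.2.preimage f)).fg_top
  choose T hT using this
  -- Hitting generators over the preimages of a finite affine cover is enough, because these
  -- preimages are affine.
  obtain ⟨Q, hQ, φ, hφ⟩ := exists_hom_of_finset f h0 hb hP E (S.sigma T)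
  refine ⟨Q, hQ, φ, epi_of_surjective_of_cover
    (fun V : S => ⟨f ⁻¹ᵁ V.1.1, V.1.2.preimage f⟩) (fun y => ?_) φ fun V => ?_⟩
  · obtain ⟨V, hV, hy⟩ := hS (f y)
    exact ⟨⟨V, hV⟩, hy⟩
  · let W : Y.Opens := f ⁻¹ᵁ V.1.1
    change Function.Surjective (φ.hom.app W)
    let R : CommRingCat.{u} := Γ(Y, W)
    let l : Γ(Q.obj, W) →ₗ[R] Γ(E.obj, W) :=
      { toFun := φ.hom.app _
        map_add' := map_add _
        map_smul' := fun a x => Modules.Hom.app_smul φ.hom a x }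
    have hl : LinearMap.range l = ⊤ := by
      rw [eq_top_iff, ← hT V.1, Submodule.span_le]
      intro t ht
      exact hφ ⟨V.1, t⟩ (Finset.mem_sigma.2 ⟨V.2, ht⟩)
    intro y
    obtain ⟨x, hx⟩ : y ∈ LinearMap.range l := by
      rw [hl]
      trivial
    exact ⟨x, hx⟩

end AlgebraicGeometry.Scheme

/-! ### Projective threefolds and the conclusion -/

namespace AlgebraicGeometry.Scheme

open Modules

attribute [local instance] MvPolynomial.gradedAlgebra in
-- The polynomial ring is of finite type over its degree zero part, so `Proj` is quasi-compact over
-- an affine scheme.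
lemma compactSpace_proj_mvPolynomial (k : Type u) [Field k] (n : ℕ) :
    CompactSpace (Proj (MvPolynomial.homogeneousSubmodule (Fin (n + 1)) k)) := by
  have : IsScalarTower k (MvPolynomial.homogeneousSubmodule (Fin (n + 1)) k 0)
      (MvPolynomial (Fin (n + 1)) k) := ⟨fun a b c => smul_mul_assoc a b.1 c⟩
  have : Algebra.FiniteType (MvPolynomial.homogeneousSubmodule (Fin (n + 1)) k 0)
      (MvPolynomial (Fin (n + 1)) k) :=
    Algebra.FiniteType.of_restrictScalars_finiteType k _ _
  exact QuasiCompact.compactSpace_of_compactSpace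
    (Proj.toSpecZero (MvPolynomial.homogeneousSubmodule (Fin (n + 1)) k))

section

variable {k : Type u} [Field k] {X : Scheme.{u}} (p : X ⟶ Spec (.of k))

attribute [local instance] MvPolynomial.gradedAlgebra in
lemma isSeparated_of_isSmoothProjectiveThreefold [h : IsSmoothProjectiveThreefold p] :
    X.IsSeparated := by
  obtain ⟨n, i, hi, -⟩ := h.projective
  have : IsSeparated (i ≫ terminal.from _) := inferInstance
  exact ⟨by rwa [← terminal.comp_from i]⟩

attribute [local instance] MvPolynomial.gradedAlgebra in
lemma compactSpace_of_isSmoothProjectiveThreefold [h : IsSmoothProjectiveThreefold p] :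
    CompactSpace X := by
  obtain ⟨n, i, hi, -⟩ := h.projective
  have := compactSpace_proj_mvPolynomial k n
  exact QuasiCompact.compactSpace_of_compactSpace i

variable (A : Type u) [CommRing A] [Algebra k A]

instance : IsAffineHom (baseChangeFst p A) :=
  MorphismProperty.of_isPullback (P := @IsAffineHom) (isPullback_baseChange p A).flip
    (inferInstanceAs (IsAffineHom (Spec.map (CommRingCat.ofHom (algebraMap k A)))))

instance [CompactSpace X] : CompactSpace (baseChange p A) :=
  QuasiCompact.compactSpace_of_compactSpace (baseChangeFst p A)

end

section

variable {X : Scheme.{u}} [IsLocallyNoetherian X]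

/-- The t-structure on the derived category of coherent sheaves that is obtained by tilting with
respect to the sheaves with support of dimension at most one. -/
def tiltedTStructure (X : Scheme.{u}) [IsLocallyNoetherian X] [CompactSpace X] :
    TStructure (DCoh X) :=
  DerivedCategory.tilt (isSerre_cohLEOne.isTorsionPair isNoetherianObject_coh :
    IsTorsionPair (cohLEOne X) (cohGETwo X))

lemma isTiltedTStructure [CompactSpace X] : IsTiltedTStructure (tiltedTStructure X) where
  le_zero_iff _ := Iff.rfl
  ge_zero_iff _ := Iff.rfl

end

section

variable {k : Type u} [Field k] {X : Scheme.{u}} (p : X ⟶ Spec (.of k))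
  [IsSmoothProjectiveThreefold p]
  {A B : Type u} [CommRing A] [Algebra k A] [IsNoetherianRing A] [CommRing B] [Algebra k B]
  [IsNoetherianRing B]

lemma isAdaptedTo_cohPullback_baseChangeMap (φ : A →ₐ[k] B) (hφ : Function.Surjective φ) :
    (IsFlatOver p A).IsAdaptedTo (cohPullback (baseChangeMap p φ)) := by
  have := isSeparated_of_isSmoothProjectiveThreefold p
  have := compactSpace_of_isSmoothProjectiveThreefold p
  have : IsLocallyNoetherian X := LocallyOfFiniteType.isLocallyNoetherian p
  refine isAdaptedTo_isFlatOver p φ hφ fun E => exists_epi_of_cohPullback (baseChangeFst p A)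
    (isFlatOver_of_isZero p) (isFlatOver_biprod p) (isFlatOver_cohPullback_fst p) E

/-- The common form of both assertions. All geometric input enters here: flat sheaves are adapted,
dimension of support defines a torsion pair, and kernels created by the inverse image stay inside
the support. -/
theorem exists_heartEndofunctor_iso (φ : A →ₐ[k] B) [IsClosedImmersion (baseChangeMap p φ)]
    (hφ : Function.Surjective φ) :
    ∃ (t : TStructure (DCoh (baseChange p B))) (ht : IsTiltedTStructure t)
      (_ : (cohPullback (baseChangeMap p φ)).HasLeftDerivedFunctorMinus),
      Nonempty (ht.heartEndofunctor (baseChangeMap p φ) ≅ 𝟭 t.heart.FullSubcategory) := by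
  have := compactSpace_of_isSmoothProjectiveThreefold p
  have hS := isAdaptedTo_cohPullback_baseChangeMap p φ hφ
  have := hS.hasLeftDerivedFunctorMinus
  exact ⟨tiltedTStructure _, isTiltedTStructure, this,
    nonempty_iso_heart_of_adjunction (cohPullbackPushforwardAdjunction (baseChangeMap p φ))
      (isSerre_cohLEOne.isTorsionPair isNoetherianObject_coh)
      (fun f _ hY => isSerre_cohLEOne.of_mono f hY) hS
      (fun P _ Q hQ r _ => cohLEOne_kernel_cohPullback_map _ hQ r)
      _ (fun n => rfl) _ (Iso.refl _)⟩

end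

end AlgebraicGeometry.Scheme

end

/-- Both parts concern a surjection of noetherian `k`-algebras, from `R` or `R/(π^m)` onto a
quotient by a power of `π`. -/
theorem lemma5p5 {k : Type u} [Field k] [IsAlgClosed k] [CharZero k]
    {R : Type u} [CommRing R] [IsDomain R] [IsDiscreteValuationRing R] [Algebra k R]
    (π : R) (hπ : Irreducible π)
    {X : AlgebraicGeometry.Scheme.{u}} (p : X ⟶ AlgebraicGeometry.Spec (.of k))
    [AlgebraicGeometry.Scheme.IsSmoothProjectiveThreefold p] :
    (∀ m : ℕ, 1 ≤ m →
      ∃ (t : TStructure (AlgebraicGeometry.Scheme.DCoh (AlgebraicGeometry.Scheme.thickening p π m)))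
        (ht : AlgebraicGeometry.Scheme.IsTiltedTStructure t)
        (_ : (AlgebraicGeometry.Scheme.cohPullback
          (AlgebraicGeometry.Scheme.thickeningι p π m)).HasLeftDerivedFunctorMinus),
        Nonempty (ht.heartEndofunctor (AlgebraicGeometry.Scheme.thickeningι p π m) ≅
          𝟭 t.heart.FullSubcategory)) ∧
    (∀ (m' m : ℕ) (h : m' < m), 1 ≤ m' →
      ∃ (t : TStructure (AlgebraicGeometry.Scheme.DCoh (AlgebraicGeometry.Scheme.thickening p π m')))
        (ht : AlgebraicGeometry.Scheme.IsTiltedTStructure t)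
        (_ : (AlgebraicGeometry.Scheme.cohPullback
          (AlgebraicGeometry.Scheme.thickeningMap p π h.le)).HasLeftDerivedFunctorMinus),
        Nonempty (ht.heartEndofunctor (AlgebraicGeometry.Scheme.thickeningMap p π h.le) ≅
          𝟭 t.heart.FullSubcategory)) := by
  refine ⟨fun m _ => ?_, fun m' m h _ => ?_⟩
  · have : IsClosedImmersion (AlgebraicGeometry.Scheme.baseChangeMap p
        (Ideal.Quotient.mkₐ k (Ideal.span {π ^ m}))) :=
      inferInstanceAs (IsClosedImmersion (AlgebraicGeometry.Scheme.thickeningι p π m))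
    exact AlgebraicGeometry.Scheme.exists_heartEndofunctor_iso p _
      (Ideal.Quotient.mkₐ_surjective k _)
  · have : IsClosedImmersion (AlgebraicGeometry.Scheme.baseChangeMap p
        (Ideal.Quotient.factorₐ k (AlgebraicGeometry.Scheme.span_pow_le π h.le))) :=
      inferInstanceAs (IsClosedImmersion (AlgebraicGeometry.Scheme.thickeningMap p π h.le))
    exact AlgebraicGeometry.Scheme.exists_heartEndofunctor_iso p _
      (Ideal.Quotient.factor_surjective (AlgebraicGeometry.Scheme.span_pow_le π h.le))
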